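/- \textbf{Theorem (Duality transformation formula of type $C$).} Let $\Omega=\mathbb{Z}\omega_1\oplus\mathbb{Z}\omega_2\subset\mathbb{C}$, where $\omega_1,\omega_2$ are linearly independent over $\mathbb{R}$, let $c\in\mathbb{C}$, and put $$[u]=e^{2\pi\sqrt{-1}\,c u^2}\,\sigma(u;\Omega),\qquad \sigma(u;\Omega)=u\prod_{\omega\in\Omega\setminus\{0\}}\Bigl(1-\frac{u}{\omega}\Bigr)e^{\frac{u}{\omega}+\frac{u^2}{2\omega^2}} .$$ Let $\delta\in\mathbb{C}\setminus\{0\}$ with $\mathbb{Z}\delta\cap\Omega=\{0\}$, and write $[u]_k=[u][u+\delta]\cdots[u+(k-1)\delta]$ for $k=0,1,2,\ldots$ and $[u\pm v]=[u+v][u-v]$. For any complex parameters $(a_0,a_1,a_2,a_3)$ define $(b_0,b_1,b_2,b_3)$ by $b_p=\frac{\delta}{2}-a_p$. Let $\alpha\in\mathbb{N}^m$, $\beta\in\mathbb{N}^n$ (with $0\in\mathbb{N}$) be multi-indices with $|\alpha|=\sum_i\alpha_i=M$ and $|\beta|=\sum_k\beta_k=N$, where $m,n,M,N$ may be different. For $\alpha\in\mathbb{N}^m$,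 $x=(x_1,\ldots,x_m)$ and $u=(u_1,\ldots,u_r)$ let $$\Phi_\alpha(x|u)=\sum_{0\le\mu\le\alpha}\ \prod_{i=1}^m\frac{[2x_i+2\mu_i\delta]}{[2x_i]}\prod_{1\le i<j\le m}\frac{[(x_i+\mu_i\delta)\pm(x_j+\mu_j\delta)]}{[x_i\pm x_j]} \prod_{1\le i,j\le m}\frac{[x_i+x_j]_{\mu_i}[x_i-x_j-\alpha_j\delta]_{\mu_i}}{[x_i+x_j+(\alpha_j+1)\delta]_{\mu_i}[x_i-x_j+\delta]_{\mu_i}} \prod_{i=1}^m\prod_{k=1}^r\frac{[x_i+u_k]_{\mu_i}}{[x_i-u_k+\delta]_{\mu_i}},$$ the sum being over all $\mu\in\mathbb{N}^m$ with $\mu_i\le\alpha_i$ for all $i$. Under the balancing condition $\sum_{p=0}^3a_p=(N-M+1)\delta$, the following identity holds for two sets of variables $x=(x_1,\ldots,x_m)$ and $y=(y_1,\ldots,y_n)$, that is, at all $x\in\mathbb{C}^m$, $y\in\mathbb{C}^n$ for which none of the denominators on either side vanishes: $$\begin{aligned} &\prod_{1\le p<q\le3}[b_p+b_q]_N\ \prod_{i=1}^m\frac{\prod_{p=0}^3[x_i+\frac{\delta}{2}+a_p]_{\alpha_i}}{[2x_i+\delta]_{\alpha_i}}\prod_{1\le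 i<j\le m}\frac{[x_i+x_j+(\alpha_j+1)\delta]_{\alpha_i}}{[x_i+x_j+\delta]_{\alpha_i}}\\ &\qquad\cdot\Phi_\alpha\Bigl(x\Big|(\tfrac{\delta}{2}-a_p)_{0\le p\le3},\,(\tfrac{\delta}{2}+y_k+\beta_k\delta,\ \tfrac{\delta}{2}-y_k)_{1\le k\le n}\Bigr)\\ &=(-1)^N\prod_{p=1}^3[a_0+a_p]_M\ \prod_{k=1}^n\prod_{i=1}^m\frac{[y_k-x_i+\frac{\delta}{2}-\alpha_i\delta]_{\beta_k}}{[y_k-x_i+\frac{\delta}{2}]_{\beta_k}}\\ &\qquad\cdot\prod_{k=1}^n\frac{\prod_{p=0}^3[y_k+\frac{\delta}{2}+b_p]_{\beta_k}}{[2y_k+\delta]_{\beta_k}}\prod_{1\le k<l\le n}\frac{[y_k+y_l+(\beta_l+1)\delta]_{\beta_k}}{[y_k+y_l+\delta]_{\beta_k}}\\ &\qquad\cdot\Phi_\beta\Bigl(y\Big|(\tfrac{\delta}{2}-b_p)_{0\le p\le3},\,(\tfrac{\delta}{2}+x_i+\alpha_i\delta,\ \tfrac{\delta}{2}-x_i)_{1\le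 i\le m}\Bigr). \end{aligned}$$ -/

import Mathlib

noncomputable section

namespace EllipticC

/-- The Weierstrass sigma function of the lattice `Ω = ℤ ω₁ ⊕ ℤ ω₂`:
`σ(u; Ω) = u ∏_{ω ∈ Ω, ω ≠ 0} (1 - u/ω) exp(u/ω + u²/(2ω²))`. -/
def sigma (L : PeriodPair) (u : ℂ) : ℂ :=
  u * ∏' ω : {ω : L.lattice // ω ≠ 0},
    (1 - u / (ω : ℂ)) * Complex.exp (u / (ω : ℂ) + u ^ 2 / (2 * (ω : ℂ) ^ 2))

/-- The function `[u] = e(c u²) σ(u; Ω)`, where `e(v) = exp(2π√-1 v)`. -/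
def bracket (L : PeriodPair) (c u : ℂ) : ℂ :=
  Complex.exp (2 * (Real.pi : ℂ) * Complex.I * (c * u ^ 2)) * sigma L u

/-- The shifted factorial `[u]_k = [u][u+δ]⋯[u+(k-1)δ]`, with `br` in the role of `[·]`. -/
def shifted (br : ℂ → ℂ) (δ u : ℂ) (k : ℕ) : ℂ :=
  ∏ r ∈ Finset.range k, br (u + r * δ)

/-- The factor in front of the series:
`∏_i (∏_p [x_i+δ/2+a_p]_{α_i}) / [2x_i+δ]_{α_i}
  · ∏_{i<j} [x_i+x_j+(α_j+1)δ]_{α_i} / [x_i+x_j+δ]_{α_i}`. -/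
def prefactor (br : ℂ → ℂ) (δ : ℂ) (a : Fin 4 → ℂ) {m : ℕ} (α : Fin m → ℕ)
    (x : Fin m → ℂ) : ℂ :=
  (∏ i, (∏ p, shifted br δ (x i + δ / 2 + a p) (α i)) / shifted br δ (2 * x i + δ) (α i)) *
  ∏ i, ∏ j ∈ Finset.Ioi i,
    shifted br δ (x i + x j + (α j + 1) * δ) (α i) / shifted br δ (x i + x j + δ) (α i)

/-- The term of index `μ` of the series of type `C_m`. -/
def term (br : ℂ → ℂ) (δ : ℂ) (a : Fin 4 → ℂ) {m n : ℕ} (α : Fin m → ℕ) (β : Fin n → ℕ)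
    (x : Fin m → ℂ) (y : Fin n → ℂ) (μ : Fin m → ℕ) : ℂ :=
  (∏ i, ∏ p,
    shifted br δ (x i + δ / 2 - a p) (μ i) / shifted br δ (x i + δ / 2 + a p) (μ i)) *
  (∏ i, br (2 * x i + 2 * μ i * δ) / br (2 * x i)) *
  (∏ i, ∏ j ∈ Finset.Ioi i,
    (br ((x i + μ i * δ) + (x j + μ j * δ)) * br ((x i + μ i * δ) - (x j + μ j * δ))) /
      (br (x i + x j) * br (x i - x j))) *
  (∏ i, ∏ j,
    (shifted br δ (x i + x j) (μ i) * shifted br δ (x i - x j - α j * δ) (μ i)) /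
      (shifted br δ (x i + x j + (α j + 1) * δ) (μ i) * shifted br δ (x i - x j + δ) (μ i))) *
  ∏ i, ∏ k,
    (shifted br δ (x i + y k + δ / 2 + β k * δ) (μ i) *
        shifted br δ (x i - y k + δ / 2) (μ i)) /
      (shifted br δ (x i + y k + δ / 2) (μ i) *
        shifted br δ (x i - y k + δ / 2 - β k * δ) (μ i))

/-- The multiple series of type `C_m` in the variables `x`,
`Φ_α(x | (δ/2-a_p)_p, (δ/2+y_k+β_kδ, δ/2-y_k)_k)`: the sum over all `0 ≤ μ ≤ α`. -/
def series (br : ℂ → ℂ) (δ : ℂ) (a : Fin 4 → ℂ) {m n : ℕ} (α : Fin m → ℕ) (β : Fin n → ℕ)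
    (x : Fin m → ℂ) (y : Fin n → ℂ) : ℂ :=
  ∑ μ ∈ Finset.Icc 0 α, term br δ a α β x y μ

/-- None of the denominators in `prefactor br δ a α x` and `series br δ a α β x y` vanishes.
(The denominators `[·]_{μ_i}` with `μ_i ≤ α_i` divide `[·]_{α_i}`; the denominator
`[x_i-x_i+δ]_{α_i} = [δ]_{α_i}` does not depend on the variables and is not listed.) -/
structure DenomNeZero (br : ℂ → ℂ) (δ : ℂ) (a : Fin 4 → ℂ) {m n : ℕ} (α : Fin m → ℕ)
    (β : Fin n → ℕ) (x : Fin m → ℂ) (y : Fin n → ℂ) : Prop where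
  param : ∀ i p, shifted br δ (x i + δ / 2 + a p) (α i) ≠ 0
  double : ∀ i, br (2 * x i) ≠ 0
  double_shifted : ∀ i, shifted br δ (2 * x i + δ) (α i) ≠ 0
  add : ∀ i j, i < j → br (x i + x j) ≠ 0
  sub : ∀ i j, i < j → br (x i - x j) ≠ 0
  add_shifted : ∀ i j, i < j → shifted br δ (x i + x j + δ) (α i) ≠ 0
  add_shifted' : ∀ i j, shifted br δ (x i + x j + (α j + 1) * δ) (α i) ≠ 0
  sub_shifted : ∀ i j, i ≠ j → shifted br δ (x i - x j + δ) (α i) ≠ 0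
  cross_add : ∀ i k, shifted br δ (x i + y k + δ / 2) (α i) ≠ 0
  cross_sub : ∀ i k, shifted br δ (x i - y k + δ / 2 - β k * δ) (α i) ≠ 0

end EllipticC

end

/-! The identity is a determinant identity specialized to arithmetic progressions. Apart from
nonvanishing, the algebra uses only two properties of [·]: it is odd, and it satisfies Weierstrass'
three-term relation. The relation comes from σ(x+y)σ(x-y) = σ(x)²σ(y)²(℘(y)-℘(x)), which is proved
by Liouville's theorem from the quasi-periodicity of σ (`exists_sigma_add`,
`sigma_add_mul_sigma_sub`, `three_term_bracket`).

The three-term relation gives a partial fraction identity with four nodes. At the nodes X, -X,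
Y-δ/2, -Y-δ/2 it becomes a kernel identity (`kernel_identity`): if ∑ a_p = δ, a sum over the two
signs of X equals the same kind of sum over the signs of Y, with a_p replaced by δ/2 - a_p. Taking
the determinant of this identity over sets of points X_p, Y_q of equal size and expanding by rows
gives sums over sign vectors whose terms are Cauchy determinants, evaluated by `det_cauchy`
(`signSum_duality`). This is the theorem with all multiplicities equal to one.

Now let the X_p run through the strings x_i + δ/2 + rδ, 0 ≤ r < α_i. A sign vector having a plus
followed by a minus inside a string produces two equal rows, so only the vectors with minus signs
for r < μ_i and plus signs afterwards survive; these are indexed by 0 ≤ μ ≤ α (`signSum_node`). The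
term of index μ divided by the term of index 0 is the summand of Φ_α (`strTerm_eq`), and the term of
index 0 is the prefactor times a product that matches the one on the other side up to a sign and the
cross factor (`strTerm_zero`, `prod_pm_node_swap`). This settles M = N for generic data
(`duality_of_sum_eq`).

If M = N + d, one more variable of multiplicity d is adjoined to y at the point -(a_0 + dδ). On the
x side its only effect is to shift a parameter; on the y side it forces the new summation index to
be 0 (`duality_of_sum_eq_add`). The case M ≤ N follows by exchanging the two sides. Arbitrary
admissible data are limits of generic ones along a complex line that preserves the balancing
condition. -/

noncomputable section

namespace EllipticC

/-! ### The Weierstrass product for σ: convergence, zeros, parity -/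

open Filter Topology PeriodPair

/-- The genus-two Weierstrass elementary factor `(1 - t) exp(t + t²/2)`, minus one, is `O(t³)`. -/
lemma norm_elementaryFactor_sub_one_le {t : ℂ} (ht : ‖t‖ ≤ 1 / 2) :
    ‖(1 - t) * Complex.exp (t + t ^ 2 / 2) - 1‖ ≤ 2 * ‖t‖ ^ 3 := by
  have h1 : (1 - t) ≠ 0 := by
    intro h
    have : t = 1 := by linear_combination -h
    rw [this] at ht; norm_num at ht
  -- The elementary factor is the exponential of the remainder of log(1-t) after its second Taylor
  -- polynomial -t - t²/2, and this remainder is cubic in t.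
  have key := Complex.norm_log_sub_logTaylor_le 2 (z := -t) (by rw [norm_neg]; linarith)
  have hT : Complex.logTaylor (2 + 1) (-t) = -t - t ^ 2 / 2 := by
    simp [Complex.logTaylor, Finset.sum_range_succ]; ring
  rw [hT, norm_neg] at key
  have hb : ‖Complex.log (1 + -t) - (-t - t ^ 2 / 2)‖ ≤ ‖t‖ ^ 3 := by
    refine key.trans ?_
    have : (1 - ‖t‖)⁻¹ ≤ 2 := by
      rw [inv_le_comm₀ (by linarith) (by norm_num)]; linarith
    norm_num
    have h3 : 0 ≤ ‖t‖ ^ 3 := by positivity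
    nlinarith [mul_le_mul_of_nonneg_left this h3]
  have he : (1 - t) * Complex.exp (t + t ^ 2 / 2) =
      Complex.exp (Complex.log (1 + -t) - (-t - t ^ 2 / 2)) := by
    rw [Complex.exp_sub, Complex.exp_log (by simpa [sub_eq_add_neg] using h1),
      eq_div_iff (Complex.exp_ne_zero _), mul_assoc, ← Complex.exp_add]
    ring_nf; simp [sub_eq_add_neg, add_comm]
  have h3 : ‖t‖ ^ 3 ≤ 1 := pow_le_one₀ (norm_nonneg _) (by linarith)
  rw [he]
  exact (Complex.norm_exp_sub_one_le (hb.trans h3)).trans (by linarith)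

variable (L : PeriodPair)

/-- The factor of the Weierstrass product of `sigma` at a nonzero lattice point. -/
def sigmaFactor (ω : {ω : L.lattice // ω ≠ 0}) (u : ℂ) : ℂ :=
  (1 - u / (ω : ℂ)) * Complex.exp (u / (ω : ℂ) + u ^ 2 / (2 * (ω : ℂ) ^ 2))

/-- The Weierstrass product of `sigma` without the factor `u`. -/
def sigmaProd (u : ℂ) : ℂ := ∏' ω, sigmaFactor L ω u

lemma sigma_eq (u : ℂ) : sigma L u = u * sigmaProd L u := rfl

variable {L}

lemma coe_ne_zero_of_ne (ω : {ω : L.lattice // ω ≠ 0}) : (ω : ℂ) ≠ 0 := by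
  intro h
  exact ω.2 (by ext; simpa using h)

lemma differentiable_sigmaFactor (ω : {ω : L.lattice // ω ≠ 0}) :
    Differentiable ℂ (sigmaFactor L ω) := by
  unfold sigmaFactor; fun_prop

lemma norm_sigmaFactor_sub_one_le {ω : {ω : L.lattice // ω ≠ 0}} {u : ℂ}
    (h : 2 * ‖u‖ ≤ ‖(ω : ℂ)‖) :
    ‖sigmaFactor L ω u - 1‖ ≤ 2 * ‖u‖ ^ 3 * ‖(ω : ℂ)‖⁻¹ ^ 3 := by
  have hω : 0 < ‖(ω : ℂ)‖ := norm_pos_iff.mpr (coe_ne_zero_of_ne ω)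
  have := norm_elementaryFactor_sub_one_le (t := u / ω)
    (by rw [norm_div, div_le_iff₀ hω]; linarith)
  rw [norm_div, div_pow, div_pow] at this
  rw [sigmaFactor, inv_pow]
  convert this using 1
  · congr 5; field_simp
  · ring

/-- The exponent 3 exceeds the rank 2 of the lattice; this is why the elementary factors carry
second-order exponents. -/
lemma summable_inv_norm_cube : Summable fun ω : {ω : L.lattice // ω ≠ 0} ↦ ‖(ω : ℂ)‖⁻¹ ^ 3 :=
  (ZLattice.summable_norm_pow_inv L.lattice 3 (by simp)).subtype _

lemma eventually_two_mul_le_norm (r : ℝ) :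
    ∀ᶠ ω : {ω : L.lattice // ω ≠ 0} in cofinite, 2 * r ≤ ‖(ω : ℂ)‖ := by
  have : {l : L.lattice | ¬ 2 * r ≤ ‖(l : ℂ)‖}.Finite := by
    refine (isCompact_iff_finite.mp (isCompact_closedBall (0 : L.lattice) (2 * r))).subset ?_
    intro l hl
    simpa using (not_le.mp hl).le
  exact this.preimage (f := fun ω : {ω : L.lattice // ω ≠ 0} ↦ ω.1)
    Subtype.val_injective.injOn

/-- Weierstrass M-test: on a compact set the cubic bound holds for all but finitely many ω. -/
lemma hasProdLocallyUniformlyOn_sigmaFactor :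
    HasProdLocallyUniformlyOn (sigmaFactor L) (sigmaProd L) Set.univ := by
  refine hasProdLocallyUniformlyOn_of_forall_compact isOpen_univ fun K _ hK ↦ ?_
  obtain ⟨r, hr⟩ := hK.isBounded.exists_norm_le
  have := Summable.hasProdUniformlyOn_one_add (f := fun ω u ↦ sigmaFactor L ω u - 1) hK
    ((summable_inv_norm_cube (L := L)).mul_left (2 * r ^ 3))
    (by
      filter_upwards [eventually_two_mul_le_norm r] with ω hω u hu
      refine (norm_sigmaFactor_sub_one_le (by linarith [hr u hu])).trans ?_
      gcongr
      exact hr u hu)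
    (fun ω ↦ ((differentiable_sigmaFactor ω).continuous.sub continuous_const).continuousOn)
  simpa only [add_sub_cancel] using! this

lemma differentiable_sigmaProd : Differentiable ℂ (sigmaProd L) := by
  rw [← differentiableOn_univ]
  refine hasProdLocallyUniformlyOn_sigmaFactor.differentiableOn (.of_forall fun s ↦ ?_) isOpen_univ
  exact .fun_finsetProd fun i _ ↦ (differentiable_sigmaFactor i).differentiableOn

lemma differentiable_sigma : Differentiable ℂ (sigma L) :=
  differentiable_id.mul differentiable_sigmaProd

lemma sigmaFactor_eq_zero_iff {ω : {ω : L.lattice // ω ≠ 0}} {u : ℂ} :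
    sigmaFactor L ω u = 0 ↔ u = ω := by
  have := coe_ne_zero_of_ne ω
  rw [sigmaFactor, mul_eq_zero, or_iff_left (Complex.exp_ne_zero _), sub_eq_zero, eq_div_iff this]
  constructor <;> intro h <;> simpa using h.symm

lemma sigmaProd_ne_zero {u : ℂ} (hu : ∀ ω : L.lattice, ω ≠ 0 → u ≠ ω) : sigmaProd L u ≠ 0 := by
  have := tprod_one_add_ne_zero_of_summable (f := fun ω ↦ sigmaFactor L ω u - 1)
    (fun ω ↦ by simpa [sigmaFactor_eq_zero_iff] using hu ω.1 ω.2)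
    (by
      refine .of_norm_bounded_eventually (((summable_inv_norm_cube (L := L)).mul_left (2 * ‖u‖ ^ 3))) ?_
      filter_upwards [eventually_two_mul_le_norm ‖u‖] with ω hω
      simpa using norm_sigmaFactor_sub_one_le hω)
  simpa only [add_sub_cancel] using! this

lemma sigma_eq_zero_iff {u : ℂ} : sigma L u = 0 ↔ u ∈ L.lattice := by
  constructor
  · intro h
    by_contra hu
    rw [sigma_eq, mul_eq_zero] at h
    rcases h with rfl | h
    · exact hu (zero_mem _)
    · exact sigmaProd_ne_zero (u := u) (fun ω _ h ↦ hu (h ▸ ω.2)) h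
  · intro hu
    by_cases h0 : u = 0
    · simp [sigma_eq, h0]
    · rw [sigma_eq, sigmaProd, tprod_of_exists_eq_zero, mul_zero]
      exact ⟨⟨⟨u, hu⟩, by simpa [Subtype.ext_iff] using h0⟩, sigmaFactor_eq_zero_iff.mpr rfl⟩

lemma sigmaProd_neg (u : ℂ) : sigmaProd L (-u) = sigmaProd L u := by
  let e : {ω : L.lattice // ω ≠ 0} ≃ {ω : L.lattice // ω ≠ 0} :=
    (Equiv.neg L.lattice).subtypeEquiv (by simp)
  rw [sigmaProd, ← e.tprod_eq]
  refine tprod_congr fun ω ↦ ?_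
  simp [sigmaFactor, e, neg_div_neg_eq]

lemma sigma_neg (u : ℂ) : sigma L (-u) = -sigma L u := by
  rw [sigma_eq, sigma_eq, sigmaProd_neg, neg_mul]

lemma sigmaProd_zero : sigmaProd L 0 = 1 := by simp [sigmaProd, sigmaFactor]

lemma isConnected_compl_lattice : IsConnected (L.lattice : Set ℂ)ᶜ :=
  Set.Countable.isConnected_compl_of_one_lt_rank (by simp)
    (countable_of_Lindelof_of_discrete (X := L.lattice))

lemma dense_compl_lattice : Dense (L.lattice : Set ℂ)ᶜ :=
  Set.Countable.dense_compl ℂ (countable_of_Lindelof_of_discrete (X := L.lattice))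

lemma isOpen_compl_lattice : IsOpen (L.lattice : Set ℂ)ᶜ := L.isClosed_lattice.isOpen_compl

/-! ### Second logarithmic derivative of σ and quasi-periodicity -/

lemma deriv_logDeriv {f : ℂ → ℂ} (hf : Differentiable ℂ f) {z : ℂ} (hz : f z ≠ 0) :
    deriv (logDeriv f) z = (deriv (deriv f) z * f z - deriv f z ^ 2) / f z ^ 2 := by
  have hd : Differentiable ℂ (deriv f) := fun z ↦
    (hf.analyticAt z).deriv.differentiableAt
  have : logDeriv f = fun z ↦ deriv f z / f z := rfl
  rw [this, deriv_fun_div (hd z) (hf z) hz]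
  ring

/-- Locally uniform convergence of the partial products passes to first and second derivatives, and
(log f)'' is a rational expression in f, f', f''. No branch of the logarithm is needed. -/
lemma hasSum_deriv_logDeriv_sigmaProd {z : ℂ} (hz : z ∉ L.lattice) :
    HasSum (fun ω ↦ deriv (logDeriv (sigmaFactor L ω)) z) (deriv (logDeriv (sigmaProd L)) z) := by
  have hF (s : Finset {ω : L.lattice // ω ≠ 0}) :
      Differentiable ℂ (fun u ↦ ∏ ω ∈ s, sigmaFactor L ω u) :=
    .fun_finsetProd fun i _ ↦ differentiable_sigmaFactor i
  have hne (ω : {ω : L.lattice // ω ≠ 0}) {w : ℂ} (hw : w ∉ L.lattice) :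
      sigmaFactor L ω w ≠ 0 := fun h ↦ hw (sigmaFactor_eq_zero_iff.mp h ▸ ω.1.2)
  have h0 := hasProdLocallyUniformlyOn_sigmaFactor (L := L)
  rw [hasProdLocallyUniformlyOn_iff_tendstoLocallyUniformlyOn] at h0
  have h1 := h0.deriv (.of_forall fun s ↦ (hF s).differentiableOn) isOpen_univ
  have h2 := h1.deriv (.of_forall fun s ↦ ((hF s).differentiableOn).deriv isOpen_univ) isOpen_univ
  have hP := sigmaProd_ne_zero (u := z) (fun ω _ h ↦ hz (h ▸ ω.2))
  rw [deriv_logDeriv differentiable_sigmaProd hP]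
  refine Tendsto.congr' ?_ ((((h2.tendsto_at (Set.mem_univ z)).mul (h0.tendsto_at
    (Set.mem_univ z))).sub ((h1.tendsto_at (Set.mem_univ z)).pow 2)).div
      ((h0.tendsto_at (Set.mem_univ z)).pow 2) (pow_ne_zero 2 hP))
  refine .of_forall fun s ↦ ?_
  have := deriv_logDeriv (hF s) (z := z) (Finset.prod_ne_zero_iff.mpr fun ω _ ↦ hne ω hz)
  refine Eq.trans ?_ (this.symm.trans ?_)
  · rfl
  refine Eq.trans ?_ (deriv_fun_sum (A := fun ω w ↦ logDeriv (sigmaFactor L ω) w) ?_)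
  · refine EventuallyEq.deriv_eq ?_
    filter_upwards [isOpen_compl_lattice.mem_nhds hz] with w hw
    rw [logDeriv_prod (fun i _ ↦ hne i hw) fun i _ ↦ differentiable_sigmaFactor i w]
  · intro ω _
    have : logDeriv (sigmaFactor L ω) = fun z ↦ deriv (sigmaFactor L ω) z / sigmaFactor L ω z := rfl
    rw [this]
    exact ((differentiable_sigmaFactor ω).analyticAt z).deriv.differentiableAt.div
      (differentiable_sigmaFactor ω z) (hne ω hz)

lemma logDeriv_sigmaFactor {ω : {ω : L.lattice // ω ≠ 0}} {z : ℂ} (hz : z ≠ ω) :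
    logDeriv (sigmaFactor L ω) z = 1 / (z - ω) + 1 / (ω : ℂ) + z / (ω : ℂ) ^ 2 := by
  have hω := coe_ne_zero_of_ne ω
  have h1 : (1 - z / (ω : ℂ)) ≠ 0 := by
    rw [sub_ne_zero, Ne, eq_div_iff hω]; simpa using hz.symm
  have h2 : z - ω ≠ 0 := sub_ne_zero.mpr hz
  have hd : HasDerivAt (sigmaFactor L ω) (-(1 / (ω : ℂ)) *
      Complex.exp (z / (ω : ℂ) + z ^ 2 / (2 * (ω : ℂ) ^ 2)) + (1 - z / (ω : ℂ)) *
      (Complex.exp (z / (ω : ℂ) + z ^ 2 / (2 * (ω : ℂ) ^ 2)) *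
        (1 / (ω : ℂ) + 2 * z / (2 * (ω : ℂ) ^ 2)))) z := by
    have ha : HasDerivAt (fun u : ℂ ↦ 1 - u / (ω : ℂ)) (-(1 / (ω : ℂ))) z :=
      ((hasDerivAt_id z).div_const _).const_sub 1
    have hb : HasDerivAt (fun u : ℂ ↦ u / (ω : ℂ) + u ^ 2 / (2 * (ω : ℂ) ^ 2))
        (1 / (ω : ℂ) + 2 * z / (2 * (ω : ℂ) ^ 2)) z := by
      simpa using! ((hasDerivAt_id z).div_const (ω : ℂ)).add
        (((hasDerivAt_id z).pow 2).div_const (2 * (ω : ℂ) ^ 2))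
    exact ha.mul hb.cexp
  rw [logDeriv_apply, hd.deriv, sigmaFactor]
  have h3 : (1 - z / (ω : ℂ)) = -(z - ω) / ω := by field_simp; ring
  rw [h3]
  have := Complex.exp_ne_zero (z / (ω : ℂ) + z ^ 2 / (2 * (ω : ℂ) ^ 2))
  field_simp
  ring

lemma deriv_logDeriv_sigmaFactor {ω : {ω : L.lattice // ω ≠ 0}} {z : ℂ} (hz : z ≠ ω) :
    deriv (logDeriv (sigmaFactor L ω)) z = -(1 / (z - ω) ^ 2 - 1 / (ω : ℂ) ^ 2) := by
  have : logDeriv (sigmaFactor L ω) =ᶠ[𝓝 z]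
      fun z ↦ 1 / (z - ω) + 1 / (ω : ℂ) + z / (ω : ℂ) ^ 2 := by
    filter_upwards [isOpen_ne.mem_nhds hz] with w hw using logDeriv_sigmaFactor hw
  rw [this.deriv_eq]
  have h2 : z - ω ≠ 0 := sub_ne_zero.mpr hz
  have ha : HasDerivAt (fun u : ℂ ↦ 1 / (u - ω) + 1 / (ω : ℂ) + u / (ω : ℂ) ^ 2)
      (-1 / (z - ω) ^ 2 + 1 / (ω : ℂ) ^ 2) z := by
    simpa using! ((((hasDerivAt_id z).sub_const (ω : ℂ)).inv h2).add_const (1 / (ω : ℂ))).add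
      ((hasDerivAt_id z).div_const ((ω : ℂ) ^ 2))
  rw [ha.deriv]; ring

lemma deriv_logDeriv_sigmaProd {z : ℂ} (hz : z ∉ L.lattice) :
    deriv (logDeriv (sigmaProd L)) z = -℘[L - (0 : ℂ)] z := by
  have h1 := hasSum_deriv_logDeriv_sigmaProd hz
  have h2 := (L.hasSum_weierstrassPExcept 0 z).neg
  refine h1.unique ?_
  -- `weierstrassPExcept` sums over the whole lattice with the term at 0 replaced by 0, so
  -- restricting to nonzero lattice points loses nothing.
  rw [← Function.Injective.hasSum_iff (f := _) (Subtype.val_injective (p := fun ω : L.lattice ↦ ω ≠ 0))] at h2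
  · refine (Eq.to_iff (congrArg (HasSum · _) (funext fun ω ↦ ?_))).mp h2
    have hzω : z ≠ ω := by rintro rfl; exact hz ω.1.2
    rw [deriv_logDeriv_sigmaFactor hzω]
    simp [ω.2]
  · intro l hl
    have : l = 0 := by simpa using hl
    simp [this]

lemma deriv_logDeriv_sigma {z : ℂ} (hz : z ∉ L.lattice) :
    deriv (logDeriv (sigma L)) z = -℘[L] z := by
  have hz0 : z ≠ 0 := fun h ↦ hz (h ▸ zero_mem _)
  have h1 : logDeriv (sigma L) =ᶠ[𝓝 z] fun w ↦ w⁻¹ + logDeriv (sigmaProd L) w := by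
    filter_upwards [isOpen_compl_lattice.mem_nhds hz] with w hw
    have hw0 : w ≠ 0 := fun h ↦ hw (h ▸ zero_mem _)
    have := logDeriv_mul (f := fun u ↦ u) (g := sigmaProd L) w hw0
      (sigmaProd_ne_zero (u := w) (fun ω _ h ↦ hw (h ▸ ω.2))) differentiableAt_fun_id
      (differentiable_sigmaProd w)
    rw [show sigma L = fun u ↦ u * sigmaProd L u from rfl, this]
    simp [logDeriv_apply]
  have hP := sigmaProd_ne_zero (u := z) (fun ω _ h ↦ hz (h ▸ ω.2))
  have hd : DifferentiableAt ℂ (logDeriv (sigmaProd L)) z :=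
    (differentiable_sigmaProd.analyticAt z).deriv.differentiableAt.div
      (differentiable_sigmaProd z) hP
  rw [h1.deriv_eq, deriv_fun_add (differentiableAt_inv hz0) hd, deriv_logDeriv_sigmaProd hz,
    deriv_inv]
  have := L.weierstrassPExcept_add 0 z
  simp only [ZeroMemClass.coe_zero] at this
  rw [← this]; simp

/-- Quasi-periodicity of the Weierstrass sigma function. -/
lemma exists_sigma_add (l : L.lattice) :
    ∃ C η : ℂ, ∀ z, sigma L (z + l) = C * Complex.exp (η * z) * sigma L z := by
  have hmem {z : ℂ} (hz : z ∉ L.lattice) : z + l ∉ L.lattice := fun h ↦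
    hz (by simpa using sub_mem h l.2)
  have hne {z : ℂ} (hz : z ∉ L.lattice) : sigma L z ≠ 0 := mt sigma_eq_zero_iff.mp hz
  have hS : Differentiable ℂ (fun z ↦ sigma L (z + l)) :=
    differentiable_sigma.comp (differentiable_id.add_const _)
  have hlogd {f : ℂ → ℂ} (hf : Differentiable ℂ f) {z : ℂ} (hz : f z ≠ 0) :
      DifferentiableAt ℂ (logDeriv f) z :=
    (hf.analyticAt z).deriv.differentiableAt.div (hf z) hz
  -- The difference of the two logarithmic derivatives has derivative -℘(z+l) + ℘(z) = 0, and the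
  -- complement of the countable set Ω is connected. So it is a constant η, and σ(z+l) is a constant
  -- multiple of exp(ηz)σ(z).
  obtain ⟨η, hη⟩ := isOpen_compl_lattice.exists_is_const_of_deriv_eq_zero
    (isConnected_compl_lattice (L := L)).isPreconnected
    (f := fun z ↦ logDeriv (fun z ↦ sigma L (z + l)) z - logDeriv (sigma L) z)
    (fun z hz ↦ ((hlogd hS (hne (hmem hz))).sub
      (hlogd differentiable_sigma (hne hz))).differentiableWithinAt)
    (fun z hz ↦ by
      have h1 : logDeriv (fun z ↦ sigma L (z + l)) = fun z ↦ logDeriv (sigma L) (z + l) := by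
        ext w; simp [logDeriv_apply, deriv_comp_add_const]
      rw [deriv_fun_sub (hlogd hS (hne (hmem hz))) (hlogd differentiable_sigma (hne hz)), h1,
        deriv_comp_add_const, deriv_logDeriv_sigma hz, deriv_logDeriv_sigma (hmem hz)]
      simp)
  have hE : Differentiable ℂ (fun z ↦ Complex.exp (η * z) * sigma L z) :=
    (by fun_prop : Differentiable ℂ fun z ↦ Complex.exp (η * z)).mul differentiable_sigma
  have h2 : Set.EqOn (logDeriv fun z ↦ sigma L (z + l))
      (logDeriv fun z ↦ Complex.exp (η * z) * sigma L z) (L.lattice : Set ℂ)ᶜ := by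
    intro z hz
    rw [logDeriv_mul (f := fun z ↦ Complex.exp (η * z)) z (Complex.exp_ne_zero _) (hne hz)
      (by fun_prop) (differentiable_sigma z)]
    have : logDeriv (fun z ↦ Complex.exp (η * z)) z = η := by
      have hd : HasDerivAt (fun z ↦ Complex.exp (η * z)) (Complex.exp (η * z) * η) z := by
        simpa using ((hasDerivAt_id z).const_mul η).cexp
      rw [logDeriv_apply, hd.deriv]
      field_simp [Complex.exp_ne_zero]
    rw [this, ← hη z hz]; ring
  obtain ⟨C, -, hC⟩ := (logDeriv_eqOn_iff hS.differentiableOn hE.differentiableOn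
    isOpen_compl_lattice (isConnected_compl_lattice (L := L)).isPreconnected
    (fun z hz ↦ mul_ne_zero (Complex.exp_ne_zero _) (hne hz)) (fun z hz ↦ hne (hmem hz))).mp h2
  refine ⟨C, η, fun z ↦ ?_⟩
  have := Continuous.ext_on (dense_compl_lattice (L := L)) hS.continuous
    (g := C • fun z ↦ Complex.exp (η * z) * sigma L z) (hE.continuous.const_smul C) hC
  simpa [mul_assoc] using congrFun this z

end EllipticC

end

/-! ### The addition formula for σ and the three-term relation -/

noncomputable section

namespace EllipticC

open Filter Topology PeriodPair

variable {L : PeriodPair}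

lemma deriv_eq_zero_of_even {f : ℂ → ℂ} (hf : ∀ z, f (-z) = f z) : deriv f 0 = 0 := by
  have : deriv f 0 = -deriv f 0 := by
    conv_lhs => rw [show f = fun z ↦ f (-z) from funext fun z ↦ (hf z).symm]
    rw [deriv_comp_neg]; simp
  exact self_eq_neg.mp this

/-- `f z = z² g z` near `0` with `g` analytic when `f` is analytic, even and vanishes at `0`. -/
lemma exists_eq_sq_mul_of_even {f : ℂ → ℂ} (hf : AnalyticAt ℂ f 0) (h0 : f 0 = 0)
    (heven : ∀ z, f (-z) = f z) : ∃ g : ℂ → ℂ, AnalyticAt ℂ g 0 ∧ ∀ z, f z = z ^ 2 * g z := by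
  obtain ⟨g₁, hg₁, e₁⟩ : ∃ g : ℂ → ℂ, AnalyticAt ℂ g 0 ∧ ∀ z, f z = z * g z := by
    obtain ⟨p, hp⟩ := hf
    exact ⟨dslope f 0, hp.has_fpower_series_dslope_fslope.analyticAt,
      fun z ↦ by simpa [h0] using (sub_smul_dslope f 0 z).symm⟩
  have hg0 : g₁ 0 = 0 := by
    have hd : HasDerivAt (fun z ↦ z * g₁ z) (1 * g₁ 0 + 0 * deriv g₁ 0) 0 :=
      (hasDerivAt_id 0).mul hg₁.differentiableAt.hasDerivAt
    have := deriv_eq_zero_of_even heven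
    rw [show f = fun z ↦ z * g₁ z from funext e₁, hd.deriv] at this
    simpa using this
  obtain ⟨p, hp⟩ := hg₁
  refine ⟨dslope g₁ 0, hp.has_fpower_series_dslope_fslope.analyticAt, fun z ↦ ?_⟩
  have := sub_smul_dslope g₁ 0 z
  simp only [sub_zero, smul_eq_mul, hg0] at this
  rw [e₁, ← this]; ring

lemma analyticAt_sigma (z : ℂ) : AnalyticAt ℂ (sigma L) z := differentiable_sigma.analyticAt z

/-- The elliptic function `σ(x+y)σ(x-y)/σ(x)² + σ(y)²℘(x)` of `x` is constant. -/
lemma sigma_add_mul_sigma_sub_aux (y : ℂ) : ∃ K, ∀ x ∉ L.lattice,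
    sigma L (x + y) * sigma L (x - y) / sigma L x ^ 2 + sigma L y ^ 2 * ℘[L] x = K := by
  classical
  set g : ℂ → ℂ := fun x ↦
    sigma L (x + y) * sigma L (x - y) / sigma L x ^ 2 + sigma L y ^ 2 * ℘[L] x with hg
  have hg_per (l : L.lattice) (x : ℂ) : g (x + l) = g x := by
    obtain ⟨C, η, h⟩ := exists_sigma_add l
    -- `exists_sigma_add` does not exclude C = 0; the point ω₁/2 + l, which is not in the lattice,
    -- does.
    have hC : C ≠ 0 := by
      rintro rfl
      have h1 := h (L.ω₁ / 2)
      simp only [zero_mul, sigma_eq_zero_iff] at h1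
      exact L.ω₁_div_two_notMem_lattice (by simpa using sub_mem h1 l.2)
    have hE := Complex.exp_ne_zero (η * x)
    simp only [hg, weierstrassP_add_coe, h x, show x + l + y = x + y + l by ring,
      show x + l - y = x - y + l by ring, h (x + y), h (x - y)]
    congr 1
    rw [show C * Complex.exp (η * (x + y)) * sigma L (x + y) *
        (C * Complex.exp (η * (x - y)) * sigma L (x - y)) =
        (C * Complex.exp (η * x)) ^ 2 * (sigma L (x + y) * sigma L (x - y)) by
      rw [mul_add, mul_sub, Complex.exp_add, Complex.exp_sub]
      have := Complex.exp_ne_zero (η * y)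
      field_simp, mul_pow _ (sigma L x) 2,
      mul_div_mul_left _ _ (pow_ne_zero 2 (mul_ne_zero hC hE))]
  -- N is x² times the part of g that could be singular at 0. It is even, and N(0) = σ(y)σ(-y) +
  -- σ(y)² = 0, so it is divisible by x² and the double pole cancels.
  set N : ℂ → ℂ := fun x ↦
    sigma L (x + y) * sigma L (x - y) / sigmaProd L x ^ 2 + sigma L y ^ 2 with hN
  have hP0 : sigmaProd L 0 ≠ 0 := by simp [sigmaProd_zero]
  have hNan : AnalyticAt ℂ N 0 := by
    have h1 : AnalyticAt ℂ (sigmaProd L) 0 := differentiable_sigmaProd.analyticAt 0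
    have h2 : AnalyticAt ℂ (fun x ↦ sigma L (x + y)) 0 :=
      (differentiable_sigma.comp (differentiable_id.add_const y)).analyticAt 0
    have h3 : AnalyticAt ℂ (fun x ↦ sigma L (x - y)) 0 :=
      (differentiable_sigma.comp (differentiable_id.sub_const y)).analyticAt 0
    exact ((h2.mul h3).div (h1.pow 2) (pow_ne_zero 2 hP0)).add analyticAt_const
  obtain ⟨h, hh, eh⟩ := exists_eq_sq_mul_of_even hNan
    (by simp [hN, sigmaProd_zero, sigma_neg]; ring)
    (fun z ↦ by
      simp only [hN, sigmaProd_neg, show -z + y = -(z - y) by ring,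
        show -z - y = -(z + y) by ring, sigma_neg]
      ring)
  set H : ℂ → ℂ := fun x ↦ h x + sigma L y ^ 2 * ℘[L - (0 : ℂ)] x with hH
  have hHan : AnalyticAt ℂ H 0 :=
    hh.add (analyticAt_const.mul (L.analyticAt_weierstrassPExcept 0))
  have hgH {x : ℂ} (hx : x ∉ L.lattice) : g x = H x := by
    have hx0 : x ≠ 0 := fun h ↦ hx (h ▸ zero_mem _)
    have h2 := L.weierstrassPExcept_add 0 x
    simp only [ZeroMemClass.coe_zero] at h2
    have h1 := eh x
    simp only [hN] at h1
    have hPx := sigmaProd_ne_zero (u := x) (fun ω _ h ↦ hx (h ▸ ω.2))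
    have h3 : h x = (sigma L (x + y) * sigma L (x - y) / sigmaProd L x ^ 2 + sigma L y ^ 2) / x ^ 2 := by
      rw [h1]; field_simp
    simp only [hg, hH, h3, ← h2, sigma_eq (L := L) x]
    field_simp
    ring
  -- G fills in the removable singularities. Periodicity carries analyticity at 0 to every lattice
  -- point, so G is entire and bounded, hence constant.
  set G : ℂ → ℂ := fun x ↦ if x ∈ L.lattice then H 0 else g x with hG
  have hG_per (l : L.lattice) (x : ℂ) : G (x + l) = G x := by
    have : x + l ∈ L.lattice ↔ x ∈ L.lattice := L.lattice.toAddSubgroup.add_mem_cancel_right l.2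
    simp only [hG, this, hg_per]
  have hG0 : AnalyticAt ℂ G 0 := by
    refine hHan.congr ?_
    filter_upwards [L.compl_lattice_sdiff_singleton_mem_nhds 0] with x hx
    by_cases hx' : x ∈ L.lattice
    · have : x = 0 := by simpa [hx'] using hx
      simp [hG, this]
    · simp [hG, hx', hgH hx']
  have hGan (x : ℂ) : AnalyticAt ℂ G x := by
    by_cases hx : x ∈ L.lattice
    · lift x to L.lattice using hx
      rw [← sub_self x.1] at hG0
      convert! hG0.comp (f := (· - x.1)) (by fun_prop)
      ext a
      simpa using hG_per x (a - x.1)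
    · have : AnalyticAt ℂ g x := by
        have h1 : AnalyticAt ℂ (sigma L) x := analyticAt_sigma x
        have h2 : AnalyticAt ℂ (fun x ↦ sigma L (x + y)) x :=
          (differentiable_sigma.comp (differentiable_id.add_const y)).analyticAt x
        have h3 : AnalyticAt ℂ (fun x ↦ sigma L (x - y)) x :=
          (differentiable_sigma.comp (differentiable_id.sub_const y)).analyticAt x
        exact ((h2.mul h3).div (h1.pow 2) (pow_ne_zero 2 (mt sigma_eq_zero_iff.mp hx))).add
          (analyticAt_const.mul (L.analyticOnNhd_weierstrassP _ hx))
      refine this.congr ?_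
      filter_upwards [isOpen_compl_lattice.mem_nhds hx] with w hw
      exact (if_neg hw).symm
  have hGd : Differentiable ℂ G := fun x ↦ (hGan x).differentiableAt
  refine ⟨G 0, fun x hx ↦ ?_⟩
  rw [← hGd.apply_eq_apply_of_bounded (IsZLattice.isCompact_range_of_periodic L.lattice _
    hGd.continuous fun z w hw ↦ by lift w to L.lattice using hw; exact hG_per w z).isBounded x 0]
  simp [hG, hx, hg]

/-- `σ(x+y)σ(x-y) = σ(x)²σ(y)²(℘(y) - ℘(x))`. -/
lemma sigma_add_mul_sigma_sub {x y : ℂ} (hx : x ∉ L.lattice) (hy : y ∉ L.lattice) :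
    sigma L (x + y) * sigma L (x - y) =
      sigma L x ^ 2 * sigma L y ^ 2 * (℘[L] y - ℘[L] x) := by
  obtain ⟨K, hK⟩ := sigma_add_mul_sigma_sub_aux (L := L) y
  -- The constant is found at x = y, where the σ-quotient vanishes because σ(0) = 0.
  have h1 := (hK x hx).trans (hK y hy).symm
  have h0 : sigma L 0 = 0 := sigma_eq_zero_iff.mpr (zero_mem _)
  have hne : sigma L x ≠ 0 := mt sigma_eq_zero_iff.mp hx
  rw [sub_self, h0, mul_zero, zero_div, zero_add] at h1
  field_simp at h1
  linear_combination h1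

lemma continuous_sigma : Continuous (sigma L) := differentiable_sigma.continuous

/-- Off the lattice each product is σ²σ²σ²σ² times (A-B)(C-D) with A, B, C, D among the four
℘-values, and the three such products cancel identically. Density of the complement removes the
restriction in one variable at a time. -/
lemma three_term_sigma (x y u v : ℂ) :
    sigma L (x + y) * sigma L (x - y) * (sigma L (u + v) * sigma L (u - v)) +
      sigma L (x + u) * sigma L (x - u) * (sigma L (v + y) * sigma L (v - y)) +
      sigma L (x + v) * sigma L (x - v) * (sigma L (y + u) * sigma L (y - u)) = 0 := by
  have hc := continuous_sigma (L := L)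
  have hU : Dense (L.lattice : Set ℂ)ᶜ := dense_compl_lattice
  have key : ∀ x ∈ (L.lattice : Set ℂ)ᶜ, ∀ y ∈ (L.lattice : Set ℂ)ᶜ,
      ∀ u ∈ (L.lattice : Set ℂ)ᶜ, ∀ v ∈ (L.lattice : Set ℂ)ᶜ,
      sigma L (x + y) * sigma L (x - y) * (sigma L (u + v) * sigma L (u - v)) +
      sigma L (x + u) * sigma L (x - u) * (sigma L (v + y) * sigma L (v - y)) +
      sigma L (x + v) * sigma L (x - v) * (sigma L (y + u) * sigma L (y - u)) = 0 := by
    intro x hx y hy u hu v hv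
    rw [sigma_add_mul_sigma_sub hx hy, sigma_add_mul_sigma_sub hu hv,
      sigma_add_mul_sigma_sub hx hu, sigma_add_mul_sigma_sub hv hy,
      sigma_add_mul_sigma_sub hx hv, sigma_add_mul_sigma_sub hy hu]
    ring
  have ext0 {F : ℂ → ℂ} (hF : Continuous F) (h : ∀ z ∈ (L.lattice : Set ℂ)ᶜ, F z = 0) (z : ℂ) :
      F z = 0 :=
    congrFun (Continuous.ext_on hU hF continuous_const h : F = fun _ ↦ 0) z
  refine ext0 (F := fun x ↦ sigma L (x + y) * sigma L (x - y) * (sigma L (u + v) * sigma L (u - v)) +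
      sigma L (x + u) * sigma L (x - u) * (sigma L (v + y) * sigma L (v - y)) +
      sigma L (x + v) * sigma L (x - v) * (sigma L (y + u) * sigma L (y - u))) (by fun_prop)
    (fun x hx ↦ ?_) x
  refine ext0 (F := fun y ↦ sigma L (x + y) * sigma L (x - y) * (sigma L (u + v) * sigma L (u - v)) +
      sigma L (x + u) * sigma L (x - u) * (sigma L (v + y) * sigma L (v - y)) +
      sigma L (x + v) * sigma L (x - v) * (sigma L (y + u) * sigma L (y - u))) (by fun_prop)
    (fun y hy ↦ ?_) y
  refine ext0 (F := fun u ↦ sigma L (x + y) * sigma L (x - y) * (sigma L (u + v) * sigma L (u - v)) +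
      sigma L (x + u) * sigma L (x - u) * (sigma L (v + y) * sigma L (v - y)) +
      sigma L (x + v) * sigma L (x - v) * (sigma L (y + u) * sigma L (y - u))) (by fun_prop)
    (fun u hu ↦ ?_) u
  exact ext0 (F := fun v ↦ sigma L (x + y) * sigma L (x - y) * (sigma L (u + v) * sigma L (u - v)) +
      sigma L (x + u) * sigma L (x - u) * (sigma L (v + y) * sigma L (v - y)) +
      sigma L (x + v) * sigma L (x - v) * (sigma L (y + u) * sigma L (y - u))) (by fun_prop)
    (fun v hv ↦ key x hx y hy u hu v hv) v

lemma continuous_bracket (c : ℂ) : Continuous (bracket L c) := by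
  have := continuous_sigma (L := L)
  unfold bracket
  fun_prop

lemma bracket_eq_zero_iff {c u : ℂ} : bracket L c u = 0 ↔ u ∈ L.lattice := by
  rw [bracket, mul_eq_zero, or_iff_right (Complex.exp_ne_zero _), sigma_eq_zero_iff]

lemma bracket_neg (c u : ℂ) : bracket L c (-u) = -bracket L c u := by
  rw [bracket, bracket, sigma_neg, neg_sq, mul_neg]

/-- The three-term relation (Weierstrass' addition formula) for `bracket`. -/
lemma three_term_bracket (c x y u v : ℂ) :
    bracket L c (x + y) * bracket L c (x - y) * (bracket L c (u + v) * bracket L c (u - v)) +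
      bracket L c (x + u) * bracket L c (x - u) * (bracket L c (v + y) * bracket L c (v - y)) +
      bracket L c (x + v) * bracket L c (x - v) * (bracket L c (y + u) * bracket L c (y - u)) =
        0 := by
  have h (x y u v : ℂ) : bracket L c (x + y) * bracket L c (x - y) *
      (bracket L c (u + v) * bracket L c (u - v)) =
      Complex.exp (2 * Real.pi * Complex.I * (2 * c * (x ^ 2 + y ^ 2 + u ^ 2 + v ^ 2))) *
        (sigma L (x + y) * sigma L (x - y) * (sigma L (u + v) * sigma L (u - v))) := by
    -- The Gaussian exponents add up to a quantity symmetric in x, y, u, v, so all three products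
    -- acquire the same factor.
    have : (2 * Real.pi * Complex.I * (2 * c * (x ^ 2 + y ^ 2 + u ^ 2 + v ^ 2)) : ℂ) =
      2 * Real.pi * Complex.I * (c * (x + y) ^ 2) + 2 * Real.pi * Complex.I * (c * (x - y) ^ 2) +
      2 * Real.pi * Complex.I * (c * (u + v) ^ 2) + 2 * Real.pi * Complex.I * (c * (u - v) ^ 2) := by
      ring
    rw [this, Complex.exp_add, Complex.exp_add, Complex.exp_add]
    simp only [bracket]
    ring
  rw [h x y u v, h x u v y, h x v y u,
    show x ^ 2 + u ^ 2 + v ^ 2 + y ^ 2 = x ^ 2 + y ^ 2 + u ^ 2 + v ^ 2 by ring,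
    show x ^ 2 + v ^ 2 + y ^ 2 + u ^ 2 = x ^ 2 + y ^ 2 + u ^ 2 + v ^ 2 by ring, ← mul_add,
    ← mul_add, three_term_sigma, mul_zero]

end EllipticC

end

/-! ### Theta brackets, partial fractions and the kernel identity -/

noncomputable section

namespace EllipticC

open Finset

/-- The properties of `[·]` used in the algebraic part of the proof: `[·]` is odd, satisfies the
three-term relation, does not vanish off `Λ`, and `δ` generates a free orbit of nonzero values. -/
structure IsThetaBracket (br : ℂ → ℂ) (δ : ℂ) (Λ : AddSubgroup ℂ) : Prop where
  neg : ∀ u, br (-u) = -br u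
  three_term : ∀ x y u v, br (x + y) * br (x - y) * (br (u + v) * br (u - v)) +
    br (x + u) * br (x - u) * (br (v + y) * br (v - y)) +
    br (x + v) * br (x - v) * (br (y + u) * br (y - u)) = 0
  ne_zero : ∀ u, u ∉ Λ → br u ≠ 0
  half_mem : δ / 2 ∈ Λ
  int_mul_ne_zero : ∀ k : ℤ, k ≠ 0 → br (k * δ) ≠ 0

/-- `[x ± y] = [x + y][x - y]`. -/
def pm (br : ℂ → ℂ) (x y : ℂ) : ℂ := br (x + y) * br (x - y)

/-- The one-variable coefficient `∏_p [x + a_p] / [2x]`. -/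
def coeffC (br : ℂ → ℂ) (a : Fin 4 → ℂ) (x : ℂ) : ℂ := (∏ p, br (x + a p)) / br (2 * x)

/-- `x` or `-x`. -/
def signed (e : Bool) (x : ℂ) : ℂ := cond e (-x) x

variable {br : ℂ → ℂ} {δ : ℂ} {Λ : AddSubgroup ℂ}

namespace IsThetaBracket

variable (h : IsThetaBracket br δ Λ)
include h

lemma zero : br 0 = 0 := by
  have := h.neg 0
  rw [neg_zero] at this
  exact self_eq_neg.mp this

lemma sub_comm (x y : ℂ) : br (x - y) = -br (y - x) := by rw [← h.neg, neg_sub]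

lemma pm_comm (x y : ℂ) : pm br x y = -pm br y x := by
  rw [pm, pm, h.sub_comm x y, add_comm x y]; ring

lemma pm_neg_left (x y : ℂ) : pm br (-x) y = pm br x y := by
  rw [pm, pm, show -x + y = -(x - y) by ring, show -x - y = -(x + y) by ring, h.neg, h.neg]; ring

lemma pm_signed_left (e : Bool) (x y : ℂ) : pm br (signed e x) y = pm br x y := by
  cases e
  · rfl
  · exact h.pm_neg_left x y

lemma pm_plucker (x y u v : ℂ) :
    pm br x y * pm br u v + pm br x u * pm br v y + pm br x v * pm br y u = 0 :=
  h.three_term x y u v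

/-- This is the three-term relation with all arguments measured from the midpoint t of w₁ and w₂;
the balance of the sums turns the remaining arguments into w₃ - z. -/
lemma partial_fraction_three (z₁ z₂ z₃ w₁ w₂ w₃ : ℂ) (hs : z₁ + z₂ + z₃ = w₁ + w₂ + w₃) :
    br (z₁ - w₁) * br (z₁ - w₂) * br (z₁ - w₃) * br (z₂ - z₃) +
      br (z₂ - w₁) * br (z₂ - w₂) * br (z₂ - w₃) * br (z₃ - z₁) +
      br (z₃ - w₁) * br (z₃ - w₂) * br (z₃ - w₃) * br (z₁ - z₂) = 0 := by
  set t := (w₁ + w₂) / 2 with ht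
  have key := h.three_term (t - w₁) (z₁ - t) (z₂ - t) (z₃ - t)
  have e (z : ℂ) : br (t - w₁ + (z - t)) * br (t - w₁ - (z - t)) =
      -(br (z - w₁) * br (z - w₂)) := by
    rw [show t - w₁ + (z - t) = z - w₁ by ring,
      show t - w₁ - (z - t) = w₂ - z by rw [ht]; ring, h.sub_comm w₂ z]
    ring
  have e' (z z' z'' : ℂ) (hz : z + z' + z'' = w₁ + w₂ + w₃) :
      br (z' - t + (z'' - t)) * br (z' - t - (z'' - t)) = -(br (z - w₃) * br (z' - z'')) := by
    rw [show z' - t + (z'' - t) = w₃ - z by rw [ht]; linear_combination hz,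
      show z' - t - (z'' - t) = z' - z'' by ring, h.sub_comm w₃ z]
    ring
  rw [e, e, e, e' z₁ z₂ z₃ hs, e' z₂ z₃ z₁ (by linear_combination hs),
    e' z₃ z₁ z₂ (by linear_combination hs)] at key
  linear_combination key

/-- Interpolation reduces four nodes to three: by the three-term relation, [z-w₃][z-w₄] is a
combination of [z-z₃][z+z₃-s] and [z-z₄][z+z₄-s] with s = w₃+w₄. Each of these vanishes at one node,
leaving a three-node identity. The two nonvanishing hypotheses are the interpolation denominators.
-/
lemma partial_fraction_four (z₁ z₂ z₃ z₄ w₁ w₂ w₃ w₄ : ℂ)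
    (hs : z₁ + z₂ + z₃ + z₄ = w₁ + w₂ + w₃ + w₄) (h34 : br (z₃ - z₄) ≠ 0)
    (hw : br (z₃ + z₄ - (w₃ + w₄)) ≠ 0) :
    br (z₁ - w₁) * br (z₁ - w₂) * br (z₁ - w₃) * br (z₁ - w₄) *
        (br (z₂ - z₃) * br (z₂ - z₄) * br (z₃ - z₄)) -
      br (z₂ - w₁) * br (z₂ - w₂) * br (z₂ - w₃) * br (z₂ - w₄) *
        (br (z₁ - z₃) * br (z₁ - z₄) * br (z₃ - z₄)) +
      br (z₃ - w₁) * br (z₃ - w₂) * br (z₃ - w₃) * br (z₃ - w₄) *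
        (br (z₁ - z₂) * br (z₁ - z₄) * br (z₂ - z₄)) -
      br (z₄ - w₁) * br (z₄ - w₂) * br (z₄ - w₃) * br (z₄ - w₄) *
        (br (z₁ - z₂) * br (z₁ - z₃) * br (z₂ - z₃)) = 0 := by
  set s := w₃ + w₄ with hsdef
  have hq (z : ℂ) : br (z - w₃) * br (z - w₄) * (br (z₃ - z₄) * br (z₃ + z₄ - s)) =
      -(br (z₄ - w₃) * br (z₄ - w₄)) * (br (z - z₃) * br (z + z₃ - s)) +
        br (z₃ - w₃) * br (z₃ - w₄) * (br (z - z₄) * br (z + z₄ - s)) := by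
    have key := h.three_term (z - s / 2) (w₃ - s / 2) (z₃ - s / 2) (z₄ - s / 2)
    rw [show z - s / 2 + (w₃ - s / 2) = z - w₄ by rw [hsdef]; ring,
      show z - s / 2 - (w₃ - s / 2) = z - w₃ by ring,
      show z₃ - s / 2 + (z₄ - s / 2) = z₃ + z₄ - s by ring,
      show z₃ - s / 2 - (z₄ - s / 2) = z₃ - z₄ by ring,
      show z - s / 2 + (z₃ - s / 2) = z + z₃ - s by ring,
      show z - s / 2 - (z₃ - s / 2) = z - z₃ by ring,
      show z - s / 2 + (z₄ - s / 2) = z + z₄ - s by ring,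
      show z - s / 2 - (z₄ - s / 2) = z - z₄ by ring,
      show z₄ - s / 2 + (w₃ - s / 2) = z₄ - w₄ by rw [hsdef]; ring,
      show z₄ - s / 2 - (w₃ - s / 2) = z₄ - w₃ by ring,
      show w₃ - s / 2 + (z₃ - s / 2) = z₃ - w₄ by rw [hsdef]; ring,
      show w₃ - s / 2 - (z₃ - s / 2) = w₃ - z₃ by ring, h.sub_comm w₃ z₃] at key
    linear_combination key
  have p3 := h.partial_fraction_three z₁ z₂ z₄ w₁ w₂ (s - z₃) (by rw [hsdef]; linear_combination hs)
  have p4 := h.partial_fraction_three z₁ z₂ z₃ w₁ w₂ (s - z₄) (by rw [hsdef]; linear_combination hs)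
  simp only [← sub_add] at p3 p4
  rw [h.sub_comm z₄ z₁, show z₁ - s + z₃ = z₁ + z₃ - s by ring,
    show z₂ - s + z₃ = z₂ + z₃ - s by ring, show z₄ - s + z₃ = z₃ + z₄ - s by ring] at p3
  rw [h.sub_comm z₃ z₁, show z₁ - s + z₄ = z₁ + z₄ - s by ring,
    show z₂ - s + z₄ = z₂ + z₄ - s by ring, show z₃ - s + z₄ = z₃ + z₄ - s by ring] at p4
  have h1 := hq z₁
  have h2 := hq z₂
  refine (mul_eq_zero.mp ?_).resolve_right (mul_ne_zero h34 hw)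
  linear_combination br (z₁ - w₁) * br (z₁ - w₂) * (br (z₂ - z₃) * br (z₂ - z₄) * br (z₃ - z₄)) * h1
    - br (z₂ - w₁) * br (z₂ - w₂) * (br (z₁ - z₃) * br (z₁ - z₄) * br (z₃ - z₄)) * h2
    - br (z₃ - z₄) * br (z₁ - z₃) * br (z₂ - z₃) * br (z₄ - w₃) * br (z₄ - w₄) * p3
    + br (z₃ - z₄) * br (z₁ - z₄) * br (z₂ - z₄) * br (z₃ - w₃) * br (z₃ - w₄) * p4

/-- The kernel function identity in one pair of variables. -/
lemma kernel_identity (a : Fin 4 → ℂ) (ha : ∑ p, a p = δ) (ha' : br (a 2 + a 3 - δ) ≠ 0) (X Y : ℂ)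
    (hX : br (2 * X) ≠ 0) (hY : br (2 * Y) ≠ 0)
    (h1 : br (X + Y + δ / 2) ≠ 0) (h2 : br (X - Y + δ / 2) ≠ 0)
    (h3 : br (X + Y - δ / 2) ≠ 0) (h4 : br (X - Y - δ / 2) ≠ 0) :
    ∑ e, coeffC br a (signed e X) / pm br (signed e X + δ / 2) Y =
      ∑ e, coeffC br (fun p ↦ δ / 2 - a p) (signed e Y) / pm br (signed e Y + δ / 2) X := by
  rw [Fin.sum_univ_four] at ha
  -- These nodes are ±X and poles of the kernel in X; both the nodes and the points -a_p have sum
  -- -δ. The hypothesis on a₂ + a₃ - δ is the second interpolation denominator.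
  have key := h.partial_fraction_four X (-X) (Y - δ / 2) (-Y - δ / 2)
    (-a 0) (-a 1) (-a 2) (-a 3) (by linear_combination ha)
    (by rwa [show Y - δ / 2 - (-Y - δ / 2) = 2 * Y by ring])
    (by rwa [show Y - δ / 2 + (-Y - δ / 2) - (-a 2 + -a 3) = a 2 + a 3 - δ by ring])
  simp only [sub_neg_eq_add] at key
  have e1 (q : ℂ) : br (-Y - δ / 2 + q) = -br (Y + (δ / 2 - q)) := by
    rw [← h.neg]; congr 1; ring
  have e2 (q : ℂ) : br (Y - δ / 2 + q) = -br (-Y + (δ / 2 - q)) := by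
    rw [← h.neg]; congr 1; ring
  have f1 : br (-X - (Y - δ / 2)) = -br (X + Y - δ / 2) := by rw [← h.neg]; congr 1; ring
  have f2 : br (-X - (-Y - δ / 2)) = -br (X - Y - δ / 2) := by rw [← h.neg]; congr 1; ring
  rw [show Y - δ / 2 - (-Y - δ / 2) = 2 * Y by ring, show X + X = 2 * X by ring,
    show X - (Y - δ / 2) = X - Y + δ / 2 by ring,
    show X - (-Y - δ / 2) = X + Y + δ / 2 by ring, f1, f2] at key
  simp only [e1, e2] at key
  have g1 : br (-X + δ / 2 + Y) = -br (X - Y - δ / 2) := by rw [← h.neg]; congr 1; ring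
  have g2 : br (-X + δ / 2 - Y) = -br (X + Y - δ / 2) := by rw [← h.neg]; congr 1; ring
  have g3 : br (-Y + δ / 2 - X) = -br (X + Y - δ / 2) := by rw [← h.neg]; congr 1; ring
  have g4 : br (Y + δ / 2 - X) = -br (X - Y - δ / 2) := by rw [← h.neg]; congr 1; ring
  simp only [Fintype.sum_bool, signed, cond_true, cond_false, coeffC, Fin.prod_univ_four, pm,
    mul_neg, h.neg, g1, g2, g3, g4, show X + δ / 2 + Y = X + Y + δ / 2 by ring,
    show X + δ / 2 - Y = X - Y + δ / 2 by ring, show Y + δ / 2 + X = X + Y + δ / 2 by ring,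
    show -Y + δ / 2 + X = X - Y + δ / 2 by ring]
  generalize br (X + Y + δ / 2) = A at *
  generalize br (X - Y + δ / 2) = B at *
  generalize br (X + Y - δ / 2) = C at *
  generalize br (X - Y - δ / 2) = D at *
  generalize br (2 * X) = U at *
  generalize br (2 * Y) = V at *
  obtain ⟨P, hP⟩ : ∃ P : ℂ → ℂ, ∀ q, br (Y + (δ / 2 - q)) = P q := ⟨_, fun _ ↦ rfl⟩
  obtain ⟨Q, hQ⟩ : ∃ Q : ℂ → ℂ, ∀ q, br (-Y + (δ / 2 - q)) = Q q := ⟨_, fun _ ↦ rfl⟩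
  simp only [hP, hQ] at key ⊢
  field_simp
  linear_combination key

end IsThetaBracket

/-! ### The Cauchy determinant and products over ordered pairs -/

/-- The Cauchy determinant for a skew-symmetric `v` satisfying the Plücker relation. -/
lemma det_cauchy_fin {v : ℂ → ℂ → ℂ} (hv : ∀ x y, v x y = -v y x)
    (hp : ∀ x y u w, v x y * v u w + v x u * v w y + v x w * v y u = 0) :
    ∀ {n : ℕ} (X Y : Fin n → ℂ), (∀ i j, v (X i) (Y j) ≠ 0) →
      (Matrix.of fun i j ↦ 1 / v (X i) (Y j)).det =
        (∏ i, ∏ j ∈ Ioi i, v (X i) (X j)) * (∏ i, ∏ j ∈ Ioi i, v (Y j) (Y i)) /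
          ∏ i, ∏ j, v (X i) (Y j) := by
  intro n
  induction n with
  | zero => intro X Y _; simp
  | succ n ih =>
    intro X Y hne
    set B : Matrix (Fin (n + 1)) (Fin (n + 1)) ℂ := Matrix.of fun i j ↦ 1 / v (X i) (Y j) with hB
    -- Multiples of row 0 clear column 0 below the diagonal. By the Plücker relation the remaining
    -- minor is again a Cauchy matrix, up to row and column factors.
    set c : Fin (n + 1) → ℂ := Fin.cons 0 fun i ↦ -(v (X 0) (Y 0) / v (X i.succ) (Y 0)) with hc
    set A : Matrix (Fin (n + 1)) (Fin (n + 1)) ℂ := Matrix.of fun i j ↦ B i j + c i * B 0 j with hA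
    have hdet : A.det = B.det :=
      Matrix.det_eq_of_forall_row_eq_smul_add_const c 0 (by simp [hc]) (fun i j ↦ rfl)
    have hA0 (i : Fin n) : A i.succ 0 = 0 := by
      have h1 := hne i.succ 0
      have h2 := hne 0 0
      simp only [hA, hB, hc, Matrix.of_apply, Fin.cons_succ]
      field_simp
      ring
    have hsub : A.submatrix Fin.succ Fin.succ = Matrix.of fun i j ↦
        (v (X 0) (X i.succ) / v (X i.succ) (Y 0)) *
          ((Matrix.of fun i j : Fin n ↦ v (Y j.succ) (Y 0) / v (X 0) (Y j.succ) *
            (Matrix.of fun i j : Fin n ↦ 1 / v (X i.succ) (Y j.succ)) i j) i j) := by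
      ext i j
      have h1 := hne i.succ 0
      have h2 := hne 0 j.succ
      have h3 := hne i.succ j.succ
      have key := hp (X i.succ) (Y 0) (X 0) (Y j.succ)
      rw [hv (Y 0) (X 0), hv (X i.succ) (X 0)] at key
      simp only [hA, hB, hc, Matrix.of_apply, Fin.cons_succ, Matrix.submatrix_apply]
      field_simp
      linear_combination key
    rw [← hdet, Matrix.det_succ_column_zero, Fin.sum_univ_succ]
    simp only [hA0, Fin.val_zero, pow_zero, one_mul, mul_zero, zero_mul, sum_const_zero, add_zero]
    rw [show ((0 : Fin (n + 1)).succAbove : Fin n → _) = Fin.succ from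
      funext fun i ↦ Fin.succAbove_zero_apply (i := i) , hsub, Matrix.det_mul_column, Matrix.det_mul_row, ih _ _ fun i j ↦ hne _ _]
    simp only [Fin.prod_univ_succ, Fin.prod_Ioi_zero, Fin.prod_Ioi_succ, prod_div_distrib,
      prod_mul_distrib]
    simp only [hA, hB, hc, Matrix.of_apply, Fin.cons_zero, zero_mul, add_zero]
    have h0 := hne 0 0
    have h1 : ∏ i : Fin n, v (X i.succ) (Y 0) ≠ 0 := prod_ne_zero_iff.mpr fun i _ ↦ hne _ _
    have h2 : ∏ j : Fin n, v (X 0) (Y j.succ) ≠ 0 := prod_ne_zero_iff.mpr fun i _ ↦ hne _ _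
    have h3 : ∏ i : Fin n, ∏ j : Fin n, v (X i.succ) (Y j.succ) ≠ 0 :=
      prod_ne_zero_iff.mpr fun i _ ↦ prod_ne_zero_iff.mpr fun j _ ↦ hne _ _
    field_simp

/-- The product over the pairs `i < j` of a finite linear order. -/
def pairProd {ι : Type*} [Fintype ι] [LinearOrder ι] (F : ι → ι → ℂ) : ℂ :=
  ∏ i, ∏ j, if i < j then F i j else 1

section PairProd

variable {ι κ : Type*} [Fintype ι] [LinearOrder ι] [Fintype κ] [LinearOrder κ]

lemma pairProd_mul (F G : ι → ι → ℂ) :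
    pairProd (fun i j ↦ F i j * G i j) = pairProd F * pairProd G := by
  simp only [pairProd, ← prod_mul_distrib]
  refine prod_congr rfl fun i _ ↦ prod_congr rfl fun j _ ↦ ?_
  split_ifs <;> simp

lemma pairProd_congr {F G : ι → ι → ℂ} (h : ∀ i j, i < j → F i j = G i j) :
    pairProd F = pairProd G := by
  unfold pairProd
  refine prod_congr rfl fun i _ ↦ prod_congr rfl fun j _ ↦ ?_
  split_ifs with hij
  · exact h i j hij
  · rfl

lemma pairProd_ne_zero {F : ι → ι → ℂ} (h : ∀ i j, i < j → F i j ≠ 0) : pairProd F ≠ 0 := by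
  refine prod_ne_zero_iff.mpr fun i _ ↦ prod_ne_zero_iff.mpr fun j _ ↦ ?_
  split_ifs with hij
  · exact h i j hij
  · exact one_ne_zero

lemma pairProd_orderIso (e : ι ≃o κ) (F : κ → κ → ℂ) :
    pairProd (fun i j ↦ F (e i) (e j)) = pairProd F := by
  unfold pairProd
  rw [← e.toEquiv.prod_comp]
  refine prod_congr rfl fun i _ ↦ ?_
  rw [← e.toEquiv.prod_comp]
  refine prod_congr rfl fun j _ ↦ ?_
  simp

lemma pairProd_fin {n : ℕ} (F : Fin n → Fin n → ℂ) :
    pairProd F = ∏ i, ∏ j ∈ Ioi i, F i j := by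
  unfold pairProd
  refine prod_congr rfl fun i _ ↦ ?_
  rw [← prod_filter, filter_lt_eq_Ioi]

/-- The Cauchy determinant for index sets identified by an order isomorphism. -/
lemma det_cauchy {v : ℂ → ℂ → ℂ} (hv : ∀ x y, v x y = -v y x)
    (hp : ∀ x y u w, v x y * v u w + v x u * v w y + v x w * v y u = 0) (e : ι ≃o κ)
    (X : ι → ℂ) (Y : κ → ℂ) (hne : ∀ i k, v (X i) (Y k) ≠ 0) :
    (Matrix.of fun i j ↦ 1 / v (X i) (Y (e j))).det =
      pairProd (fun i j ↦ v (X i) (X j)) * pairProd (fun k l ↦ v (Y l) (Y k)) /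
        ∏ i, ∏ k, v (X i) (Y k) := by
  let f : Fin (Fintype.card ι) ≃o ι := Fintype.orderIsoFinOfCardEq ι rfl
  have key := det_cauchy_fin hv hp (fun i ↦ X (f i)) (fun i ↦ Y (e (f i))) (fun i j ↦ hne _ _)
  rw [← pairProd_fin, ← pairProd_fin, pairProd_orderIso f (fun i j ↦ v (X i) (X j)),
    show pairProd (fun i j ↦ v (Y (e (f j))) (Y (e (f i)))) = _ from
      pairProd_orderIso (f.trans e) (fun k l ↦ v (Y l) (Y k)),
    show ∏ i, ∏ j, v (X (f i)) (Y (e (f j))) = _ from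
      f.toEquiv.prod_comp (fun i ↦ ∏ j, v (X i) (Y (e (f j))))] at key
  have h2 (i : ι) : ∏ j, v (X i) (Y (e (f j))) = ∏ k, v (X i) (Y k) :=
    (f.trans e).toEquiv.prod_comp (fun k ↦ v (X i) (Y k))
  simp only [h2] at key
  rw [← key, ← Matrix.det_submatrix_equiv_self f.toEquiv]
  rfl

end PairProd

/-! ### The determinantal duality with all multiplicities one -/

section Source

variable {ι κ : Type*} [Fintype ι] [DecidableEq ι]

/-- The sum over signs obtained by expanding the determinant of the kernel identity. -/
def signSum (br : ℂ → ℂ) (δ : ℂ) (a : Fin 4 → ℂ) (e : ι ≃ κ) (X : ι → ℂ) (Y : κ → ℂ) : ℂ :=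
  ∑ ε : ι → Bool, (∏ i, coeffC br a (signed (ε i) (X i))) *
    (Matrix.of fun i j ↦ 1 / pm br (signed (ε i) (X i) + δ / 2) (Y (e j))).det

/-- Multilinearity of the determinant in its rows: each row chooses its own sign. -/
lemma signSum_eq_det (a : Fin 4 → ℂ) (e : ι ≃ κ) (X : ι → ℂ) (Y : κ → ℂ) :
    signSum br δ a e X Y = (Matrix.of fun i j ↦ ∑ s,
      coeffC br a (signed s (X i)) / pm br (signed s (X i) + δ / 2) (Y (e j))).det := by
  have := (Matrix.detRowAlternating (R := ℂ) (n := ι)).toMultilinearMap.map_sum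
    (fun i (s : Bool) j ↦ coeffC br a (signed s (X i)) / pm br (signed s (X i) + δ / 2) (Y (e j)))
  rw [signSum]
  refine Eq.trans ?_ (this.symm.trans ?_)
  · refine sum_congr rfl fun ε _ ↦ ?_
    rw [← Matrix.det_mul_column]
    refine congrArg Matrix.det ?_
    ext i j
    simp [div_eq_mul_inv]
  · refine congrArg Matrix.det ?_
    ext i j
    simp

/-- The duality transformation for all multiplicities equal to one. -/
lemma IsThetaBracket.signSum_duality [Fintype κ] [DecidableEq κ] (h : IsThetaBracket br δ Λ) (a : Fin 4 → ℂ)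
    (ha : ∑ p, a p = δ) (ha' : br (a 2 + a 3 - δ) ≠ 0) (e : ι ≃ κ) (X : ι → ℂ) (Y : κ → ℂ)
    (hX : ∀ i, br (2 * X i) ≠ 0) (hY : ∀ k, br (2 * Y k) ≠ 0)
    (h1 : ∀ i k, br (X i + Y k + δ / 2) ≠ 0) (h2 : ∀ i k, br (X i - Y k + δ / 2) ≠ 0)
    (h3 : ∀ i k, br (X i + Y k - δ / 2) ≠ 0) (h4 : ∀ i k, br (X i - Y k - δ / 2) ≠ 0) :
    signSum br δ a e X Y = signSum br δ (fun p ↦ δ / 2 - a p) e.symm Y X := by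
  rw [signSum_eq_det, signSum_eq_det, ← Matrix.det_transpose, ← Matrix.det_submatrix_equiv_self e]
  refine congrArg Matrix.det ?_
  ext i j
  simpa using h.kernel_identity a ha ha' (X j) (Y (e i)) (hX _) (hY _) (h1 _ _) (h2 _ _)
    (h3 _ _) (h4 _ _)

end Source

end EllipticC

end

/-! ### Shifted factorials and products with an omitted index -/

noncomputable section

namespace EllipticC

open Finset

variable {br : ℂ → ℂ} {δ : ℂ} {Λ : AddSubgroup ℂ}

section Shifted

lemma shifted_zero (u : ℂ) : shifted br δ u 0 = 1 := by simp [shifted]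

lemma shifted_succ (u : ℂ) (n : ℕ) :
    shifted br δ u (n + 1) = shifted br δ u n * br (u + n * δ) := by
  simp [shifted, prod_range_succ]

lemma shifted_add (u : ℂ) (k n : ℕ) :
    shifted br δ u (k + n) = shifted br δ u k * shifted br δ (u + k * δ) n := by
  simp only [shifted, prod_range_add]
  congr 1
  refine prod_congr rfl fun r _ ↦ ?_
  push_cast
  ring_nf

/-- Two ways of splitting [u]_{k+n}; every later quotient of shifted factorials is rearranged
through this. -/
lemma shifted_mul_comm (u : ℂ) (k n : ℕ) :
    shifted br δ u k * shifted br δ (u + k * δ) n =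
      shifted br δ u n * shifted br δ (u + n * δ) k := by
  rw [← shifted_add, ← shifted_add, add_comm]

/-- `[u]_n` written with decreasing arguments. -/
lemma prod_range_sub_eq_shifted (u : ℂ) (n : ℕ) :
    ∏ s ∈ range n, br (u - s * δ) = shifted br δ (u + δ - n * δ) n := by
  rw [shifted, ← prod_range_reflect]
  refine prod_congr rfl fun s hs ↦ ?_
  have hs' := mem_range.mp hs
  rw [show n - 1 - s = n - (1 + s) by omega, Nat.cast_sub (by omega)]
  push_cast
  ring_nf

end Shifted

namespace IsThetaBracket

variable (h : IsThetaBracket br δ Λ)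
include h

lemma mul_half_mem (k : ℤ) : (k : ℂ) * (δ / 2) ∈ Λ := by
  rw [← zsmul_eq_mul]; exact Λ.zsmul_mem h.half_mem k

/-- Since Λ contains δ/2, one genericity condition u ∉ Λ covers all shifts of u by multiples of δ/2,
hence every factor occurring later. -/
lemma notMem_of_eq {u w : ℂ} (hu : u ∉ Λ) (k : ℤ) (hw : w = u + k * (δ / 2)) : w ∉ Λ := by
  rw [hw, Λ.add_mem_cancel_right (h.mul_half_mem k)]
  exact hu

lemma ne_of_eq {u w : ℂ} (hu : u ∉ Λ) (k : ℤ) (hw : w = u + k * (δ / 2)) : br w ≠ 0 :=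
  h.ne_zero _ (h.notMem_of_eq hu k hw)

lemma shifted_ne_of_eq {u w : ℂ} (hu : u ∉ Λ) (k : ℤ) (hw : w = u + k * (δ / 2)) (n : ℕ) :
    shifted br δ w n ≠ 0 :=
  prod_ne_zero_iff.mpr fun r _ ↦ h.ne_of_eq hu (k + 2 * r) (by rw [hw]; push_cast; ring)

lemma int_ne {w : ℂ} (k : ℤ) (hk : k ≠ 0) (hw : w = k * δ) : br w ≠ 0 :=
  hw ▸ h.int_mul_ne_zero k hk

lemma shifted_delta_ne (n : ℕ) : shifted br δ δ n ≠ 0 :=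
  prod_ne_zero_iff.mpr fun r _ ↦ h.int_ne (r + 1) (by omega) (by push_cast; ring)

end IsThetaBracket

/-- The increasing enumeration of `ℕ ∖ {μ}`. -/
def skip (μ r : ℕ) : ℕ := if r < μ then r else r + 1

lemma coe_succAbove {n μ : ℕ} (hμ : μ < n + 1) (r : Fin n) :
    (((⟨μ, hμ⟩ : Fin (n + 1)).succAbove r : Fin (n + 1)) : ℕ) = skip μ r := by
  simp only [Fin.succAbove, skip, Fin.lt_def, Fin.val_castSucc]
  split_ifs <;> simp

lemma skip_le {n μ r : ℕ} (hr : r < n) : skip μ r ≤ n := by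
  unfold skip; split_ifs <;> omega

lemma prod_skip_mul (g : ℕ → ℂ) {n μ : ℕ} (hμ : μ ≤ n) :
    (∏ r : Fin n, g (skip μ r)) * g μ = ∏ r ∈ range (n + 1), g r := by
  rw [prod_range, Fin.prod_univ_succAbove _ ⟨μ, Nat.lt_succ_of_le hμ⟩, mul_comm]
  simp only [coe_succAbove]

lemma prod_skip (g : ℕ → ℂ) {n μ : ℕ} (hμ : μ ≤ n) (hg : ∀ r ≤ n, g r ≠ 0) :
    ∏ r : Fin n, g (skip μ r) = (∏ r : Fin n, g (skip 0 r)) * (g 0 / g μ) := by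
  have h1 := prod_skip_mul g hμ
  have h2 := prod_skip_mul g (Nat.zero_le n)
  have := hg μ hμ
  field_simp
  rw [h1, h2]

/-- Inclusion–exclusion for deleting a row and a column: their ratios are taken over full ranges,
and the crossing entry, then divided out twice, is restored once. -/
lemma prod_skip_skip (G : ℕ → ℕ → ℂ) {n k μ ν : ℕ} (hμ : μ ≤ n) (hν : ν ≤ k)
    (hG : ∀ r ≤ n, ∀ s ≤ k, G r s ≠ 0) :
    ∏ r : Fin n, ∏ s : Fin k, G (skip μ r) (skip ν s) =
      (∏ r : Fin n, ∏ s : Fin k, G (skip 0 r) (skip 0 s)) *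
        ((∏ s ∈ range (k + 1), G 0 s / G μ s) * (∏ r ∈ range (n + 1), G r 0 / G r ν) *
          (G μ ν / G 0 0)) := by
  have h1 (r : Fin n) : ∏ s : Fin k, G (skip μ r) (skip ν s) =
      (∏ s : Fin k, G (skip μ r) (skip 0 s)) * (G (skip μ r) 0 / G (skip μ r) ν) :=
    prod_skip (G (skip μ r)) hν (hG _ (skip_le r.2))
  have h2 : ∏ r : Fin n, (G (skip μ r) 0 / G (skip μ r) ν) = _ :=
    prod_skip (fun r ↦ G r 0 / G r ν) hμ
      (fun r hr ↦ div_ne_zero (hG r hr 0 (Nat.zero_le _)) (hG r hr ν hν))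
  have h3 (s : Fin k) : ∏ r : Fin n, G (skip μ r) (skip 0 s) = _ :=
    prod_skip (fun r ↦ G r (skip 0 s)) hμ (fun r hr ↦ hG r hr _ (skip_le s.2))
  have h4 : ∏ r : Fin n, ∏ s : Fin k, G (skip μ r) (skip 0 s) =
      (∏ r : Fin n, ∏ s : Fin k, G (skip 0 r) (skip 0 s)) *
        ∏ s : Fin k, (G 0 (skip 0 s) / G μ (skip 0 s)) := by
    rw [prod_comm]
    simp only [h3, prod_mul_distrib]
    rw [prod_comm]
  simp only [h1, prod_mul_distrib]
  rw [h2, h4, ← prod_skip_mul (fun s ↦ G 0 s / G μ s) (Nat.zero_le k),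
    ← prod_skip_mul (fun r ↦ G r 0 / G r ν) (Nat.zero_le n)]
  have h00 := hG 0 (Nat.zero_le _) 0 (Nat.zero_le _)
  have hm0 := hG μ hμ 0 (Nat.zero_le _)
  have h0n := hG 0 (Nat.zero_le _) ν hν
  have hmn := hG μ hμ ν hν
  field_simp

/-- Restoring the omitted index μ adds its pairs with all other indices; skew-symmetry contributes a
sign for each of the μ smaller ones. -/
lemma pairProd_skip (G : ℕ → ℕ → ℂ) (hG : ∀ r s, G r s = -G s r) {n μ : ℕ} (hμ : μ ≤ n) :
    pairProd (fun r s : Fin n ↦ G (skip μ r) (skip μ s)) *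
      ((-1) ^ μ * ∏ s ∈ range (n + 1), if s = μ then 1 else G μ s) =
        pairProd (fun r s : Fin (n + 1) ↦ G r s) := by
  set p : Fin (n + 1) := ⟨μ, Nat.lt_succ_of_le hμ⟩ with hp
  have hsign : (-1 : ℂ) ^ μ * (∏ s ∈ range (n + 1), if s = μ then 1 else G μ s) =
      (∏ s : Fin n, if p < p.succAbove s then G μ (skip μ s) else 1) *
        ∏ s : Fin n, if p.succAbove s < p then G (skip μ s) μ else 1 := by
    have h1 : (-1 : ℂ) ^ μ = ∏ s ∈ range (n + 1), if s < μ then -1 else 1 := by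
      rw [← prod_filter, prod_const]
      congr 1
      rw [show (range (n + 1)).filter (· < μ) = range μ by ext; simp; omega, card_range]
    rw [h1, ← prod_mul_distrib, prod_range, Fin.prod_univ_succAbove _ p, ← prod_mul_distrib]
    simp only [hp, lt_irrefl, ite_true, ite_false, one_mul, coe_succAbove, Fin.lt_def]
    refine prod_congr rfl fun s _ ↦ ?_
    have hne : skip μ s ≠ μ := by unfold skip; split_ifs <;> omega
    rcases lt_or_gt_of_ne hne with hlt | hlt
    · simp [hlt, hne, not_lt.mpr hlt.le, hG μ]
    · simp [hlt, hne, not_lt.mpr hlt.le]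
  rw [hsign]
  conv_rhs => rw [pairProd, Fin.prod_univ_succAbove _ p]
  simp only [Fin.prod_univ_succAbove _ p, lt_irrefl, ite_false, one_mul, prod_mul_distrib,
    Fin.succAbove_lt_succAbove_iff]
  simp only [hp, coe_succAbove, pairProd]
  ring

/-! ### The multiple principal specialization -/

section Strings

variable {m n : ℕ}

/-- The index set of the multiple principal specialization of multiplicity `α`. -/
abbrev Str (α : Fin m → ℕ) : Type := Σₗ i : Fin m, Fin (α i)

/-- The index `(i, r)`. -/
def Str.mk {α : Fin m → ℕ} (i : Fin m) (r : Fin (α i)) : Str α := toLex ⟨i, r⟩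

lemma Str.forall {α : Fin m → ℕ} {P : Str α → Prop} : (∀ p, P p) ↔ ∀ i r, P (Str.mk i r) :=
  ⟨fun h _ _ ↦ h _, fun h p ↦ h (ofLex p).1 (ofLex p).2⟩

lemma prod_str {α : Fin m → ℕ} (F : Str α → ℂ) : ∏ p, F p = ∏ i, ∏ r, F (Str.mk i r) := by
  rw [← Fintype.prod_sigma' (fun i r ↦ F (Str.mk i r))]
  exact (Fintype.prod_equiv toLex _ _ fun _ ↦ rfl).symm

lemma Str.mk_lt_mk {α : Fin m → ℕ} {i j : Fin m} {r : Fin (α i)} {s : Fin (α j)} :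
    Str.mk i r < Str.mk j s ↔ i < j ∨ ∃ h : i = j, h ▸ r < s :=
  Sigma.Lex.lt_def

lemma pairProd_str {α : Fin m → ℕ} (F : Str α → Str α → ℂ) :
    pairProd F = (∏ i, pairProd fun r s ↦ F (Str.mk i r) (Str.mk i s)) *
      ∏ i, ∏ j ∈ Ioi i, ∏ r, ∏ s, F (Str.mk i r) (Str.mk j s) := by
  have hout : pairProd F = ∏ i, ∏ j, ∏ r, ∏ s,
      if Str.mk i r < Str.mk j s then F (Str.mk i r) (Str.mk j s) else 1 := by
    simp only [pairProd, prod_str]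
    exact prod_congr rfl fun i _ ↦ prod_comm
  rw [hout, ← prod_mul_distrib]
  refine prod_congr rfl fun i _ ↦ ?_
  have hcase (j : Fin m) : (∏ r, ∏ s,
      if Str.mk i r < Str.mk j s then F (Str.mk i r) (Str.mk j s) else 1) =
      (if j = i then pairProd fun r s ↦ F (Str.mk i r) (Str.mk i s) else 1) *
        if i < j then ∏ r, ∏ s, F (Str.mk i r) (Str.mk j s) else 1 := by
    rcases lt_trichotomy i j with hij | rfl | hij
    · simp [Str.mk_lt_mk, hij, hij.ne']
    · simp [Str.mk_lt_mk, pairProd]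
    · simp [Str.mk_lt_mk, hij.not_gt, hij.ne, hij.ne']
  rw [prod_congr rfl fun j _ ↦ hcase j, prod_mul_distrib, prod_ite_eq' univ i,
    if_pos (mem_univ _), ← prod_filter, filter_lt_eq_Ioi]

/-- The point `x_i + δ/2 + r δ` of the specialization. -/
def node (δ : ℂ) {α : Fin m → ℕ} (x : Fin m → ℂ) (p : Str α) : ℂ :=
  x (ofLex p).1 + δ / 2 + ((ofLex p).2 : ℕ) * δ

/-- The points `x_i + r δ`, `0 ≤ r ≤ α_i`, `r ≠ μ_i`. -/
def skipNode (δ : ℂ) {α : Fin m → ℕ} (x : Fin m → ℂ) (μ : Fin m → ℕ) (p : Str α) : ℂ :=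
  x (ofLex p).1 + (skip (μ (ofLex p).1) (ofLex p).2 : ℕ) * δ

/-- The signs `-` for `r < μ_i` and `+` for `μ_i ≤ r`. -/
def stepSign {α : Fin m → ℕ} (μ : Fin m → ℕ) (p : Str α) : Bool :=
  decide (((ofLex p).2 : ℕ) < μ (ofLex p).1)

lemma node_mk {α : Fin m → ℕ} (x : Fin m → ℂ) (i : Fin m) (r : Fin (α i)) :
    node δ x (Str.mk i r) = x i + δ / 2 + (r : ℕ) * δ := rfl

lemma skipNode_mk {α : Fin m → ℕ} (x : Fin m → ℂ) (μ : Fin m → ℕ) (i : Fin m) (r : Fin (α i)) :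
    skipNode δ x μ (Str.mk i r) = x i + (skip (μ i) r : ℕ) * δ := rfl

lemma stepSign_mk {α : Fin m → ℕ} (μ : Fin m → ℕ) (i : Fin m) (r : Fin (α i)) :
    stepSign μ (Str.mk i r) = decide ((r : ℕ) < μ i) := rfl

lemma skipNode_zero {α : Fin m → ℕ} (x : Fin m → ℂ) (p : Str α) :
    skipNode δ x 0 p = node δ x p + δ / 2 := by
  simp [skipNode, node, skip]; ring

/-- Adding δ/2 sends a plus sign to x_i + (r+1)δ and a minus sign to -(x_i + rδ). With minus signs
exactly for r < μ_i, the points up to sign fill the string of length α_i + 1 except for the position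
μ_i. -/
lemma signed_stepSign_add {α : Fin m → ℕ} (x : Fin m → ℂ) (μ : Fin m → ℕ) (p : Str α) :
    signed (stepSign μ p) (node δ x p) + δ / 2 = signed (stepSign μ p) (skipNode δ x μ p) := by
  by_cases h : ((ofLex p).2 : ℕ) < μ (ofLex p).1
  · simp [signed, stepSign, node, skipNode, skip, h]; ring
  · simp [signed, stepSign, node, skipNode, skip, h]; ring

lemma exists_threshold {P : ℕ → Prop} : ∀ {n : ℕ}, (∀ r, r + 1 < n → P (r + 1) → P r) →
    ∃ μ ≤ n, ∀ r < n, P r ↔ r < μ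
  | 0, _ => ⟨0, le_rfl, by simp⟩
  | n + 1, hP => by
    obtain ⟨μ, hμ, H⟩ := exists_threshold (n := n) fun r hr ↦ hP r (hr.trans (Nat.lt_succ_self n))
    by_cases hn : P n
    · refine ⟨n + 1, le_rfl, fun r hr ↦ ⟨fun _ ↦ hr, fun _ ↦ ?_⟩⟩
      rcases Nat.lt_succ_iff_lt_or_eq.mp hr with hr | rfl
      · obtain ⟨k, rfl⟩ := Nat.exists_eq_succ_of_ne_zero (by omega : n ≠ 0)
        have := (H k (Nat.lt_succ_self k)).mp (hP k (Nat.lt_succ_self _) hn)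
        exact (H r hr).mpr (by omega)
      · exact hn
    · refine ⟨μ, by omega, fun r hr ↦ ?_⟩
      rcases Nat.lt_succ_iff_lt_or_eq.mp hr with hr | rfl
      · exact H r hr
      · exact ⟨fun h ↦ absurd h hn, fun h ↦ by omega⟩

/-- The term of `signSum` that survives the multiple principal specialization. -/
def strTerm (br : ℂ → ℂ) (δ : ℂ) (a : Fin 4 → ℂ) {α : Fin m → ℕ} {κ : Type*} (e : Str α ≃ κ)
    (x : Fin m → ℂ) (Y : κ → ℂ) (μ : Fin m → ℕ) : ℂ :=
  (∏ p : Str α, coeffC br a (signed (stepSign μ p) (node δ x p))) *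
    (Matrix.of fun p q : Str α ↦ 1 / pm br (skipNode δ x μ p) (Y (e q))).det

lemma IsThetaBracket.signSum_node (h : IsThetaBracket br δ Λ) (a : Fin 4 → ℂ) {α : Fin m → ℕ}
    {κ : Type*} (e : Str α ≃ κ) (x : Fin m → ℂ) (Y : κ → ℂ) :
    signSum br δ a e (node δ x) Y = ∑ μ ∈ Icc 0 α, strTerm br δ a e x Y μ := by
  symm
  refine sum_of_injOn stepSign ?_ (fun _ _ ↦ mem_coe.mpr (mem_univ _)) ?_ ?_
  · intro μ hμ ν hν hμν
    ext i
    have h1 : μ i ≤ α i := (mem_Icc.mp (mem_coe.mp hμ)).2 i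
    have h2 : ν i ≤ α i := (mem_Icc.mp (mem_coe.mp hν)).2 i
    by_contra hne
    rcases lt_or_gt_of_ne hne with hlt | hlt
    · have := congrFun hμν (Str.mk i ⟨μ i, by omega⟩)
      simp [stepSign_mk, hlt] at this
    · have := congrFun hμν (Str.mk i ⟨ν i, by omega⟩)
      simp [stepSign_mk, hlt] at this
  · intro ε _ hε
    -- If no plus is followed by a minus in any string, the minus signs form initial segments and ε
    -- is some `stepSign μ` with μ ≤ α.
    obtain ⟨i, r, hr, h0, h1⟩ : ∃ (i : Fin m) (r : ℕ) (hr : r + 1 < α i),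
        ε (Str.mk i ⟨r, by omega⟩) = false ∧ ε (Str.mk i ⟨r + 1, hr⟩) = true := by
      by_contra! hcon
      refine hε ?_
      have hthr (i : Fin m) : ∃ μ ≤ α i, ∀ r < α i,
          (∃ hr : r < α i, ε (Str.mk i ⟨r, hr⟩) = true) ↔ r < μ := by
        refine exists_threshold fun r hr ⟨hr', h1⟩ ↦ ⟨by omega, ?_⟩
        by_contra h0
        exact hcon i r hr' (by simpa using h0) h1
      choose μ hμ hμ' using hthr
      refine ⟨μ, mem_coe.mpr (mem_Icc.mpr ⟨fun i ↦ Nat.zero_le _, hμ⟩), ?_⟩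
      ext p
      revert p
      rw [Str.forall]
      intro i r
      have := hμ' i r r.2
      simp only [r.2, exists_true_left] at this
      rw [stepSign_mk, Bool.eq_iff_iff, decide_eq_true_iff, ← this]
    rw [mul_eq_zero]
    -- Rows r and r+1 both sit at x_i + (r+1)δ up to sign, and `pm` is even in its first argument.
    refine Or.inr (Matrix.det_zero_of_row_eq (i := Str.mk i ⟨r, by omega⟩)
      (j := Str.mk i ⟨r + 1, hr⟩) ?_ ?_)
    · intro heq
      have := (Sigma.mk.inj_iff.mp (toLex.injective heq)).2
      simp at this
    · ext q
      simp only [Matrix.of_apply, h0, h1, node_mk, signed, cond_true, cond_false]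
      rw [← h.pm_neg_left]
      congr 2
      push_cast
      ring
  · intro μ _
    rw [strTerm]
    refine congrArg (_ * Matrix.det ·) ?_
    ext p q
    simp only [Matrix.of_apply]
    rw [signed_stepSign_add, h.pm_signed_left]

end Strings

end EllipticC

end

/-! ### Ratios of the surviving terms -/

noncomputable section

namespace EllipticC

open Finset

variable {br : ℂ → ℂ} {δ : ℂ} {Λ : AddSubgroup ℂ}

/-- Genericity of the variables `x` of one side of the duality transformation. -/
structure GenericSide (Λ : AddSubgroup ℂ) (a : Fin 4 → ℂ) {m n : ℕ} (x : Fin m → ℂ)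
    (y : Fin n → ℂ) : Prop where
  two : ∀ i, 2 * x i ∉ Λ
  add : ∀ i j, i ≠ j → x i + x j ∉ Λ
  sub : ∀ i j, i ≠ j → x i - x j ∉ Λ
  cross_add : ∀ i k, x i + y k ∉ Λ
  cross_sub : ∀ i k, x i - y k ∉ Λ
  param : ∀ i p, x i + a p ∉ Λ

namespace IsThetaBracket

variable (h : IsThetaBracket br δ Λ)
include h

lemma pm_ne_zero {x y : ℂ} (h1 : x + y ∉ Λ) (h2 : x - y ∉ Λ) : pm br x y ≠ 0 :=
  mul_ne_zero (h.ne_zero _ h1) (h.ne_zero _ h2)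

/-- Replacing X by -X flips four signs in the numerator of the coefficient and one in [2X], so each
of the μ minus signs costs -1. -/
lemma prod_coeffC_signed (a : Fin 4 → ℂ) {n μ : ℕ} (hμ : μ ≤ n) (x : ℂ) (hx : ∀ p, x + a p ∉ Λ) :
    ∏ r : Fin n, coeffC br a (signed (decide ((r : ℕ) < μ)) (x + δ / 2 + (r : ℕ) * δ)) =
      (∏ r : Fin n, coeffC br a (x + δ / 2 + (r : ℕ) * δ)) * ((-1) ^ μ *
        ∏ p, shifted br δ (x + δ / 2 - a p) μ / shifted br δ (x + δ / 2 + a p) μ) := by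
  have hflip (X : ℂ) (hX : ∀ p, br (X + a p) ≠ 0) : coeffC br a (-X) =
      coeffC br a X * (-1 * ∏ p, br (X - a p) / br (X + a p)) := by
    have e (p : Fin 4) : br (-X + a p) = -br (X - a p) := by rw [← h.neg]; congr 1; ring
    have hne : ∏ p, br (X + a p) ≠ 0 := prod_ne_zero_iff.mpr fun p _ ↦ hX p
    have hneg : ∏ p, -br (X - a p) = ∏ p, br (X - a p) := by simp [Fin.prod_univ_four]
    simp only [coeffC, e, mul_neg, h.neg, prod_div_distrib, hneg]
    rw [div_mul_eq_mul_div, mul_left_comm, mul_div_cancel₀ _ hne, neg_one_mul, div_neg, neg_div]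
  have hterm (r : ℕ) : coeffC br a (signed (decide (r < μ)) (x + δ / 2 + r * δ)) =
      coeffC br a (x + δ / 2 + r * δ) * if r < μ then
        (-1 * ∏ p, br (x + δ / 2 + r * δ - a p) / br (x + δ / 2 + r * δ + a p)) else 1 := by
    by_cases hr : r < μ
    · simp only [hr, decide_true, signed, cond_true, if_true]
      exact hflip _ fun p ↦ h.ne_of_eq (hx p) (1 + 2 * r) (by push_cast; ring)
    · simp [hr, signed]
  simp only [hterm, prod_mul_distrib]
  congr 1
  rw [← prod_range (fun r ↦ if r < μ then
        (-1 * ∏ p, br (x + δ / 2 + r * δ - a p) / br (x + δ / 2 + r * δ + a p)) else 1),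
    ← prod_filter, show (range n).filter (· < μ) = range μ by ext; simp; omega,
    prod_mul_distrib, prod_const, card_range, prod_comm]
  congr 1
  refine prod_congr rfl fun p _ ↦ ?_
  rw [prod_div_distrib, shifted, shifted]
  congr 1 <;> refine prod_congr rfl fun r _ ↦ ?_ <;> congr 1 <;> ring

omit h in
lemma prod_pm (x y : ℂ) (k : ℕ) : ∏ s ∈ range k, pm br x (y + s * δ) =
    shifted br δ (x + y) k * shifted br δ (x - y + δ - k * δ) k := by
  simp only [pm, prod_mul_distrib, ← prod_range_sub_eq_shifted, sub_sub, ← add_assoc]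
  rfl

lemma prod_pm_div (x y : ℂ) (k μ : ℕ) (h1 : x + y ∉ Λ) (h2 : x - y ∉ Λ) :
    ∏ s ∈ range k, pm br x (y + s * δ) / pm br (x + μ * δ) (y + s * δ) =
      (shifted br δ (x + y) μ * shifted br δ (x - y + δ - k * δ) μ) /
        (shifted br δ (x + y + k * δ) μ * shifted br δ (x - y + δ) μ) := by
  rw [prod_div_distrib, prod_pm, prod_pm]
  have e1 := shifted_mul_comm (br := br) (δ := δ) (x + y) μ k
  have e2 := shifted_mul_comm (br := br) (δ := δ) (x - y + δ - k * δ) μ k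
  rw [sub_add_cancel] at e2
  rw [show x + μ * δ + y = x + y + μ * δ by ring,
    show x + μ * δ - y + δ - k * δ = x - y + δ - k * δ + μ * δ by ring]
  have n1 := h.shifted_ne_of_eq h1 (2 * μ) (w := x + y + μ * δ) (by push_cast; ring) k
  have n2 := h.shifted_ne_of_eq h2 (2 - 2 * k + 2 * μ) (w := x - y + δ - k * δ + μ * δ)
    (by push_cast; ring) k
  have n3 := h.shifted_ne_of_eq h1 (2 * k) (w := x + y + k * δ) (by push_cast; ring) μ
  have n4 := h.shifted_ne_of_eq h2 2 (w := x - y + δ) (by push_cast; ring) μ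
  rw [div_eq_div_iff (mul_ne_zero n1 n2) (mul_ne_zero n3 n4)]
  linear_combination -shifted br δ (x - y + δ - k * δ) k * shifted br δ (x - y + δ) μ * e1
    - shifted br δ (x + y) μ * shifted br δ (x + y + μ * δ) k * e2

omit h in
/-- The products `∏_{s ≤ n, s ≠ μ} [(μ - s)δ]` for consecutive `μ`. -/
lemma prod_int_mul_shifted {n : ℕ} : ∀ {μ : ℕ}, μ ≤ n →
    (∏ s ∈ range (n + 1), if s = μ then 1 else br (μ * δ - s * δ)) * shifted br δ (-(n * δ)) μ =
      (∏ s ∈ range (n + 1), if s = 0 then 1 else br (-(s * δ))) * shifted br δ δ μ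
  | 0, _ => by simp [shifted_zero]
  | μ + 1, hμ => by
    have ih := prod_int_mul_shifted (n := n) (μ := μ) (by omega)
    rw [prod_range_succ, if_neg (by omega : n ≠ μ)] at ih
    rw [prod_range_succ', if_neg (by omega : (0 : ℕ) ≠ μ + 1), shifted_succ, shifted_succ,
      ← mul_assoc (∏ s ∈ range (n + 1), if s = 0 then 1 else br (-(s * δ))), ← ih]
    -- Passing from μ to μ+1 re-indexes s to s+1: the factor at s = n leaves and one at s = 0
    -- enters.
    have e : ∏ s ∈ range n, (if s + 1 = μ + 1 then 1 else
        br (((μ + 1 : ℕ) : ℂ) * δ - ((s + 1 : ℕ) : ℂ) * δ)) =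
        ∏ s ∈ range n, if s = μ then 1 else br (μ * δ - s * δ) := by
      refine prod_congr rfl fun s _ ↦ ?_
      by_cases hs : s = μ
      · simp [hs]
      · rw [if_neg hs, if_neg (by omega)]
        congr 1; push_cast; ring
    rw [e, show ((μ + 1 : ℕ) : ℂ) * δ - ((0 : ℕ) : ℂ) * δ = δ + μ * δ by push_cast; ring,
      show -(n * δ) + μ * δ = μ * δ - n * δ by ring]
    ring

/-- The sum parts form a full shifted factorial once the missing factor at s = μ is inserted.
Dividing by it again is the origin of the factor [2x_i + 2μ_iδ] in the series. -/
lemma prod_pm_self (x : ℂ) {n μ : ℕ} (hμ : μ ≤ n) (hx : 2 * x ∉ Λ) :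
    ∏ s ∈ range (n + 1), (if s = μ then 1 else pm br (x + μ * δ) (x + s * δ)) =
      shifted br δ (2 * x + μ * δ) (n + 1) / br (2 * x + 2 * μ * δ) *
        ∏ s ∈ range (n + 1), if s = μ then 1 else br (μ * δ - s * δ) := by
  have hne : br (2 * x + 2 * μ * δ) ≠ 0 := h.ne_of_eq hx (4 * μ) (by push_cast; ring)
  have e1 (s : ℕ) : (if s = μ then 1 else pm br (x + μ * δ) (x + s * δ)) =
      (br (2 * x + μ * δ + s * δ) / if s = μ then br (2 * x + 2 * μ * δ) else 1) *
        if s = μ then 1 else br (μ * δ - s * δ) := by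
    by_cases hs : s = μ
    · simp only [hs, if_true]
      rw [show 2 * x + μ * δ + μ * δ = 2 * x + 2 * μ * δ by ring, div_self hne, one_mul]
    · simp only [hs, if_false, pm]
      rw [div_one]
      congr 2 <;> ring
  simp only [e1, prod_mul_distrib, prod_div_distrib]
  rw [prod_ite_eq' (range (n + 1)) μ, if_pos (by simp; omega)]
  rfl

lemma prod_pm_self_div (x : ℂ) {n μ : ℕ} (hμ : μ ≤ n) (hx : 2 * x ∉ Λ) :
    (∏ s ∈ range (n + 1), if s = 0 then 1 else pm br x (x + s * δ)) /
      (∏ s ∈ range (n + 1), if s = μ then 1 else pm br (x + μ * δ) (x + s * δ)) =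
      br (2 * x + 2 * μ * δ) / br (2 * x) *
        ((shifted br δ (x + x) μ * shifted br δ (x - x - n * δ) μ) /
          (shifted br δ (x + x + (n + 1) * δ) μ * shifted br δ (x - x + δ) μ)) := by
  have h0 := h.prod_pm_self x (n.zero_le) hx
  simp only [Nat.cast_zero, zero_mul, add_zero, mul_zero, zero_sub] at h0
  rw [h0, h.prod_pm_self x hμ hx, sub_self, zero_add, zero_sub, ← two_mul]
  have e1 := shifted_mul_comm (br := br) (δ := δ) (2 * x) μ (n + 1)
  push_cast at e1
  have e2 := prod_int_mul_shifted (br := br) (δ := δ) hμ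
  have n1 : br (2 * x + 2 * μ * δ) ≠ 0 := h.ne_of_eq hx (4 * μ) (by push_cast; ring)
  have n2 : br (2 * x) ≠ 0 := h.ne_zero _ hx
  have n3 := h.shifted_ne_of_eq hx (2 * μ) (w := 2 * x + μ * δ) (by push_cast; ring) (n + 1)
  have n4 := h.shifted_ne_of_eq hx (2 * (n + 1)) (w := 2 * x + (n + 1) * δ) (by push_cast; ring) μ
  have n5 := h.shifted_delta_ne μ
  have n6 : ∏ s ∈ range (n + 1), (if s = μ then 1 else br (μ * δ - s * δ)) ≠ 0 := by
    refine prod_ne_zero_iff.mpr fun s _ ↦ ?_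
    split_ifs with hs
    · exact one_ne_zero
    · exact h.int_ne (μ - s) (by omega) (by push_cast; ring)
  generalize (∏ s ∈ range (n + 1), if s = μ then 1 else br (μ * δ - s * δ)) = V at *
  generalize (∏ s ∈ range (n + 1), if s = 0 then 1 else br (-(s * δ))) = V₀ at *
  generalize br (2 * x + 2 * μ * δ) = B at *
  generalize shifted br δ (2 * x + μ * δ) (n + 1) = C at *
  generalize shifted br δ (2 * x + (n + 1) * δ) μ = D at *
  generalize shifted br δ (-(n * δ)) μ = E at *
  field_simp
  linear_combination (-shifted br δ δ μ * V₀) * e1 - shifted br δ (2 * x) μ * C * e2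

variable {m n : ℕ} {a : Fin 4 → ℂ} {α : Fin m → ℕ} {β : Fin n → ℕ} {x : Fin m → ℂ} {y : Fin n → ℂ}

lemma pairProd_skipNode_self (hg : GenericSide Λ a x y) (i : Fin m) {μ : ℕ} (hμ : μ ≤ α i) :
    pairProd (fun r s : Fin (α i) ↦ pm br (x i + skip μ r * δ) (x i + skip μ s * δ)) =
      pairProd (fun r s : Fin (α i) ↦ pm br (x i + skip 0 r * δ) (x i + skip 0 s * δ)) *
        ((-1) ^ μ * (br (2 * x i + 2 * μ * δ) / br (2 * x i) *
        ((shifted br δ (x i + x i) μ * shifted br δ (x i - x i - α i * δ) μ) /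
          (shifted br δ (x i + x i + (α i + 1) * δ) μ * shifted br δ (x i - x i + δ) μ)))) := by
  have key (ν : ℕ) (hν : ν ≤ α i) :=
    pairProd_skip (fun r s ↦ pm br (x i + r * δ) (x i + s * δ)) (fun _ _ ↦ h.pm_comm _ _) hν
  have h1 := key μ hμ
  have h0 := key 0 (Nat.zero_le _)
  rw [← h0] at h1
  simp only [Nat.cast_zero, zero_mul, add_zero, pow_zero, one_mul] at h1
  rw [← h.prod_pm_self_div (x i) hμ (hg.two i)]
  have n6 : ∏ s ∈ range (α i + 1), (if s = μ then 1 else pm br (x i + μ * δ) (x i + s * δ)) ≠ 0 := by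
    refine prod_ne_zero_iff.mpr fun s _ ↦ ?_
    split_ifs with hs
    · exact one_ne_zero
    · refine mul_ne_zero (h.ne_of_eq (hg.two i) (2 * μ + 2 * s) (by push_cast; ring))
        (h.int_ne (μ - s) (by omega) (by push_cast; ring))
  have hsq : ((-1 : ℂ) ^ μ) * (-1) ^ μ = 1 := by rw [← mul_pow]; simp
  generalize (∏ s ∈ range (α i + 1), if s = μ then 1 else pm br (x i + μ * δ) (x i + s * δ)) = W
    at *
  generalize pairProd (fun r s : Fin (α i) ↦
    pm br (x i + skip μ r * δ) (x i + skip μ s * δ)) = B at *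
  rw [← mul_assoc, ← mul_div_assoc, eq_div_iff n6]
  linear_combination (-1) ^ μ * h1 - B * W * hsq

/-- The row ratio gives the (i,j) factor of the series, the column ratio gives the (j,i) factor by
skew-symmetry, and the crossing entry gives the factor for the pair i < j. -/
lemma prod_skipNode_cross (hg : GenericSide Λ a x y) {i j : Fin m} (hij : i ≠ j) {μ ν : ℕ}
    (hμ : μ ≤ α i) (hν : ν ≤ α j) :
    ∏ r : Fin (α i), ∏ s : Fin (α j), pm br (x i + skip μ r * δ) (x j + skip ν s * δ) =
      (∏ r : Fin (α i), ∏ s : Fin (α j), pm br (x i + skip 0 r * δ) (x j + skip 0 s * δ)) *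
      ((shifted br δ (x j + x i) ν * shifted br δ (x j - x i - α i * δ) ν) /
          (shifted br δ (x j + x i + (α i + 1) * δ) ν * shifted br δ (x j - x i + δ) ν) *
        ((shifted br δ (x i + x j) μ * shifted br δ (x i - x j - α j * δ) μ) /
          (shifted br δ (x i + x j + (α j + 1) * δ) μ * shifted br δ (x i - x j + δ) μ)) *
        (pm br (x i + μ * δ) (x j + ν * δ) / pm br (x i) (x j))) := by
  have hG := prod_skip_skip (fun r s : ℕ ↦ pm br (x i + r * δ) (x j + s * δ)) hμ hν
    (fun r _ s _ ↦ h.pm_ne_zero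
      (h.notMem_of_eq (hg.add i j hij) (2 * r + 2 * s) (by push_cast; ring))
      (h.notMem_of_eq (hg.sub i j hij) (2 * r - 2 * s) (by push_cast; ring)))
  simp only [Nat.cast_zero, zero_mul, add_zero] at hG
  rw [hG]
  have e1 := h.prod_pm_div (x i) (x j) (α j + 1) μ (hg.add i j hij) (hg.sub i j hij)
  have e2 := h.prod_pm_div (x j) (x i) (α i + 1) ν (hg.add j i hij.symm) (hg.sub j i hij.symm)
  push_cast at e1 e2
  rw [show x i - x j + δ - (α j + 1) * δ = x i - x j - α j * δ by ring] at e1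
  rw [show x j - x i + δ - (α i + 1) * δ = x j - x i - α i * δ by ring] at e2
  have e3 : ∏ r ∈ range (α i + 1), pm br (x i + r * δ) (x j) / pm br (x i + r * δ) (x j + ν * δ) =
      ∏ r ∈ range (α i + 1), pm br (x j) (x i + r * δ) / pm br (x j + ν * δ) (x i + r * δ) :=
    prod_congr rfl fun r _ ↦ by
      rw [h.pm_comm (x j), h.pm_comm (x j + ν * δ), neg_div_neg_eq]
  rw [e1, e3, e2]
  ring

lemma prod_skipNode_node (hg : GenericSide Λ a x y) (i : Fin m) {μ : ℕ} (hμ : μ ≤ α i) :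
    ∏ r : Fin (α i), ∏ k, ∏ s : Fin (β k), pm br (x i + skip μ r * δ) (y k + δ / 2 + (s : ℕ) * δ) =
      (∏ r : Fin (α i), ∏ k, ∏ s : Fin (β k),
        pm br (x i + skip 0 r * δ) (y k + δ / 2 + (s : ℕ) * δ)) /
      ∏ k, (shifted br δ (x i + y k + δ / 2 + β k * δ) μ * shifted br δ (x i - y k + δ / 2) μ) /
        (shifted br δ (x i + y k + δ / 2) μ * shifted br δ (x i - y k + δ / 2 - β k * δ) μ) := by
  have hne (r s : ℕ) (k : Fin n) : pm br (x i + r * δ) (y k + δ / 2 + s * δ) ≠ 0 :=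
    h.pm_ne_zero (h.notMem_of_eq (hg.cross_add i k) (2 * r + 1 + 2 * s) (by push_cast; ring))
      (h.notMem_of_eq (hg.cross_sub i k) (2 * r - 1 - 2 * s) (by push_cast; ring))
  rw [prod_skip (fun r ↦ ∏ k, ∏ s : Fin (β k), pm br (x i + r * δ) (y k + δ / 2 + (s : ℕ) * δ)) hμ
    (fun r _ ↦ prod_ne_zero_iff.mpr fun k _ ↦ prod_ne_zero_iff.mpr fun s _ ↦ hne r s k),
    div_eq_mul_inv (∏ r : Fin (α i), _)]
  congr 1
  rw [← prod_div_distrib, ← prod_inv_distrib]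
  refine prod_congr rfl fun k _ ↦ ?_
  have := h.prod_pm_div (x i) (y k + δ / 2) (β k) μ
    (h.notMem_of_eq (hg.cross_add i k) 1 (by push_cast; ring))
    (h.notMem_of_eq (hg.cross_sub i k) (-1) (by push_cast; ring))
  rw [prod_range, prod_div_distrib] at this
  simp only [Nat.cast_zero, zero_mul, add_zero]
  rw [this, inv_div, ← add_assoc, show x i - (y k + δ / 2) + δ = x i - y k + δ / 2 by ring]

omit h in
lemma prod_prod_eq_diag_mul {f : Fin m → Fin m → ℂ} :
    ∏ i, ∏ j, f i j = (∏ i, f i i) * ∏ i, ∏ j ∈ Ioi i, f j i * f i j := by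
  rw [prod_prod_Ioi_mul_eq_prod_prod_off_diag, prod_comm, ← prod_mul_distrib]
  refine prod_congr rfl fun i _ ↦ ?_
  exact Fintype.prod_eq_mul_prod_compl i _

-- The signs S_i = (-1)^{μ_i} occur twice, from the coefficients and from reordering inside each
-- string, and cancel. The diagonal and the two orders of each pair make up the product over all
-- (i,j).
omit h in
lemma assemble_term {S : Fin m → ℂ} (P D : Fin m → ℂ) (Q V : Fin m → Fin m → ℂ)
    (K : Fin m → Fin n → ℂ) {F A B E : ℂ} (hS : ∀ i, S i * S i = 1) :
    F * (∏ i, S i * P i) * (A * ((∏ i, S i * (D i * Q i i)) *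
      ∏ i, ∏ j ∈ Ioi i, Q j i * Q i j * V i j) * B / (E / ∏ i, ∏ k, K i k)) =
    F * (A * B / E) * ((∏ i, P i) * (∏ i, D i) * (∏ i, ∏ j ∈ Ioi i, V i j) *
      (∏ i, ∏ j, Q i j) * ∏ i, ∏ k, K i k) := by
  have hS' : (∏ i, S i) * ∏ i, S i = 1 := by
    rw [← prod_mul_distrib]; exact prod_eq_one fun i _ ↦ hS i
  rw [prod_prod_eq_diag_mul (f := Q), div_div_eq_mul_div]
  have e : ∏ i, ∏ j ∈ Ioi i, Q j i * Q i j * V i j =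
      (∏ i, ∏ j ∈ Ioi i, Q j i * Q i j) * ∏ i, ∏ j ∈ Ioi i, V i j := by
    simp only [prod_mul_distrib]
  rw [e, prod_mul_distrib, prod_mul_distrib, prod_mul_distrib]
  generalize (∏ i, ∏ j ∈ Ioi i, Q j i * Q i j) = q
  linear_combination (F * A * B / E * (∏ i, P i) * (∏ i, D i) * (∏ i, ∏ j ∈ Ioi i, V i j) *
    (∏ i, Q i i) * q * ∏ i, ∏ k, K i k) * hS'

lemma pm_skipNode_node_ne_zero (hg : GenericSide Λ a x y) (ν : Fin m → ℕ) (p : Str α) (q : Str β) :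
    pm br (skipNode δ x ν p) (node δ y q) ≠ 0 :=
  h.pm_ne_zero
    (h.notMem_of_eq (hg.cross_add (ofLex p).1 (ofLex q).1)
      (2 * skip (ν (ofLex p).1) (ofLex p).2 + 1 + 2 * ((ofLex q).2 : ℕ))
      (by rw [skipNode, node]; push_cast; ring))
    (h.notMem_of_eq (hg.cross_sub (ofLex p).1 (ofLex q).1)
      (2 * skip (ν (ofLex p).1) (ofLex p).2 - 1 - 2 * ((ofLex q).2 : ℕ))
      (by rw [skipNode, node]; push_cast; ring))

lemma strTerm_eq_cauchy (hg : GenericSide Λ a x y) (e : Str α ≃o Str β) (ν : Fin m → ℕ) :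
    strTerm br δ a e.toEquiv x (node δ y) ν =
      (∏ p : Str α, coeffC br a (signed (stepSign ν p) (node δ x p))) *
      (pairProd (fun p q : Str α ↦ pm br (skipNode δ x ν p) (skipNode δ x ν q)) *
        pairProd (fun k l : Str β ↦ pm br (node δ y l) (node δ y k)) /
        ∏ p : Str α, ∏ k : Str β, pm br (skipNode δ x ν p) (node δ y k)) := by
  rw [strTerm, ← det_cauchy h.pm_comm h.pm_plucker e (skipNode δ x ν) (node δ y)
    (h.pm_skipNode_node_ne_zero hg ν)]
  congr!

lemma prod_coeffC_stepSign (hg : GenericSide Λ a x y) {μ : Fin m → ℕ} (hμ : μ ≤ α) :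
    ∏ p : Str α, coeffC br a (signed (stepSign μ p) (node δ x p)) =
      (∏ p : Str α, coeffC br a (signed (stepSign 0 p) (node δ x p))) * ∏ i, ((-1) ^ μ i *
        ∏ p, shifted br δ (x i + δ / 2 - a p) (μ i) / shifted br δ (x i + δ / 2 + a p) (μ i)) := by
  rw [prod_str, prod_str, ← prod_mul_distrib]
  refine prod_congr rfl fun i _ ↦ ?_
  have := h.prod_coeffC_signed a (hμ i) (x i) (hg.param i)
  simpa [stepSign_mk, node_mk, signed] using this

lemma pairProd_skipNode (hg : GenericSide Λ a x y) {μ : Fin m → ℕ} (hμ : μ ≤ α) :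
    pairProd (fun p q : Str α ↦ pm br (skipNode δ x μ p) (skipNode δ x μ q)) =
      pairProd (fun p q : Str α ↦ pm br (skipNode δ x 0 p) (skipNode δ x 0 q)) *
      ((∏ i, ((-1) ^ μ i * (br (2 * x i + 2 * μ i * δ) / br (2 * x i) *
        ((shifted br δ (x i + x i) (μ i) * shifted br δ (x i - x i - α i * δ) (μ i)) /
          (shifted br δ (x i + x i + (α i + 1) * δ) (μ i) *
            shifted br δ (x i - x i + δ) (μ i)))))) *
        ∏ i, ∏ j ∈ Ioi i,
        ((shifted br δ (x j + x i) (μ j) * shifted br δ (x j - x i - α i * δ) (μ j)) /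
          (shifted br δ (x j + x i + (α i + 1) * δ) (μ j) * shifted br δ (x j - x i + δ) (μ j)) *
        ((shifted br δ (x i + x j) (μ i) * shifted br δ (x i - x j - α j * δ) (μ i)) /
          (shifted br δ (x i + x j + (α j + 1) * δ) (μ i) * shifted br δ (x i - x j + δ) (μ i))) *
        (pm br (x i + μ i * δ) (x j + μ j * δ) / pm br (x i) (x j)))) := by
  rw [pairProd_str, pairProd_str, mul_mul_mul_comm]
  simp only [skipNode_mk, Pi.zero_apply]
  refine congrArg₂ (· * ·) ?_ ?_
  · rw [← prod_mul_distrib]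
    exact prod_congr rfl fun i _ ↦ h.pairProd_skipNode_self hg i (hμ i)
  · rw [← prod_mul_distrib]
    refine prod_congr rfl fun i _ ↦ ?_
    rw [← prod_mul_distrib]
    exact prod_congr rfl fun j hj ↦
      h.prod_skipNode_cross hg (mem_Ioi.mp hj).ne (hμ i) (hμ j)

lemma prod_pm_skipNode_node (hg : GenericSide Λ a x y) {μ : Fin m → ℕ} (hμ : μ ≤ α) :
    ∏ p : Str α, ∏ q : Str β, pm br (skipNode δ x μ p) (node δ y q) =
      (∏ p : Str α, ∏ q : Str β, pm br (skipNode δ x 0 p) (node δ y q)) / ∏ i, ∏ k,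
        (shifted br δ (x i + y k + δ / 2 + β k * δ) (μ i) *
          shifted br δ (x i - y k + δ / 2) (μ i)) /
        (shifted br δ (x i + y k + δ / 2) (μ i) *
          shifted br δ (x i - y k + δ / 2 - β k * δ) (μ i)) := by
  simp only [prod_str, skipNode_mk, node_mk, Pi.zero_apply]
  rw [← prod_div_distrib]
  exact prod_congr rfl fun i _ ↦ h.prod_skipNode_node hg i (hμ i)

/-- The surviving terms of the specialized series are the terms of `series`. -/
lemma strTerm_eq (hg : GenericSide Λ a x y) (e : Str α ≃o Str β) {μ : Fin m → ℕ} (hμ : μ ≤ α) :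
    strTerm br δ a e.toEquiv x (node δ y) μ =
      strTerm br δ a e.toEquiv x (node δ y) 0 * term br δ a α β x y μ := by
  rw [h.strTerm_eq_cauchy hg, h.strTerm_eq_cauchy hg]
  rw [h.prod_coeffC_stepSign hg hμ, h.pairProd_skipNode hg hμ, h.prod_pm_skipNode_node hg hμ]
  exact assemble_term
    (fun i ↦ ∏ p, shifted br δ (x i + δ / 2 - a p) (μ i) / shifted br δ (x i + δ / 2 + a p) (μ i))
    (fun i ↦ br (2 * x i + 2 * μ i * δ) / br (2 * x i))
    (fun i j ↦ (shifted br δ (x i + x j) (μ i) * shifted br δ (x i - x j - α j * δ) (μ i)) /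
      (shifted br δ (x i + x j + (α j + 1) * δ) (μ i) * shifted br δ (x i - x j + δ) (μ i)))
    (fun i j ↦ pm br (x i + μ i * δ) (x j + μ j * δ) / pm br (x i) (x j))
    (fun i k ↦ (shifted br δ (x i + y k + δ / 2 + β k * δ) (μ i) *
      shifted br δ (x i - y k + δ / 2) (μ i)) / (shifted br δ (x i + y k + δ / 2) (μ i) *
        shifted br δ (x i - y k + δ / 2 - β k * δ) (μ i)))
    (fun i ↦ by rw [← mul_pow]; simp)

end IsThetaBracket

end EllipticC

end

/-! ### The term of index zero and the case of equal total multiplicity -/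

noncomputable section

namespace EllipticC

open Finset

variable {br : ℂ → ℂ} {δ : ℂ} {Λ : AddSubgroup ℂ}

lemma prod_range_shift_mul (f : ℕ → ℂ) (n : ℕ) :
    (∏ r ∈ range n, f (r + 1)) * f 0 = (∏ r ∈ range n, f r) * f n := by
  rw [← prod_range_succ', prod_range_succ]

lemma pairProd_fin_succ {n : ℕ} (F : ℕ → ℕ → ℂ) :
    pairProd (fun r s : Fin (n + 1) ↦ F r s) =
      pairProd (fun r s : Fin n ↦ F r s) * ∏ r ∈ range n, F r n := by
  simp only [pairProd, Fin.prod_univ_castSucc, Fin.castSucc_lt_castSucc_iff, Fin.val_castSucc,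
    Fin.val_last, Fin.castSucc_lt_last, if_true, prod_mul_distrib, prod_range, lt_irrefl, if_false]
  have (i : Fin n) : ¬ Fin.last n < i.castSucc := not_lt.mpr (Fin.le_last _)
  simp [this]

/-- Induction on n: the pairs (r,n) contribute the telescoping quotient ∏ G(r+n+1)/G(r+n) =
G(2n)/G(n). -/
lemma pairProd_add_mul (G : ℕ → ℂ) : ∀ n : ℕ,
    pairProd (fun r s : Fin n ↦ G (r + s + 1)) * ∏ r ∈ range n, G r =
      pairProd (fun r s : Fin n ↦ G (r + s)) * ∏ r ∈ range n, G (2 * r)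
  | 0 => by simp [pairProd]
  | n + 1 => by
    have ih := pairProd_add_mul G n
    rw [pairProd_fin_succ (fun r s ↦ G (r + s + 1)), pairProd_fin_succ (fun r s ↦ G (r + s)),
      prod_range_succ, prod_range_succ]
    have key := prod_range_shift_mul (fun r ↦ G (r + n)) n
    simp only [zero_add, ← two_mul, add_right_comm _ 1 n] at key
    linear_combination (∏ r ∈ range n, G (r + n + 1)) * G n * ih +
      pairProd (fun r s : Fin n ↦ G (r + s)) * (∏ r ∈ range n, G (2 * r)) * key

namespace IsThetaBracket

variable {m n : ℕ} {a : Fin 4 → ℂ} {α : Fin m → ℕ} {β : Fin n → ℕ} {x : Fin m → ℂ} {y : Fin n → ℂ}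

variable (h : IsThetaBracket br δ Λ)
include h

lemma pairProd_node_add_ne_zero (hg : GenericSide Λ a x y) (k : ℤ) :
    pairProd (fun p q : Str α ↦ br (node δ x p + node δ x q + k * δ)) ≠ 0 := by
  refine pairProd_ne_zero fun p q _ ↦ ?_
  by_cases hij : (ofLex p).1 = (ofLex q).1
  · exact h.ne_of_eq (hg.two (ofLex p).1)
      (2 + 2 * ((ofLex p).2 : ℕ) + 2 * ((ofLex q).2 : ℕ) + 2 * k)
      (by simp only [node, ← hij]; push_cast; ring)
  · exact h.ne_of_eq (hg.add _ _ hij)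
      (2 + 2 * ((ofLex p).2 : ℕ) + 2 * ((ofLex q).2 : ℕ) + 2 * k)
      (by simp only [node]; push_cast; ring)

lemma two_node_ne_zero (hg : GenericSide Λ a x y) (p : Str α) : br (2 * node δ x p) ≠ 0 :=
  h.ne_of_eq (hg.two (ofLex p).1) (2 + 4 * ((ofLex p).2 : ℕ)) (by simp only [node]; push_cast; ring)

-- Raising every sum of two nodes by δ telescopes: inside a string by `pairProd_add_mul`, between
-- two strings along the second one.
omit h in
lemma pairProd_node_add (x : Fin m → ℂ) :
    pairProd (fun p q : Str α ↦ br (node δ x p + node δ x q + δ)) *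
      ((∏ i, shifted br δ (2 * x i + δ) (α i)) *
        ∏ i, ∏ j ∈ Ioi i, shifted br δ (x i + x j + δ) (α i)) =
    pairProd (fun p q : Str α ↦ br (node δ x p + node δ x q)) * (∏ p : Str α, br (2 * node δ x p)) *
      ∏ i, ∏ j ∈ Ioi i, shifted br δ (x i + x j + (α j + 1) * δ) (α i) := by
  have h1 (i : Fin m) : pairProd (fun r s : Fin (α i) ↦
      br (node δ x (Str.mk i r) + node δ x (Str.mk i s) + δ)) * shifted br δ (2 * x i + δ) (α i) =
      pairProd (fun r s : Fin (α i) ↦ br (node δ x (Str.mk i r) + node δ x (Str.mk i s))) *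
        ∏ r : Fin (α i), br (2 * node δ x (Str.mk i r)) := by
    have key := pairProd_add_mul (fun k ↦ br (2 * x i + δ + k * δ)) (α i)
    simp only [node_mk]
    rw [prod_range (fun r ↦ br (2 * x i + δ + ((2 * r : ℕ) : ℂ) * δ))] at key
    refine (congrArg (· * _) ?_).trans (key.trans (congrArg₂ (· * ·) ?_ ?_))
    · congr 1; ext r s; congr 1; push_cast; ring
    · congr 1; ext r s; congr 1; push_cast; ring
    · refine prod_congr rfl fun r _ ↦ ?_
      congr 1; push_cast; ring
  have h2 (i j : Fin m) : (∏ r : Fin (α i), ∏ s : Fin (α j),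
      br (node δ x (Str.mk i r) + node δ x (Str.mk j s) + δ)) *
        shifted br δ (x i + x j + δ) (α i) =
      (∏ r : Fin (α i), ∏ s : Fin (α j), br (node δ x (Str.mk i r) + node δ x (Str.mk j s))) *
        shifted br δ (x i + x j + (α j + 1) * δ) (α i) := by
    rw [shifted, shifted, prod_range, prod_range, ← prod_mul_distrib, ← prod_mul_distrib]
    refine prod_congr rfl fun r _ ↦ ?_
    have key := prod_range_shift_mul (fun s ↦ br (x i + x j + δ + r * δ + s * δ)) (α j)
    rw [prod_range, prod_range] at key
    simp only [node_mk]
    convert key using 2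
    · refine prod_congr rfl fun s _ ↦ ?_
      congr 1; push_cast; ring
    · congr 1; push_cast; ring
    · refine prod_congr rfl fun s _ ↦ ?_
      congr 1; ring
    · congr 1; ring
  have h2' : (∏ i, ∏ j ∈ Ioi i, ∏ r : Fin (α i), ∏ s : Fin (α j),
      br (node δ x (Str.mk i r) + node δ x (Str.mk j s) + δ)) *
        ∏ i, ∏ j ∈ Ioi i, shifted br δ (x i + x j + δ) (α i) =
      (∏ i, ∏ j ∈ Ioi i, ∏ r : Fin (α i), ∏ s : Fin (α j),
        br (node δ x (Str.mk i r) + node δ x (Str.mk j s))) *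
        ∏ i, ∏ j ∈ Ioi i, shifted br δ (x i + x j + (α j + 1) * δ) (α i) := by
    rw [← prod_mul_distrib, ← prod_mul_distrib]
    refine prod_congr rfl fun i _ ↦ ?_
    rw [← prod_mul_distrib, ← prod_mul_distrib]
    exact prod_congr rfl fun j _ ↦ h2 i j
  have h1' := prod_congr (rfl : (univ : Finset (Fin m)) = univ) fun i _ ↦ h1 i
  rw [prod_mul_distrib, prod_mul_distrib] at h1'
  rw [pairProd_str, pairProd_str, prod_str, mul_mul_mul_comm, h1', h2']
  ring

/-- The prefactor in terms of the points of the specialization. -/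
lemma prefactor_eq (hg : GenericSide Λ a x y) : prefactor br δ a α x =
    (∏ p : Str α, coeffC br a (node δ x p)) *
      (pairProd (fun p q : Str α ↦ br (node δ x p + node δ x q + δ)) /
        pairProd (fun p q : Str α ↦ br (node δ x p + node δ x q))) := by
  have hc : ∏ p : Str α, coeffC br a (node δ x p) =
      (∏ i, ∏ p, shifted br δ (x i + δ / 2 + a p) (α i)) / ∏ p : Str α, br (2 * node δ x p) := by
    simp only [coeffC, prod_div_distrib]
    congr 1
    rw [prod_str]
    refine prod_congr rfl fun i _ ↦ ?_
    rw [prod_comm]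
    refine prod_congr rfl fun p _ ↦ ?_
    rw [shifted, prod_range]
    refine prod_congr rfl fun r _ ↦ ?_
    rw [node_mk]; congr 1; ring
  rw [hc, prefactor]
  simp only [prod_div_distrib]
  have key := pairProd_node_add (br := br) (δ := δ) (α := α) x
  have n1 : ∏ i, shifted br δ (2 * x i + δ) (α i) ≠ 0 := prod_ne_zero_iff.mpr fun i _ ↦
    h.shifted_ne_of_eq (hg.two i) 2 (by push_cast; ring) _
  have n2 : ∏ i, ∏ j ∈ Ioi i, shifted br δ (x i + x j + δ) (α i) ≠ 0 :=
    prod_ne_zero_iff.mpr fun i _ ↦ prod_ne_zero_iff.mpr fun j hj ↦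
      h.shifted_ne_of_eq (hg.add i j (mem_Ioi.mp hj).ne) 2 (by push_cast; ring) _
  have n3 : ∏ p : Str α, br (2 * node δ x p) ≠ 0 :=
    prod_ne_zero_iff.mpr fun p _ ↦ h.two_node_ne_zero hg p
  have n4 : pairProd (fun p q : Str α ↦ br (node δ x p + node δ x q)) ≠ 0 := by
    simpa using h.pairProd_node_add_ne_zero (α := α) hg 0
  rw [div_mul_div_comm, div_mul_div_comm, div_eq_div_iff (mul_ne_zero n1 n2) (mul_ne_zero n3 n4)]
  linear_combination -(∏ i, ∏ p, shifted br δ (x i + δ / 2 + a p) (α i)) * key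

/-- At μ = 0 all signs are plus and the omitted points are the x_i. The bracketed products treat the
two sides alike up to the order of differences, so comparing the sides leaves only the prefactors
and the denominators. -/
lemma strTerm_zero (hg : GenericSide Λ a x y) (e : Str α ≃o Str β) :
    strTerm br δ a e.toEquiv x (node δ y) 0 = prefactor br δ a α x *
      (pairProd (fun p q : Str α ↦ br (node δ x p + node δ x q)) *
        pairProd (fun p q : Str α ↦ br (node δ x p - node δ x q)) *
        pairProd (fun k l : Str β ↦ br (node δ y k + node δ y l)) *
        pairProd (fun k l : Str β ↦ br (node δ y l - node δ y k))) /
        ∏ p : Str α, ∏ k : Str β, pm br (node δ x p + δ / 2) (node δ y k) := by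
  have n4 : pairProd (fun p q : Str α ↦ br (node δ x p + node δ x q)) ≠ 0 := by
    simpa using h.pairProd_node_add_ne_zero (α := α) hg 0
  rw [h.strTerm_eq_cauchy hg, h.prefactor_eq hg]
  have e1 (p : Str α) : signed (stepSign 0 p) (node δ x p) = node δ x p := by
    simp [stepSign, signed]
  have e2 : pairProd (fun p q : Str α ↦ pm br (skipNode δ x 0 p) (skipNode δ x 0 q)) =
      pairProd (fun p q : Str α ↦ br (node δ x p + node δ x q + δ)) *
        pairProd (fun p q : Str α ↦ br (node δ x p - node δ x q)) := by
    rw [← pairProd_mul]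
    congr 1; ext p q
    rw [skipNode_zero, skipNode_zero, pm]
    congr 2 <;> ring
  have e3 : pairProd (fun k l : Str β ↦ pm br (node δ y l) (node δ y k)) =
      pairProd (fun k l : Str β ↦ br (node δ y k + node δ y l)) *
        pairProd (fun k l : Str β ↦ br (node δ y l - node δ y k)) := by
    rw [← pairProd_mul]
    congr 1; ext k l
    rw [pm, add_comm (node δ y l)]
  rw [e2, e3]
  simp only [e1, skipNode_zero]
  generalize (∏ p : Str α, ∏ k : Str β, pm br (node δ x p + δ / 2) (node δ y k)) = E
  generalize pairProd (fun p q : Str α ↦ br (node δ x p + node δ x q)) = A at *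
  field_simp

/-- Moving the shift δ/2 from the x-nodes to the y-nodes reverses each difference, which gives the
sign, and moves it by δ; this telescopes along the x-strings to the cross factor. -/
lemma prod_pm_node_swap (x : Fin m → ℂ) (y : Fin n → ℂ)
    (hne : ∀ k i, shifted br δ (y k - x i + δ / 2) (β k) ≠ 0) :
    ∏ p : Str α, ∏ k : Str β, pm br (node δ x p + δ / 2) (node δ y k) =
      (-1) ^ ((∑ i, α i) * ∑ k, β k) *
      (∏ k, ∏ i, shifted br δ (y k - x i + δ / 2 - α i * δ) (β k) /
          shifted br δ (y k - x i + δ / 2) (β k)) *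
        ∏ k : Str β, ∏ p : Str α, pm br (node δ y k + δ / 2) (node δ x p) := by
  have e1 : ∏ p : Str α, ∏ k : Str β, pm br (node δ x p + δ / 2) (node δ y k) =
      (-1) ^ ((∑ i, α i) * ∑ k, β k) *
      (∏ k : Str β, ∏ p : Str α, br (node δ y k + δ / 2 + node δ x p)) *
        ∏ k : Str β, ∏ p : Str α, br (node δ y k - node δ x p - δ / 2) := by
    have (p : Str α) (k : Str β) : pm br (node δ x p + δ / 2) (node δ y k) =
        -1 * (br (node δ y k + δ / 2 + node δ x p) * br (node δ y k - node δ x p - δ / 2)) := by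
      rw [pm, show node δ x p + δ / 2 - node δ y k = -(node δ y k - node δ x p - δ / 2) by ring,
        h.neg, show node δ x p + δ / 2 + node δ y k = node δ y k + δ / 2 + node δ x p by ring]
      ring
    have hcard {m : ℕ} (α : Fin m → ℕ) : Fintype.card (Str α) = ∑ i, α i := by
      rw [Fintype.card_lex, Fintype.card_sigma]; simp
    simp only [this]
    rw [prod_comm]
    simp only [prod_mul_distrib, prod_const, card_univ, hcard]
    rw [← pow_mul]
    ring
  have e2 (k : Fin n) (i : Fin m) :
      ∏ s : Fin (β k), ∏ r : Fin (α i), br (node δ y (Str.mk k s) - node δ x (Str.mk i r) - δ / 2) =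
      shifted br δ (y k - x i + δ / 2 - α i * δ) (β k) / shifted br δ (y k - x i + δ / 2) (β k) *
        ∏ s : Fin (β k), ∏ r : Fin (α i),
          br (node δ y (Str.mk k s) + δ / 2 - node δ x (Str.mk i r)) := by
    have key := prod_range_shift_mul
      (fun r ↦ shifted br δ (y k - x i + δ / 2 - r * δ) (β k)) (α i)
    simp only [Nat.cast_zero, zero_mul, sub_zero] at key
    rw [div_mul_eq_mul_div, eq_div_iff (hne k i), mul_comm (shifted br δ _ _) (∏ s, _)]
    rw [prod_comm, prod_comm (f := fun s r ↦ br (node δ y (Str.mk k s) + δ / 2 - node δ x (Str.mk i r)))]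
    rw [prod_range, prod_range] at key
    convert key using 2
    · refine prod_congr rfl fun r _ ↦ ?_
      rw [shifted, prod_range]
      refine prod_congr rfl fun s _ ↦ ?_
      rw [node_mk, node_mk]; congr 1; push_cast; ring
    · refine prod_congr rfl fun r _ ↦ ?_
      rw [shifted, prod_range]
      refine prod_congr rfl fun s _ ↦ ?_
      rw [node_mk, node_mk]; congr 1; ring
  have e3 (F : Str β → Str α → ℂ) : ∏ k : Str β, ∏ p : Str α, F k p =
      ∏ k, ∏ i, ∏ s, ∏ r, F (Str.mk k s) (Str.mk i r) := by
    simp only [prod_str]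
    exact prod_congr rfl fun k _ ↦ prod_comm
  rw [e1, e3 (fun k p ↦ br (node δ y k - node δ x p - δ / 2))]
  simp only [e2, prod_mul_distrib, pm, e3 (fun k p ↦ br (node δ y k + δ / 2 - node δ x p))]
  ring

/-- Both index sets have the same number of pairs, so the sign changes cancel. -/
lemma pairProd_swap {ι κ : Type*} [Fintype ι] [LinearOrder ι] [Fintype κ] [LinearOrder κ]
    (e : ι ≃o κ) (X : ι → ℂ) (Y : κ → ℂ) :
    pairProd (fun p q ↦ br (X p - X q)) * pairProd (fun k l ↦ br (Y l - Y k)) =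
      pairProd (fun p q ↦ br (X q - X p)) * pairProd (fun k l ↦ br (Y k - Y l)) := by
  rw [← pairProd_orderIso e, ← pairProd_orderIso e, ← pairProd_mul, ← pairProd_mul]
  refine pairProd_congr fun p q _ ↦ ?_
  rw [h.sub_comm (X p), h.sub_comm (Y (e q))]
  ring

lemma pairProd_node_sub_ne_zero (hg : GenericSide Λ a x y) :
    pairProd (fun p q : Str α ↦ br (node δ x p - node δ x q)) ≠ 0 := by
  refine pairProd_ne_zero fun p q hpq ↦ ?_
  by_cases hij : (ofLex p).1 = (ofLex q).1
  · refine h.int_ne (((ofLex p).2 : ℕ) - ((ofLex q).2 : ℕ)) (fun h0 ↦ hpq.ne ?_)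
      (by simp only [node, ← hij]; push_cast; ring)
    have h1 : ((ofLex p).2 : ℕ) = ((ofLex q).2 : ℕ) := by omega
    refine ofLex.injective (Sigma.ext hij ?_)
    exact (Fin.heq_ext_iff (by rw [hij])).mpr h1
  · exact h.ne_of_eq (hg.sub _ _ hij) (2 * ((ofLex p).2 : ℕ) - 2 * ((ofLex q).2 : ℕ))
      (by simp only [node]; push_cast; ring)

/-- The duality transformation for generic variables in the case `|α| = |β|`. -/
lemma duality_of_sum_eq {b : Fin 4 → ℂ} (hb : ∀ p, b p = δ / 2 - a p) (hgx : GenericSide Λ a x y)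
    (hgy : GenericSide Λ b y x) (hαβ : ∑ i, α i = ∑ k, β k) (ha : ∑ p, a p = δ)
    (ha' : br (a 2 + a 3 - δ) ≠ 0) :
    prefactor br δ a α x * series br δ a α β x y =
      (-1) ^ (∑ k, β k) * (∏ k, ∏ i, shifted br δ (y k - x i + δ / 2 - α i * δ) (β k) /
          shifted br δ (y k - x i + δ / 2) (β k)) *
        prefactor br δ b β y * series br δ b β α y x := by
  obtain rfl : b = fun p ↦ δ / 2 - a p := funext hb
  have hcard {m : ℕ} (α : Fin m → ℕ) : Fintype.card (Str α) = ∑ i, α i := by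
    rw [Fintype.card_lex, Fintype.card_sigma]; simp
  let e : Str α ≃o Str β := (Fintype.orderIsoFinOfCardEq (Str α) ((hcard α).trans hαβ)).symm.trans
    (Fintype.orderIsoFinOfCardEq (Str β) (hcard β))
  have key := h.signSum_duality a ha ha' e.toEquiv (node δ x) (node δ y)
    (h.two_node_ne_zero hgx) (h.two_node_ne_zero hgy)
    (fun p q ↦ h.ne_of_eq (hgx.cross_add (ofLex p).1 (ofLex q).1)
      (3 + 2 * ((ofLex p).2 : ℕ) + 2 * ((ofLex q).2 : ℕ)) (by simp only [node]; push_cast; ring))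
    (fun p q ↦ h.ne_of_eq (hgx.cross_sub (ofLex p).1 (ofLex q).1)
      (1 + 2 * ((ofLex p).2 : ℕ) - 2 * ((ofLex q).2 : ℕ)) (by simp only [node]; push_cast; ring))
    (fun p q ↦ h.ne_of_eq (hgx.cross_add (ofLex p).1 (ofLex q).1)
      (1 + 2 * ((ofLex p).2 : ℕ) + 2 * ((ofLex q).2 : ℕ)) (by simp only [node]; push_cast; ring))
    (fun p q ↦ h.ne_of_eq (hgx.cross_sub (ofLex p).1 (ofLex q).1)
      (-1 + 2 * ((ofLex p).2 : ℕ) - 2 * ((ofLex q).2 : ℕ)) (by simp only [node]; push_cast; ring))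
  rw [h.signSum_node, show e.toEquiv.symm = e.symm.toEquiv from rfl, h.signSum_node,
    sum_congr rfl fun μ hμ ↦ h.strTerm_eq hgx e (mem_Icc.mp hμ).2,
    sum_congr rfl fun μ hμ ↦ h.strTerm_eq hgy e.symm (mem_Icc.mp hμ).2, ← mul_sum, ← mul_sum,
    h.strTerm_zero hgx, h.strTerm_zero hgy] at key
  change _ * series br δ a α β x y = _ * series br δ _ β α y x at key
  have hne (k : Fin n) (i : Fin m) : shifted br δ (y k - x i + δ / 2) (β k) ≠ 0 :=
    h.shifted_ne_of_eq (hgy.cross_sub k i) 1 (by push_cast; ring) _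
  have hE := h.prod_pm_node_swap (α := α) (β := β) x y hne
  -- With equal totals the exponent is a square, of the same parity as its root.
  have hsign : (-1 : ℂ) ^ ((∑ i, α i) * ∑ k, β k) = (-1) ^ (∑ k, β k) := by
    rw [hαβ]
    rcases Nat.even_or_odd (∑ k, β k) with he | ho
    · rw [he.neg_one_pow, (he.mul_left _).neg_one_pow]
    · rw [ho.neg_one_pow, (ho.mul ho).neg_one_pow]
  rw [hsign] at hE
  have hswap := h.pairProd_swap e (node δ x) (node δ y)
  have n1 : pairProd (fun p q : Str α ↦ br (node δ x p + node δ x q)) ≠ 0 := by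
    simpa using h.pairProd_node_add_ne_zero (α := α) hgx 0
  have n2 : pairProd (fun p q : Str β ↦ br (node δ y p + node δ y q)) ≠ 0 := by
    simpa using h.pairProd_node_add_ne_zero (α := β) hgy 0
  have n3 := h.pairProd_node_sub_ne_zero (α := α) hgx
  have n4 : pairProd (fun k l : Str β ↦ br (node δ y l - node δ y k)) ≠ 0 := by
    have e4 : pairProd (fun k l : Str β ↦ br (node δ y l - node δ y k)) =
        pairProd (fun k l : Str β ↦ (-1 : ℂ) * br (node δ y k - node δ y l)) :=
      pairProd_congr fun k l _ ↦ by rw [h.sub_comm, neg_one_mul]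
    rw [e4, pairProd_mul (fun _ _ ↦ (-1 : ℂ))]
    exact mul_ne_zero (pairProd_ne_zero fun _ _ _ ↦ by norm_num)
      (h.pairProd_node_sub_ne_zero hgy)
  have n5 : ∏ p : Str α, ∏ k : Str β, pm br (node δ x p + δ / 2) (node δ y k) ≠ 0 := by
    refine prod_ne_zero_iff.mpr fun p _ ↦ prod_ne_zero_iff.mpr fun k _ ↦ ?_
    rw [← skipNode_zero]
    exact h.pm_skipNode_node_ne_zero hgx 0 p k
  have n6 : ∏ k : Str β, ∏ p : Str α, pm br (node δ y k + δ / 2) (node δ x p) ≠ 0 := by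
    refine prod_ne_zero_iff.mpr fun p _ ↦ prod_ne_zero_iff.mpr fun k _ ↦ ?_
    rw [← skipNode_zero]
    exact h.pm_skipNode_node_ne_zero hgy 0 p k
  generalize (∏ p : Str α, ∏ k : Str β, pm br (node δ x p + δ / 2) (node δ y k)) = E at *
  generalize (∏ k : Str β, ∏ p : Str α, pm br (node δ y k + δ / 2) (node δ x p)) = E' at *
  generalize pairProd (fun p q : Str α ↦ br (node δ x p + node δ x q)) = A at *
  generalize pairProd (fun p q : Str β ↦ br (node δ y p + node δ y q)) = B at *
  generalize pairProd (fun p q : Str α ↦ br (node δ x p - node δ x q)) = C at *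
  generalize pairProd (fun p q : Str α ↦ br (node δ x q - node δ x p)) = C' at *
  generalize pairProd (fun p q : Str β ↦ br (node δ y p - node δ y q)) = D at *
  generalize pairProd (fun p q : Str β ↦ br (node δ y q - node δ y p)) = D' at *
  generalize (∏ k, ∏ i, shifted br δ (y k - x i + δ / 2 - α i * δ) (β k) /
    shifted br δ (y k - x i + δ / 2) (β k)) = R at *
  generalize prefactor br δ a α x = P at *
  generalize prefactor br δ (fun p ↦ δ / 2 - a p) β y = Q at *
  generalize series br δ a α β x y = S at *
  generalize series br δ (fun p ↦ δ / 2 - a p) β α y x = T at *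
  have hU : A * C * B * D' ≠ 0 := mul_ne_zero (mul_ne_zero (mul_ne_zero n1 n3) n2) n4
  have hU' : B * D * A * C' = A * C * B * D' := by linear_combination -A * B * hswap
  rw [hU', div_mul_eq_mul_div, div_mul_eq_mul_div, div_eq_div_iff n5 n6, hE] at key
  refine mul_left_cancel₀ (mul_ne_zero hU n6) ?_
  linear_combination key

end IsThetaBracket

end EllipticC

end

/-! ### Unequal total multiplicities -/

noncomputable section

namespace EllipticC

open Finset

variable {br : ℂ → ℂ} {δ : ℂ} {Λ : AddSubgroup ℂ}

/-- Genericity of all variables and parameters of the duality transformation. -/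
structure Generic (Λ : AddSubgroup ℂ) (a : Fin 4 → ℂ) {m n : ℕ} (x : Fin m → ℂ)
    (y : Fin n → ℂ) : Prop where
  two_x : ∀ i, 2 * x i ∉ Λ
  two_y : ∀ k, 2 * y k ∉ Λ
  add_x : ∀ i j, i ≠ j → x i + x j ∉ Λ
  sub_x : ∀ i j, i ≠ j → x i - x j ∉ Λ
  add_y : ∀ k l, k ≠ l → y k + y l ∉ Λ
  sub_y : ∀ k l, k ≠ l → y k - y l ∉ Λ
  x_add_y : ∀ i k, x i + y k ∉ Λ
  x_sub_y : ∀ i k, x i - y k ∉ Λ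
  x_add_a : ∀ i p, x i + a p ∉ Λ
  x_sub_a : ∀ i p, x i - a p ∉ Λ
  y_add_a : ∀ k p, y k + a p ∉ Λ
  y_sub_a : ∀ k p, y k - a p ∉ Λ
  add_a : ∀ p q, a p + a q ∉ Λ

section Products

lemma prod_Ioi_castSucc {n : ℕ} (F : Fin (n + 1) → Fin (n + 1) → ℂ) :
    ∏ i, ∏ j ∈ Ioi i, F i j = (∏ i : Fin n, ∏ j ∈ Ioi i, F i.castSucc j.castSucc) *
      ∏ i : Fin n, F i.castSucc (Fin.last n) := by
  rw [← pairProd_fin, ← pairProd_fin fun i j : Fin n ↦ F i.castSucc j.castSucc]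
  simp only [pairProd, Fin.prod_univ_castSucc, Fin.castSucc_lt_castSucc_iff,
    Fin.castSucc_lt_last, if_true, prod_mul_distrib, lt_irrefl, if_false]
  have (i : Fin n) : ¬ Fin.last n < i.castSucc := not_lt.mpr (Fin.le_last _)
  simp [this]

lemma prod_Ioi_zero_fin_four (f : Fin 4 → ℂ) : ∏ p ∈ Ioi (0 : Fin 4), f p = f 1 * f 2 * f 3 := by
  rw [show Ioi (0 : Fin 4) = {1, 2, 3} by decide]
  simp [mul_assoc]

lemma prod_pairs_Ioi_zero_fin_four (f : Fin 4 → Fin 4 → ℂ) :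
    ∏ p ∈ Ioi (0 : Fin 4), ∏ q ∈ Ioi p, f p q = f 1 2 * f 1 3 * f 2 3 := by
  rw [prod_Ioi_zero_fin_four, show Ioi (1 : Fin 4) = {2, 3} by decide,
    show Ioi (2 : Fin 4) = {3} by decide, show Ioi (3 : Fin 4) = ∅ by decide]
  simp

end Products

namespace IsThetaBracket

variable {m n : ℕ} {a : Fin 4 → ℂ} {α : Fin m → ℕ} {β : Fin n → ℕ} {x : Fin m → ℂ} {y : Fin n → ℂ}

variable (h : IsThetaBracket br δ Λ)
include h

omit h in
lemma shifted_one (u : ℂ) : shifted br δ u 1 = br u := by simp [shifted]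

lemma shifted_reflect (u : ℂ) (d : ℕ) :
    shifted br δ (δ - u - d * δ) d = (-1) ^ d * shifted br δ u d := by
  have key := prod_range_sub_eq_shifted (br := br) (δ := δ) (-u) d
  rw [show -u + δ - d * δ = δ - u - d * δ by ring] at key
  rw [← key, shifted, show (-1 : ℂ) ^ d = ∏ _s ∈ range d, (-1) by rw [prod_const, card_range],
    ← prod_mul_distrib]
  refine prod_congr rfl fun s _ ↦ ?_
  rw [show -u - s * δ = -(u + s * δ) by ring, h.neg, neg_one_mul]

variable {d : ℕ} {a' : Fin 4 → ℂ}

/-- The effect on a term of adjoining the variable `-(a₀ + dδ)` with multiplicity `d` to `y`. -/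
lemma term_snoc_right (hx : ∀ i, x i + a 0 ∉ Λ) (hx' : ∀ i, x i - a 0 ∉ Λ) (h0 : a' 0 = a 0 + d * δ)
    (hs : ∀ p : Fin 3, a' p.succ = a p.succ) (μ : Fin m → ℕ) :
    term br δ a' α (Fin.snoc β d : Fin (n + 1) → ℕ) x (Fin.snoc y (-a' 0) : Fin (n + 1) → ℂ) μ =
      term br δ a α β x y μ := by
  simp only [term, Fin.prod_univ_castSucc (n := n), Fin.snoc_castSucc, Fin.snoc_last,
    Fin.prod_univ_succ (n := 3), hs, prod_mul_distrib]
  -- Two of the cross factors of the adjoined variable cancel those of the parameter a'₀; the other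
  -- two are those of a₀ = a'₀ - dδ.
  have key : (∏ i, shifted br δ (x i + δ / 2 - a' 0) (μ i) / shifted br δ (x i + δ / 2 + a' 0) (μ i)) *
      (∏ i, shifted br δ (x i + -a' 0 + δ / 2 + d * δ) (μ i) *
          shifted br δ (x i - -a' 0 + δ / 2) (μ i) /
        (shifted br δ (x i + -a' 0 + δ / 2) (μ i) *
          shifted br δ (x i - -a' 0 + δ / 2 - d * δ) (μ i))) =
      ∏ i, shifted br δ (x i + δ / 2 - a 0) (μ i) / shifted br δ (x i + δ / 2 + a 0) (μ i) := by
    rw [← prod_mul_distrib]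
    refine prod_congr rfl fun i _ ↦ ?_
    have n1 := h.shifted_ne_of_eq (hx i) (1 + 2 * d) (w := x i + δ / 2 + a' 0)
      (by rw [h0]; push_cast; ring) (μ i)
    have n2 := h.shifted_ne_of_eq (hx' i) (1 - 2 * d) (w := x i + δ / 2 - a' 0)
      (by rw [h0]; push_cast; ring) (μ i)
    rw [show x i + -a' 0 + δ / 2 + d * δ = x i + δ / 2 - a 0 by rw [h0]; ring,
      show x i - -a' 0 + δ / 2 - d * δ = x i + δ / 2 + a 0 by rw [h0]; ring,
      show x i + -a' 0 + δ / 2 = x i + δ / 2 - a' 0 by ring,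
      show x i - -a' 0 + δ / 2 = x i + δ / 2 + a' 0 by ring]
    rw [div_mul_div_comm, mul_comm (shifted br δ (x i + δ / 2 - a 0) (μ i)), ← mul_assoc,
      ← mul_assoc, mul_comm (shifted br δ (x i + δ / 2 - a' 0) (μ i)),
      mul_div_mul_left _ _ (mul_ne_zero n1 n2)]
  rw [← key]
  ring

lemma series_snoc_right (hx : ∀ i, x i + a 0 ∉ Λ) (hx' : ∀ i, x i - a 0 ∉ Λ)
    (h0 : a' 0 = a 0 + d * δ) (hs : ∀ p : Fin 3, a' p.succ = a p.succ) :
    series br δ a' α (Fin.snoc β d : Fin (n + 1) → ℕ) x (Fin.snoc y (-a' 0) : Fin (n + 1) → ℂ) =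
      series br δ a α β x y :=
  sum_congr rfl fun μ _ ↦ h.term_snoc_right hx hx' h0 hs μ

omit h in
lemma prefactor_mul_prod (h0 : a' 0 = a 0 + d * δ) (hs : ∀ p : Fin 3, a' p.succ = a p.succ)
    (hne : ∀ i, shifted br δ (x i + δ / 2 + a 0) (α i) ≠ 0) :
    prefactor br δ a' α x = prefactor br δ a α x *
      ∏ i, shifted br δ (x i + δ / 2 + a 0 + d * δ) (α i) / shifted br δ (x i + δ / 2 + a 0) (α i) := by
  rw [prefactor, prefactor, mul_right_comm, ← prod_mul_distrib, ← prod_mul_distrib,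
    ← prod_mul_distrib]
  refine prod_congr rfl fun i _ ↦ ?_
  have := hne i
  simp only [Fin.prod_univ_succ (n := 3), hs, h0, ← add_assoc]
  generalize shifted br δ (x i + δ / 2 + a 0) (α i) = A at *
  field_simp

/-- The terms with positive last index vanish after the specialization of `series_snoc_right`. -/
lemma term_snoc_left_eq_zero {b : Fin 4 → ℂ} {t : ℂ} (ht : t = b 0 - δ / 2)
    {μ : Fin (n + 1) → ℕ} (hμ : μ (Fin.last n) ≠ 0) :
    term br δ b (Fin.snoc β d : Fin (n + 1) → ℕ) α (Fin.snoc y t : Fin (n + 1) → ℂ) x μ = 0 := by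
  -- The first factor is [t + δ/2 - b₀] = [0], present as soon as the last index is positive.
  have : shifted br δ (t + δ / 2 - b 0) (μ (Fin.last n)) = 0 := by
    refine prod_eq_zero (mem_range.mpr (Nat.pos_of_ne_zero hμ)) ?_
    rw [ht, show b 0 - δ / 2 + δ / 2 - b 0 + ((0 : ℕ) : ℂ) * δ = 0 by push_cast; ring, h.zero]
  have hz : ∏ i, ∏ p, shifted br δ ((Fin.snoc y t : Fin (n + 1) → ℂ) i + δ / 2 - b p) (μ i) /
      shifted br δ ((Fin.snoc y t : Fin (n + 1) → ℂ) i + δ / 2 + b p) (μ i) = 0 := by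
    refine prod_eq_zero (mem_univ (Fin.last n)) (prod_eq_zero (mem_univ 0) ?_)
    rw [Fin.snoc_last, this, zero_div]
  rw [term, hz]
  ring

lemma term_snoc_left {b b' : Fin 4 → ℂ} {t : ℂ} (ht : t = b' 0 - δ / 2) (h0 : b 0 = b' 0 + d * δ)
    (hs : ∀ p : Fin 3, b' p.succ = b p.succ) (hadd : ∀ k, y k + t ∉ Λ) (hsub : ∀ k, y k - t ∉ Λ)
    (htwo : 2 * t ∉ Λ) (ν : Fin n → ℕ) :
    term br δ b' (Fin.snoc β d : Fin (n + 1) → ℕ) α (Fin.snoc y t : Fin (n + 1) → ℂ) x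
      (Fin.snoc ν 0 : Fin (n + 1) → ℕ) = term br δ b β α y x ν := by
  have htwo' : br (2 * t) ≠ 0 := h.ne_zero _ htwo
  rw [term, term, prod_Ioi_castSucc]
  simp only [Fin.prod_univ_castSucc (n := n), Fin.snoc_castSucc, Fin.snoc_last, shifted_zero, Fin.prod_univ_succ (n := 3), hs, prod_mul_distrib,
    Nat.cast_zero, mul_zero, zero_mul, add_zero, mul_one, div_self htwo', div_one, prod_const_one]
  -- With its index equal to 0, the adjoined variable still interacts with every y_k; these factors
  -- turn the parameter b'₀ into b₀ = b'₀ + dδ.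
  have key : (∏ k, shifted br δ (y k + δ / 2 - b' 0) (ν k) / shifted br δ (y k + δ / 2 + b' 0) (ν k)) *
      (∏ k, br (y k + ν k * δ + t) * br (y k + ν k * δ - t) / (br (y k + t) * br (y k - t))) *
      (∏ k, shifted br δ (y k + t) (ν k) * shifted br δ (y k - t - d * δ) (ν k) /
        (shifted br δ (y k + t + (d + 1) * δ) (ν k) * shifted br δ (y k - t + δ) (ν k))) =
      ∏ k, shifted br δ (y k + δ / 2 - b 0) (ν k) / shifted br δ (y k + δ / 2 + b 0) (ν k) := by
    rw [← prod_mul_distrib, ← prod_mul_distrib]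
    refine prod_congr rfl fun k _ ↦ ?_
    rw [h0, show y k + δ / 2 - b' 0 = y k - t by rw [ht]; ring,
      show y k + δ / 2 + b' 0 = y k + t + δ by rw [ht]; ring,
      show y k + δ / 2 - (b' 0 + d * δ) = y k - t - d * δ by rw [ht]; ring,
      show y k + δ / 2 + (b' 0 + d * δ) = y k + t + (d + 1) * δ by rw [ht]; ring,
      show y k + ν k * δ + t = y k + t + ν k * δ by ring,
      show y k + ν k * δ - t = y k - t + ν k * δ by ring]
    have e (u : ℂ) := shifted_mul_comm (br := br) (δ := δ) u 1 (ν k)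
    have e1 := e (y k + t)
    have e2 := e (y k - t)
    simp only [shifted_one, Nat.cast_one, one_mul] at e1 e2
    have n1 : br (y k + t) ≠ 0 := h.ne_zero _ (hadd k)
    have n2 : br (y k - t) ≠ 0 := h.ne_zero _ (hsub k)
    have n3 := h.shifted_ne_of_eq (hadd k) 2 (w := y k + t + δ) (by push_cast; ring) (ν k)
    have n4 := h.shifted_ne_of_eq (hsub k) 2 (w := y k - t + δ) (by push_cast; ring) (ν k)
    have n5 := h.shifted_ne_of_eq (hadd k) (2 * (d + 1)) (w := y k + t + (d + 1) * δ)
      (by push_cast; ring) (ν k)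
    generalize shifted br δ (y k + t + (d + 1) * δ) (ν k) = A at *
    generalize shifted br δ (y k - t - d * δ) (ν k) = B at *
    generalize shifted br δ (y k + t + δ) (ν k) = C at *
    generalize shifted br δ (y k - t + δ) (ν k) = D at *
    generalize br (y k + t + ν k * δ) = E at *
    generalize br (y k - t + ν k * δ) = F at *
    generalize shifted br δ (y k - t) (ν k) = G at *
    generalize shifted br δ (y k + t) (ν k) = H at *
    field_simp
    linear_combination B * (-D * br (y k - t) * e1 - E * H * e2)
  rw [← key]
  ring

lemma series_snoc_left {b b' : Fin 4 → ℂ} {t : ℂ} (ht : t = b' 0 - δ / 2)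
    (h0 : b 0 = b' 0 + d * δ) (hs : ∀ p : Fin 3, b' p.succ = b p.succ)
    (hadd : ∀ k, y k + t ∉ Λ) (hsub : ∀ k, y k - t ∉ Λ) (htwo : 2 * t ∉ Λ) :
    series br δ b' (Fin.snoc β d : Fin (n + 1) → ℕ) α (Fin.snoc y t : Fin (n + 1) → ℂ) x =
      series br δ b β α y x := by
  symm
  refine sum_of_injOn (fun ν ↦ (Fin.snoc ν 0 : Fin (n + 1) → ℕ)) ?_ ?_ ?_ ?_
  · intro ν _ ν' _ hν
    exact (Fin.snoc_injective2 hν).1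
  · intro ν hν
    simp only [coe_Icc, Set.mem_Icc] at hν ⊢
    refine ⟨fun i ↦ Nat.zero_le _, fun i ↦ ?_⟩
    refine Fin.lastCases ?_ (fun i ↦ ?_) i
    · simp
    · simpa using hν.2 i
  · intro μ hμ hμ'
    refine h.term_snoc_left_eq_zero ht fun hlast ↦ hμ' ⟨Fin.init μ, ?_, ?_⟩
    · simp only [coe_Icc, Set.mem_Icc]
      refine ⟨fun i ↦ Nat.zero_le _, fun i ↦ ?_⟩
      simpa using! (mem_Icc.mp hμ).2 i.castSucc
    · simp only [← hlast]
      exact Fin.snoc_init_self μ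
  · intro ν _
    exact (h.term_snoc_left ht h0 hs hadd hsub htwo ν).symm

lemma prefactor_snoc {b b' : Fin 4 → ℂ} {t : ℂ} (ht : t = b' 0 - δ / 2)
    (h0 : b 0 = b' 0 + d * δ) (hs : ∀ p : Fin 3, b' p.succ = b p.succ)
    (hadd : ∀ k, y k + t ∉ Λ) (htwo : 2 * t ∉ Λ) :
    prefactor br δ b' (Fin.snoc β d : Fin (n + 1) → ℕ) (Fin.snoc y t : Fin (n + 1) → ℂ) =
      prefactor br δ b β y * ∏ p : Fin 3, shifted br δ (b' 0 + b p.succ) d := by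
  rw [prefactor, prefactor, prod_Ioi_castSucc]
  simp only [Fin.prod_univ_castSucc (n := n), Fin.snoc_castSucc, Fin.snoc_last, Fin.prod_univ_succ (n := 3), hs]
  have n1 := h.shifted_ne_of_eq htwo 2 (w := 2 * t + δ) (by push_cast; ring) d
  rw [show t + δ / 2 + b' 0 = 2 * t + δ by rw [ht]; ring, mul_div_cancel_left₀ _ n1]
  have key : (∏ k, (shifted br δ (y k + δ / 2 + b' 0) (β k) *
        ∏ p : Fin 3, shifted br δ (y k + δ / 2 + b p.succ) (β k)) /
          shifted br δ (2 * y k + δ) (β k)) *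
      (∏ k, shifted br δ (y k + t + (d + 1) * δ) (β k) / shifted br δ (y k + t + δ) (β k)) =
      ∏ k, (shifted br δ (y k + δ / 2 + b 0) (β k) *
        ∏ p : Fin 3, shifted br δ (y k + δ / 2 + b p.succ) (β k)) /
          shifted br δ (2 * y k + δ) (β k) := by
    rw [← prod_mul_distrib]
    refine prod_congr rfl fun k _ ↦ ?_
    have n2 := h.shifted_ne_of_eq (hadd k) 2 (w := y k + t + δ) (by push_cast; ring) (β k)
    rw [h0, show y k + δ / 2 + b' 0 = y k + t + δ by rw [ht]; ring,
      show y k + δ / 2 + (b' 0 + d * δ) = y k + t + (d + 1) * δ by rw [ht]; ring]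
    generalize shifted br δ (y k + t + (d + 1) * δ) (β k) = A
    field_simp
  rw [← key]
  have e (p : Fin 3) : t + δ / 2 + b p.succ = b' 0 + b p.succ := by rw [ht]; ring
  simp only [e]
  ring

/-- The duality transformation for generic variables in the case `|β| ≤ |α|`. -/
lemma duality_of_sum_eq_add {b : Fin 4 → ℂ} (hb : ∀ p, b p = δ / 2 - a p) (hg : Generic Λ a x y)
    (hαβ : ∑ i, α i = ∑ k, β k + d) (ha : ∑ p, a p = (1 - d) * δ) :
    prefactor br δ a α x * series br δ a α β x y =
      (-1) ^ (∑ k, β k) * (∏ p : Fin 3, shifted br δ (a 0 + a p.succ) d) *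
        (∏ k, ∏ i, shifted br δ (y k - x i + δ / 2 - α i * δ) (β k) /
          shifted br δ (y k - x i + δ / 2) (β k)) *
        prefactor br δ b β y * series br δ b β α y x := by
  -- Raising a₀ by dδ makes ∑ a'_p = δ, as the case of equal totals requires; t = -a'₀ is the point
  -- at which the adjoined variable disappears from both series.
  set a' : Fin 4 → ℂ := Fin.cons (a 0 + d * δ) fun p ↦ a p.succ with ha'
  set b' : Fin 4 → ℂ := fun p ↦ δ / 2 - a' p with hb'
  have ha0 : a' 0 = a 0 + d * δ := rfl
  have has (p : Fin 3) : a' p.succ = a p.succ := rfl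
  set t : ℂ := -a' 0 with ht
  have htb : t = b' 0 - δ / 2 := by simp only [ht, hb']; ring
  have hb0 : b 0 = b' 0 + d * δ := by simp only [hb, hb', ha0]; ring
  have hbs (p : Fin 3) : b' p.succ = b p.succ := by simp only [hb, hb', has]
  have hadd (k : Fin n) : y k + t ∉ Λ :=
    h.notMem_of_eq (hg.y_sub_a k 0) (-(2 * d)) (by rw [ht, ha0]; push_cast; ring)
  have hsub (k : Fin n) : y k - t ∉ Λ :=
    h.notMem_of_eq (hg.y_add_a k 0) (2 * d) (by rw [ht, ha0]; push_cast; ring)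
  have hxt (i : Fin m) : x i + t ∉ Λ :=
    h.notMem_of_eq (hg.x_sub_a i 0) (-(2 * d)) (by rw [ht, ha0]; push_cast; ring)
  have hxt' (i : Fin m) : x i - t ∉ Λ :=
    h.notMem_of_eq (hg.x_add_a i 0) (2 * d) (by rw [ht, ha0]; push_cast; ring)
  have hneg {u : ℂ} (hu : u ∉ Λ) : -u ∉ Λ := fun hu' ↦ hu (neg_mem_iff.mp hu')
  have htwo : 2 * t ∉ Λ :=
    h.notMem_of_eq (hneg (hg.add_a 0 0)) (-(4 * d)) (by rw [ht, ha0]; push_cast; ring)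
  have hflip {u v : ℂ} (hu : u - v ∉ Λ) : v - u ∉ Λ := by simpa using hneg hu
  set y' : Fin (n + 1) → ℂ := Fin.snoc y t with hy'
  have hgx : GenericSide Λ a' x y' := by
    refine ⟨hg.two_x, hg.add_x, hg.sub_x, fun i k ↦ ?_, fun i k ↦ ?_, fun i p ↦ ?_⟩
    · refine Fin.lastCases ?_ (fun k ↦ ?_) k
      · simpa [hy'] using hxt i
      · simpa [hy'] using hg.x_add_y i k
    · refine Fin.lastCases ?_ (fun k ↦ ?_) k
      · simpa [hy'] using hxt' i
      · simpa [hy'] using hg.x_sub_y i k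
    · refine Fin.cases ?_ (fun p ↦ ?_) p
      · exact h.notMem_of_eq (hg.x_add_a i 0) (2 * d) (by rw [ha0]; push_cast; ring)
      · rw [has]; exact hg.x_add_a i _
  have hgy : GenericSide Λ b' y' x := by
    refine ⟨fun k ↦ ?_, fun k l hkl ↦ ?_, fun k l hkl ↦ ?_, fun k i ↦ ?_, fun k i ↦ ?_,
      fun k p ↦ ?_⟩
    · refine Fin.lastCases ?_ (fun k ↦ ?_) k
      · simpa [hy'] using htwo
      · simpa [hy'] using hg.two_y k
    · induction k using Fin.lastCases with
      | last =>
        induction l using Fin.lastCases with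
        | last => exact absurd rfl hkl
        | cast l => simpa [hy', add_comm t] using hadd l
      | cast k =>
        induction l using Fin.lastCases with
        | last => simpa [hy'] using hadd k
        | cast l => simpa [hy'] using hg.add_y k l (fun e ↦ hkl (by rw [e]))
    · induction k using Fin.lastCases with
      | last =>
        induction l using Fin.lastCases with
        | last => exact absurd rfl hkl
        | cast l => simpa [hy'] using hflip (hsub l)
      | cast k =>
        induction l using Fin.lastCases with
        | last => simpa [hy'] using hsub k
        | cast l => simpa [hy'] using hg.sub_y k l (fun e ↦ hkl (by rw [e]))
    · refine Fin.lastCases ?_ (fun k ↦ ?_) k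
      · simpa [hy', add_comm t] using hxt i
      · simpa [hy', add_comm (y k)] using hg.x_add_y i k
    · refine Fin.lastCases ?_ (fun k ↦ ?_) k
      · simpa [hy'] using hflip (hxt' i)
      · simpa [hy'] using hflip (hg.x_sub_y i k)
    · refine Fin.lastCases ?_ (fun k ↦ ?_) k
      · refine Fin.cases ?_ (fun p ↦ ?_) p
        · exact h.notMem_of_eq (hneg (hg.add_a 0 0)) (1 - 4 * d)
            (by simp only [hy', Fin.snoc_last, ht, hb', ha0]; push_cast; ring)
        · exact h.notMem_of_eq (hneg (hg.add_a 0 p.succ)) (1 - 2 * d)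
            (by simp only [hy', Fin.snoc_last, ht, hb', ha0, has]; push_cast; ring)
      · refine Fin.cases ?_ (fun p ↦ ?_) p
        · exact h.notMem_of_eq (hg.y_sub_a k 0) (1 - 2 * d)
            (by simp only [hy', Fin.snoc_castSucc, hb', ha0]; push_cast; ring)
        · exact h.notMem_of_eq (hg.y_sub_a k p.succ) 1
            (by simp only [hy', Fin.snoc_castSucc, hb', has]; push_cast; ring)
  have hsum : ∑ p, a' p = δ := by
    rw [Fin.sum_univ_succ] at ha ⊢
    simp only [ha0, has]
    linear_combination ha
  have ha23 : br (a' 2 + a' 3 - δ) ≠ 0 :=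
    h.ne_of_eq (hg.add_a 2 3) (-2)
      (by rw [show a' 2 = a 2 from has 1, show a' 3 = a 3 from has 2]; push_cast; ring)
  have key := h.duality_of_sum_eq (β := (Fin.snoc β d : Fin (n + 1) → ℕ)) (b := b') (fun p ↦ rfl)
    hgx hgy (by rw [hαβ, Fin.sum_univ_castSucc]; simp) hsum ha23
  rw [h.series_snoc_right (fun i ↦ hg.x_add_a i 0) (fun i ↦ hg.x_sub_a i 0) ha0 has,
    h.series_snoc_left htb hb0 hbs hadd hsub htwo, h.prefactor_snoc htb hb0 hbs hadd htwo,
    prefactor_mul_prod ha0 has (fun i ↦ h.shifted_ne_of_eq (hg.x_add_a i 0) 1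
      (by push_cast; ring) _)] at key
  simp only [Fin.prod_univ_castSucc (n := n), Fin.sum_univ_castSucc (n := n), hy',
    Fin.snoc_castSucc, Fin.snoc_last] at key
  -- By reflection, the cross factor of the adjoined variable equals the change of the x-prefactor
  -- caused by a₀ ↦ a'₀, so the two cancel.
  have hAR : ∏ i, shifted br δ (t - x i + δ / 2 - α i * δ) d / shifted br δ (t - x i + δ / 2) d =
      ∏ i, shifted br δ (x i + δ / 2 + a 0 + d * δ) (α i) /
        shifted br δ (x i + δ / 2 + a 0) (α i) := by
    refine prod_congr rfl fun i _ ↦ ?_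
    have e := shifted_mul_comm (br := br) (δ := δ) (x i + δ / 2 + a 0) (α i) d
    have n1 := h.shifted_ne_of_eq (hg.x_add_a i 0) 1 (w := x i + δ / 2 + a 0) (by push_cast; ring) d
    have n2 := h.shifted_ne_of_eq (hg.x_add_a i 0) 1 (w := x i + δ / 2 + a 0) (by push_cast; ring)
      (α i)
    rw [show t - x i + δ / 2 - α i * δ = δ - (x i + δ / 2 + a 0 + α i * δ) - d * δ by
        rw [ht, ha0]; ring,
      show t - x i + δ / 2 = δ - (x i + δ / 2 + a 0) - d * δ by rw [ht, ha0]; ring,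
      h.shifted_reflect, h.shifted_reflect, mul_div_mul_left _ _ (pow_ne_zero _ (by norm_num)),
      div_eq_div_iff n1 n2]
    linear_combination e
  have hAne : ∏ i, shifted br δ (x i + δ / 2 + a 0 + d * δ) (α i) /
        shifted br δ (x i + δ / 2 + a 0) (α i) ≠ 0 :=
    prod_ne_zero_iff.mpr fun i _ ↦ div_ne_zero
      (h.shifted_ne_of_eq (hg.x_add_a i 0) (1 + 2 * d) (by push_cast; ring) _)
      (h.shifted_ne_of_eq (hg.x_add_a i 0) 1 (by push_cast; ring) _)
  have hB (p : Fin 3) : shifted br δ (b' 0 + b p.succ) d =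
      (-1) ^ d * shifted br δ (a 0 + a p.succ) d := by
    rw [← h.shifted_reflect, hb]
    simp only [hb', ha0]
    congr 1; ring
  simp only [hB, prod_mul_distrib, prod_const, card_univ, Fintype.card_fin] at key
  rw [hAR, pow_add] at key
  -- One sign (-1)^d comes from the enlarged total of β and three from reflecting the factors [b'₀ +
  -- b_p]_d.
  have hsq : ((-1 : ℂ) ^ d) ^ 4 = 1 := by rw [← pow_mul, mul_comm, pow_mul]; norm_num
  refine mul_right_cancel₀ hAne ?_
  generalize (-1 : ℂ) ^ d = s at *
  linear_combination key + (-1) ^ (∑ k, β k) * (∏ p : Fin 3, shifted br δ (a 0 + a p.succ) d) *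
        (∏ k, ∏ i, shifted br δ (y k - x i + δ / 2 - α i * δ) (β k) /
          shifted br δ (y k - x i + δ / 2) (β k)) *
        prefactor br δ b β y * series br δ b β α y x *
        (∏ i, shifted br δ (x i + δ / 2 + a 0 + d * δ) (α i) /
        shifted br δ (x i + δ / 2 + a 0) (α i)) * hsq

lemma cross_mul_cross (hg : Generic Λ a x y) :
    (∏ k, ∏ i, shifted br δ (y k - x i + δ / 2 - α i * δ) (β k) /
          shifted br δ (y k - x i + δ / 2) (β k)) *
      (∏ i, ∏ k, shifted br δ (x i - y k + δ / 2 - β k * δ) (α i) /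
          shifted br δ (x i - y k + δ / 2) (α i)) = 1 := by
  rw [prod_comm, ← prod_mul_distrib]
  refine prod_eq_one fun i _ ↦ ?_
  rw [← prod_mul_distrib]
  refine prod_eq_one fun k _ ↦ ?_
  have hyx : y k - x i ∉ Λ := fun h' ↦ hg.x_sub_y i k (by simpa using neg_mem h')
  have e := shifted_mul_comm (br := br) (δ := δ) (y k - x i + δ / 2 - α i * δ) (β k) (α i)
  rw [sub_add_cancel] at e
  have n1 := h.shifted_ne_of_eq hyx 1 (w := y k - x i + δ / 2) (by push_cast; ring) (β k)
  have n2 := h.shifted_ne_of_eq hyx (1 - 2 * α i) (w := y k - x i + δ / 2 - α i * δ)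
    (by push_cast; ring) (α i)
  rw [show x i - y k + δ / 2 - β k * δ =
      δ - (y k - x i + δ / 2 - α i * δ + β k * δ) - α i * δ by ring,
    show x i - y k + δ / 2 = δ - (y k - x i + δ / 2 - α i * δ) - α i * δ by ring,
    h.shifted_reflect, h.shifted_reflect, mul_div_mul_left _ _ (pow_ne_zero _ (by norm_num)),
    div_mul_div_comm, e, mul_comm, div_self (mul_ne_zero n1 n2)]

/-- The duality transformation for generic variables and parameters. -/
lemma duality_of_generic {b : Fin 4 → ℂ} (hb : ∀ p, b p = δ / 2 - a p) (hg : Generic Λ a x y)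
    {M N : ℕ} (hα : ∑ i, α i = M) (hβ : ∑ k, β k = N)
    (hbal : ∑ p, a p = ((N : ℂ) - M + 1) * δ) :
    (∏ p ∈ Ioi (0 : Fin 4), ∏ q ∈ Ioi p, shifted br δ (b p + b q) N) *
      prefactor br δ a α x * series br δ a α β x y =
    (-1) ^ N * (∏ p ∈ Ioi (0 : Fin 4), shifted br δ (a 0 + a p) M) *
      (∏ k, ∏ i, shifted br δ (y k - x i + δ / 2 - α i * δ) (β k) /
          shifted br δ (y k - x i + δ / 2) (β k)) *
      prefactor br δ b β y * series br δ b β α y x := by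
  rw [prod_pairs_Ioi_zero_fin_four (fun p q ↦ shifted br δ (b p + b q) N),
    prod_Ioi_zero_fin_four (fun p ↦ shifted br δ (a 0 + a p) M)]
  have hbal' := hbal
  rw [Fin.sum_univ_four] at hbal'
  rcases le_total N M with hNM | hMN
  · obtain ⟨d, rfl⟩ := Nat.exists_eq_add_of_le hNM
    have key := h.duality_of_sum_eq_add hb hg (by rw [hα, hβ])
      (by rw [hbal]; push_cast; ring)
    rw [hβ] at key
    simp only [Fin.prod_univ_three, show (Fin.succ 0 : Fin 4) = 1 from rfl,
      show (Fin.succ 1 : Fin 4) = 2 from rfl, show (Fin.succ 2 : Fin 4) = 3 from rfl] at key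
    push_cast at hbal'
    -- By the balancing condition, b_p + b_q = a₀ + a_r + dδ for {p,q,r} = {1,2,3}. Hence
    -- [a₀+a_r]_{N+d} splits into [a₀+a_r]_d and [b_p+b_q]_N.
    have e3 : b 1 + b 2 = a 0 + a 3 + d * δ := by rw [hb, hb]; linear_combination -hbal'
    have e2 : b 1 + b 3 = a 0 + a 2 + d * δ := by rw [hb, hb]; linear_combination -hbal'
    have e1 : b 2 + b 3 = a 0 + a 1 + d * δ := by rw [hb, hb]; linear_combination -hbal'
    rw [e1, e2, e3, add_comm N d, shifted_add, shifted_add, shifted_add]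
    linear_combination shifted br δ (a 0 + a 3 + d * δ) N * shifted br δ (a 0 + a 2 + d * δ) N *
      shifted br δ (a 0 + a 1 + d * δ) N * key
  -- The involution a ↦ δ/2 - a preserves the form of the balancing condition, so this is the
  -- previous case with the sides exchanged; `cross_mul_cross` moves the cross factor back.
  · obtain ⟨d, rfl⟩ := Nat.exists_eq_add_of_le hMN
    have hneg {u : ℂ} (hu : u ∉ Λ) : -u ∉ Λ := fun hu' ↦ hu (neg_mem_iff.mp hu')
    have hg' : Generic Λ b y x := by
      refine ⟨hg.two_y, hg.two_x, hg.add_y, hg.sub_y, hg.add_x, hg.sub_x,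
        fun i k ↦ ?_, fun i k ↦ ?_, fun k p ↦ ?_, fun k p ↦ ?_, fun k p ↦ ?_, fun k p ↦ ?_,
        fun p q ↦ ?_⟩
      · rw [add_comm]; exact hg.x_add_y k i
      · simpa using hneg (hg.x_sub_y k i)
      · exact h.notMem_of_eq (hg.y_sub_a k p) 1 (by rw [hb]; push_cast; ring)
      · exact h.notMem_of_eq (hg.y_add_a k p) (-1) (by rw [hb]; push_cast; ring)
      · exact h.notMem_of_eq (hg.x_sub_a k p) 1 (by rw [hb]; push_cast; ring)
      · exact h.notMem_of_eq (hg.x_add_a k p) (-1) (by rw [hb]; push_cast; ring)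
      · exact h.notMem_of_eq (hneg (hg.add_a p q)) 2 (by rw [hb, hb]; push_cast; ring)
    have hbsum : ∑ p, b p = (1 - d) * δ := by
      rw [Fin.sum_univ_four, hb, hb, hb, hb]
      push_cast at hbal'
      linear_combination -hbal'
    have key := h.duality_of_sum_eq_add (b := a) (fun p ↦ by rw [hb]; ring) hg'
      (by rw [hα, hβ]) hbsum
    rw [hα] at key
    simp only [Fin.prod_univ_three, show (Fin.succ 0 : Fin 4) = 1 from rfl,
      show (Fin.succ 1 : Fin 4) = 2 from rfl, show (Fin.succ 2 : Fin 4) = 3 from rfl] at key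
    push_cast at hbal'
    have e3 : b 1 + b 2 = a 0 + a 3 - d * δ := by rw [hb, hb]; linear_combination -hbal'
    have e2 : b 1 + b 3 = a 0 + a 2 - d * δ := by rw [hb, hb]; linear_combination -hbal'
    have e1 : b 2 + b 3 = a 0 + a 1 - d * δ := by rw [hb, hb]; linear_combination -hbal'
    have f (p : Fin 4) : shifted br δ (b 0 + b p) d =
        (-1) ^ d * shifted br δ (a 0 + a p - d * δ) d := by
      rw [← h.shifted_reflect, hb, hb]
      congr 1; ring
    have hcross := h.cross_mul_cross (α := α) (β := β) hg
    rw [f, f, f] at key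
    have hsplit (s : ℂ) : shifted br δ (s - d * δ) (M + d) =
        shifted br δ (s - d * δ) d * shifted br δ s M := by
      rw [add_comm M d, shifted_add, sub_add_cancel]
    have hsq : ((-1 : ℂ) ^ d) ^ 4 = 1 := by rw [← pow_mul, mul_comm, pow_mul]; norm_num
    have hsq' : ((-1 : ℂ) ^ M) ^ 2 = 1 := by rw [← pow_mul, mul_comm, pow_mul]; norm_num
    rw [e1, e2, e3, hsplit, hsplit, hsplit, pow_add]
    rw [mul_assoc _ (prefactor br δ b β y), key]
    generalize (∏ k, ∏ i, shifted br δ (y k - x i + δ / 2 - α i * δ) (β k) /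
          shifted br δ (y k - x i + δ / 2) (β k)) = R at *
    generalize (∏ i, ∏ k, shifted br δ (x i - y k + δ / 2 - β k * δ) (α i) /
          shifted br δ (x i - y k + δ / 2) (α i)) = R' at *
    generalize (-1 : ℂ) ^ d = s at *
    generalize (-1 : ℂ) ^ M = s' at *
    generalize shifted br δ (a 0 + a 1 - d * δ) d = A₁
    generalize shifted br δ (a 0 + a 2 - d * δ) d = A₂
    generalize shifted br δ (a 0 + a 3 - d * δ) d = A₃
    generalize shifted br δ (a 0 + a 1) M = B₁
    generalize shifted br δ (a 0 + a 2) M = B₂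
    generalize shifted br δ (a 0 + a 3) M = B₃
    generalize prefactor br δ a α x = P
    generalize series br δ a α β x y = S
    have : s' ^ 2 * s ^ 4 * (R * R') = 1 := by rw [hsq, hsq', hcross]; norm_num
    linear_combination -(A₁ * A₂ * A₃ * B₁ * B₂ * B₃ * P * S) * this

end IsThetaBracket

end EllipticC

end

/-! ### Continuity and density of generic data -/

noncomputable section

namespace EllipticC

open Filter Topology

section Continuity

variable {br : ℂ → ℂ} {δ : ℂ} {m n : ℕ} {α : Fin m → ℕ} {β : Fin n → ℕ}

@[fun_prop]
lemma continuous_shifted (hbr : Continuous br) {u : ℂ → ℂ} (hu : Continuous u) (d : ℕ) :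
    Continuous fun t ↦ shifted br δ (u t) d := by
  unfold shifted
  fun_prop

lemma shifted_ne_zero_of_le {u : ℂ} {d e : ℕ} (hde : d ≤ e) (he : shifted br δ u e ≠ 0) :
    shifted br δ u d ≠ 0 := by
  obtain ⟨k, rfl⟩ := Nat.exists_eq_add_of_le hde
  rw [shifted_add] at he
  exact left_ne_zero_of_mul he

variable {A : ℂ → Fin 4 → ℂ} {X : ℂ → Fin m → ℂ} {Y : ℂ → Fin n → ℂ} {t₀ : ℂ}

lemma continuousAt_prefactor (hbr : Continuous br) (hA : ∀ p, Continuous fun t ↦ A t p)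
    (hX : ∀ i, Continuous fun t ↦ X t i) (hd : DenomNeZero br δ (A t₀) α β (X t₀) (Y t₀)) :
    ContinuousAt (fun t ↦ prefactor br δ (A t) α (X t)) t₀ := by
  unfold prefactor
  refine .mul (tendsto_finsetProd _ fun i _ ↦ .div ?_ ?_ (hd.double_shifted i))
    (tendsto_finsetProd _ fun i _ ↦ tendsto_finsetProd _ fun j hj ↦
      .div ?_ ?_ (hd.add_shifted i j (Finset.mem_Ioi.mp hj)))
  all_goals exact Continuous.continuousAt (by fun_prop)

lemma continuousAt_term (hbr : Continuous br) (hA : ∀ p, Continuous fun t ↦ A t p)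
    (hX : ∀ i, Continuous fun t ↦ X t i) (hY : ∀ k, Continuous fun t ↦ Y t k)
    (hδ : ∀ d, shifted br δ δ d ≠ 0)
    (hd : DenomNeZero br δ (A t₀) α β (X t₀) (Y t₀)) {μ : Fin m → ℕ} (hμ : μ ≤ α) :
    ContinuousAt (fun t ↦ term br δ (A t) α β (X t) (Y t) μ) t₀ := by
  have hsub (i j : Fin m) : shifted br δ (X t₀ i - X t₀ j + δ) (μ i) ≠ 0 := by
    rcases eq_or_ne i j with rfl | hij
    · rw [sub_self, zero_add]; exact hδ _
    · exact shifted_ne_zero_of_le (hμ i) (hd.sub_shifted i j hij)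
  unfold term
  refine .mul (.mul (.mul (.mul
    (tendsto_finsetProd _ fun i _ ↦ tendsto_finsetProd _ fun p _ ↦
      .div ?_ ?_ (shifted_ne_zero_of_le (hμ i) (hd.param i p)))
    (tendsto_finsetProd _ fun i _ ↦ .div ?_ ?_ (hd.double i)))
    (tendsto_finsetProd _ fun i _ ↦ tendsto_finsetProd _ fun j hj ↦
      .div ?_ ?_ (mul_ne_zero (hd.add i j (Finset.mem_Ioi.mp hj))
        (hd.sub i j (Finset.mem_Ioi.mp hj)))))
    (tendsto_finsetProd _ fun i _ ↦ tendsto_finsetProd _ fun j _ ↦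
      .div ?_ ?_ (mul_ne_zero (shifted_ne_zero_of_le (hμ i) (hd.add_shifted' i j)) (hsub i j))))
    (tendsto_finsetProd _ fun i _ ↦ tendsto_finsetProd _ fun k _ ↦
      .div ?_ ?_ (mul_ne_zero (shifted_ne_zero_of_le (hμ i) (hd.cross_add i k))
        (shifted_ne_zero_of_le (hμ i) (hd.cross_sub i k))))
  all_goals exact Continuous.continuousAt (by fun_prop)

lemma continuousAt_series (hbr : Continuous br) (hA : ∀ p, Continuous fun t ↦ A t p)
    (hX : ∀ i, Continuous fun t ↦ X t i) (hY : ∀ k, Continuous fun t ↦ Y t k)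
    (hδ : ∀ d, shifted br δ δ d ≠ 0) (hd : DenomNeZero br δ (A t₀) α β (X t₀) (Y t₀)) :
    ContinuousAt (fun t ↦ series br δ (A t) α β (X t) (Y t)) t₀ :=
  tendsto_finsetSum _ fun _ hμ ↦
    continuousAt_term hbr hA hX hY hδ hd (Finset.mem_Icc.mp hμ).2

end Continuity

section Density

/-- A direction with zero sum along which every `a_p` and every `a_p + a_q` varies. -/
def paramDir : Fin 4 → ℂ := ![1 / 2, 3 / 2, 5 / 2, -9 / 2]

/-- The entries are half-odd integers, so they never cancel against the integer directions given to
the variables. -/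
lemma exists_paramDir (p : Fin 4) : ∃ l : ℤ, 2 * paramDir p = 2 * l + 1 := by
  fin_cases p
  · exact ⟨0, by simp [paramDir]⟩
  · exact ⟨1, by simp [paramDir]; norm_num⟩
  · exact ⟨2, by simp [paramDir]; norm_num⟩
  · exact ⟨-5, by simp [paramDir]; norm_num⟩

lemma int_add_paramDir_ne (k : ℤ) (p : Fin 4) : (k : ℂ) + paramDir p ≠ 0 := by
  intro hk
  obtain ⟨l, hl⟩ := exists_paramDir p
  have : ((2 * k + (2 * l + 1) : ℤ) : ℂ) = 0 := by push_cast; linear_combination 2 * hk - hl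
  have : 2 * k + (2 * l + 1) = 0 := by exact_mod_cast this
  omega

lemma int_sub_paramDir_ne (k : ℤ) (p : Fin 4) : (k : ℂ) - paramDir p ≠ 0 := by
  intro hk
  refine int_add_paramDir_ne (-k) p ?_
  push_cast
  linear_combination -hk

lemma paramDir_add_ne (p q : Fin 4) : paramDir p + paramDir q ≠ 0 := by
  fin_cases p <;> fin_cases q <;> simp [paramDir] <;> norm_num

lemma sum_paramDir : ∑ p, paramDir p = 0 := by
  rw [Fin.sum_univ_four]
  simp [paramDir]
  norm_num

variable {m n : ℕ}

/-- Along a suitable line through any point, all but countably many points are generic. -/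
lemma dense_setOf_generic {Λ : AddSubgroup ℂ} (hΛ : (Λ : Set ℂ).Countable) (a : Fin 4 → ℂ)
    (x : Fin m → ℂ) (y : Fin n → ℂ) :
    Dense {t : ℂ | Generic Λ (fun p ↦ a p + t * paramDir p)
      (fun i ↦ x i + t * ((i : ℕ) + 1 : ℤ)) fun k ↦ y k + t * (m + 1 + (k : ℕ) : ℤ)} := by
  -- A nonconstant affine function is injective, so it meets the countable set Λ for only countably
  -- many t.
  have key {f : ℂ → ℂ} (z w : ℂ) (hw : w ≠ 0) (hf : ∀ t, f t = z + t * w) :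
      ∀ᶠ t in cocountable, f t ∉ Λ := by
    rw [Filter.eventually_iff, mem_cocountable]
    refine (hΛ.preimage (f := f) fun s t hst ↦ ?_).mono fun t ht ↦ not_not.mp ht
    rw [hf, hf] at hst
    exact mul_right_cancel₀ hw (add_left_cancel hst)
  have cast {l : ℤ} (hl : l ≠ 0) : (l : ℂ) ≠ 0 := Int.cast_ne_zero.mpr hl
  suffices ∀ᶠ t : ℂ in cocountable, Generic Λ (fun p ↦ a p + t * paramDir p)
      (fun i ↦ x i + t * ((i : ℕ) + 1 : ℤ)) fun k ↦ y k + t * (m + 1 + (k : ℕ) : ℤ) by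
    rw [Filter.eventually_iff, mem_cocountable] at this
    simpa using this.dense_compl ℂ
  -- The directions i+1 and m+1+k are distinct positive integers, so all sums, and all differences
  -- for distinct variables, move with nonzero speed.
  have h1 : ∀ᶠ t : ℂ in cocountable, ∀ i : Fin m, 2 * (x i + t * ((i : ℕ) + 1 : ℤ)) ∉ Λ :=
    eventually_all.mpr fun i ↦ key (2 * x i) (2 * ((i : ℕ) + 1 : ℤ) : ℤ) (cast (by omega))
      fun t ↦ by push_cast; ring
  have h2 : ∀ᶠ t : ℂ in cocountable, ∀ k : Fin n, 2 * (y k + t * (m + 1 + (k : ℕ) : ℤ)) ∉ Λ :=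
    eventually_all.mpr fun k ↦ key (2 * y k) (2 * (m + 1 + (k : ℕ) : ℤ) : ℤ) (cast (by omega))
      fun t ↦ by push_cast; ring
  have h3 : ∀ᶠ t : ℂ in cocountable, ∀ i j : Fin m,
      x i + t * ((i : ℕ) + 1 : ℤ) + (x j + t * ((j : ℕ) + 1 : ℤ)) ∉ Λ :=
    eventually_all.mpr fun i ↦ eventually_all.mpr fun j ↦
      key (x i + x j) (((i : ℕ) + 1) + ((j : ℕ) + 1) : ℤ) (cast (by omega))
        fun t ↦ by push_cast; ring
  have h4 : ∀ᶠ t : ℂ in cocountable, ∀ i j : Fin m, i ≠ j →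
      x i + t * ((i : ℕ) + 1 : ℤ) - (x j + t * ((j : ℕ) + 1 : ℤ)) ∉ Λ :=
    eventually_all.mpr fun i ↦ eventually_all.mpr fun j ↦ eventually_imp_distrib_left.mpr fun hij ↦
      key (x i - x j) (((i : ℕ) + 1) - ((j : ℕ) + 1) : ℤ) (cast (by omega))
        fun t ↦ by push_cast; ring
  have h5 : ∀ᶠ t : ℂ in cocountable, ∀ k l : Fin n,
      y k + t * (m + 1 + (k : ℕ) : ℤ) + (y l + t * (m + 1 + (l : ℕ) : ℤ)) ∉ Λ :=
    eventually_all.mpr fun k ↦ eventually_all.mpr fun l ↦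
      key (y k + y l) ((m + 1 + (k : ℕ)) + (m + 1 + (l : ℕ)) : ℤ) (cast (by omega))
        fun t ↦ by push_cast; ring
  have h6 : ∀ᶠ t : ℂ in cocountable, ∀ k l : Fin n, k ≠ l →
      y k + t * (m + 1 + (k : ℕ) : ℤ) - (y l + t * (m + 1 + (l : ℕ) : ℤ)) ∉ Λ :=
    eventually_all.mpr fun k ↦ eventually_all.mpr fun l ↦ eventually_imp_distrib_left.mpr fun hkl ↦
      key (y k - y l) ((m + 1 + (k : ℕ)) - (m + 1 + (l : ℕ)) : ℤ) (cast (by omega))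
        fun t ↦ by push_cast; ring
  have h7 : ∀ᶠ t : ℂ in cocountable, ∀ (i : Fin m) (k : Fin n),
      x i + t * ((i : ℕ) + 1 : ℤ) + (y k + t * (m + 1 + (k : ℕ) : ℤ)) ∉ Λ :=
    eventually_all.mpr fun i ↦ eventually_all.mpr fun k ↦
      key (x i + y k) (((i : ℕ) + 1) + (m + 1 + (k : ℕ)) : ℤ) (cast (by omega))
        fun t ↦ by push_cast; ring
  have h8 : ∀ᶠ t : ℂ in cocountable, ∀ (i : Fin m) (k : Fin n),
      x i + t * ((i : ℕ) + 1 : ℤ) - (y k + t * (m + 1 + (k : ℕ) : ℤ)) ∉ Λ :=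
    eventually_all.mpr fun i ↦ eventually_all.mpr fun k ↦
      key (x i - y k) (((i : ℕ) + 1) - (m + 1 + (k : ℕ)) : ℤ) (cast (by omega))
        fun t ↦ by push_cast; ring
  have h9 (l : ℤ) (z : ℂ) : ∀ᶠ t : ℂ in cocountable, ∀ p,
      z + t * l + (a p + t * paramDir p) ∉ Λ :=
    eventually_all.mpr fun p ↦ key (z + a p) _ (int_add_paramDir_ne l p) fun t ↦ by ring
  have h10 (l : ℤ) (z : ℂ) : ∀ᶠ t : ℂ in cocountable, ∀ p,
      z + t * l - (a p + t * paramDir p) ∉ Λ :=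
    eventually_all.mpr fun p ↦ key (z - a p) _ (int_sub_paramDir_ne l p) fun t ↦ by ring
  have h11 : ∀ᶠ t : ℂ in cocountable, ∀ p q,
      a p + t * paramDir p + (a q + t * paramDir q) ∉ Λ :=
    eventually_all.mpr fun p ↦ eventually_all.mpr fun q ↦
      key (a p + a q) _ (paramDir_add_ne p q) fun t ↦ by ring
  filter_upwards [h1, h2, h3, h4, h5, h6, h7, h8,
    eventually_all.mpr fun i : Fin m ↦ h9 ((i : ℕ) + 1) (x i),
    eventually_all.mpr fun i : Fin m ↦ h10 ((i : ℕ) + 1) (x i),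
    eventually_all.mpr fun k : Fin n ↦ h9 (m + 1 + (k : ℕ)) (y k),
    eventually_all.mpr fun k : Fin n ↦ h10 (m + 1 + (k : ℕ)) (y k), h11]
    with t g1 g2 g3 g4 g5 g6 g7 g8 g9 g10 g11 g12 g13
  exact ⟨g1, g2, fun i j _ ↦ g3 i j, g4, fun k l _ ↦ g5 k l, g6, g7, g8, g9, g10, g11, g12, g13⟩

end Density

/-- The group generated by the lattice and `δ / 2`. -/
def extendedLattice (L : PeriodPair) (δ : ℂ) : AddSubgroup ℂ :=
  L.lattice.toAddSubgroup ⊔ AddSubgroup.zmultiples (δ / 2)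

lemma countable_extendedLattice (L : PeriodPair) (δ : ℂ) :
    (extendedLattice L δ : Set ℂ).Countable := by
  refine ((Set.countable_univ (α := L.lattice × ℤ)).image
    fun p ↦ (p.1 : ℂ) + p.2 • (δ / 2)).mono fun z hz ↦ ?_
  obtain ⟨u, hu, v, ⟨k, rfl⟩, rfl⟩ := AddSubgroup.mem_sup.mp hz
  exact ⟨(⟨u, hu⟩, k), trivial, rfl⟩

lemma isThetaBracket_bracket (L : PeriodPair) (c : ℂ) {δ : ℂ} (hδ : δ ≠ 0)
    (hδL : ∀ k : ℤ, (k : ℂ) * δ ∈ L.lattice → (k : ℂ) * δ = 0) :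
    IsThetaBracket (bracket L c) δ (extendedLattice L δ) where
  neg := bracket_neg c
  three_term := three_term_bracket c
  ne_zero _ hu h0 := hu (le_sup_left (α := AddSubgroup ℂ) (bracket_eq_zero_iff.mp h0))
  half_mem := le_sup_right (α := AddSubgroup ℂ) (AddSubgroup.mem_zmultiples _)
  int_mul_ne_zero k hk h0 :=
    mul_ne_zero (Int.cast_ne_zero.mpr hk) hδ (hδL k (bracket_eq_zero_iff.mp h0))

end EllipticC

end

/-! ### From generic data to all admissible data -/

theorem mainTheorem1 (L : PeriodPair) (c δ : ℂ) (hδ : δ ≠ 0)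
    (hδL : ∀ k : ℤ, (k : ℂ) * δ ∈ L.lattice → (k : ℂ) * δ = 0)
    (a b : Fin 4 → ℂ) (hb : ∀ p, b p = δ / 2 - a p)
    (m n M N : ℕ) (α : Fin m → ℕ) (β : Fin n → ℕ)
    (hα : ∑ i, α i = M) (hβ : ∑ k, β k = N)
    (hbal : ∑ p, a p = ((N : ℂ) - (M : ℂ) + 1) * δ)
    (x : Fin m → ℂ) (y : Fin n → ℂ)
    (hx : EllipticC.DenomNeZero (EllipticC.bracket L c) δ a α β x y)
    (hy : EllipticC.DenomNeZero (EllipticC.bracket L c) δ b β α y x)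
    (hxy : ∀ k i,
      EllipticC.shifted (EllipticC.bracket L c) δ (y k - x i + δ / 2) (β k) ≠ 0) :
    (∏ p ∈ Finset.Ioi (0 : Fin 4), ∏ q ∈ Finset.Ioi p,
        EllipticC.shifted (EllipticC.bracket L c) δ (b p + b q) N) *
      EllipticC.prefactor (EllipticC.bracket L c) δ a α x *
      EllipticC.series (EllipticC.bracket L c) δ a α β x y =
    (-1) ^ N *
      (∏ p ∈ Finset.Ioi (0 : Fin 4),
        EllipticC.shifted (EllipticC.bracket L c) δ (a 0 + a p) M) *
      (∏ k, ∏ i,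
        EllipticC.shifted (EllipticC.bracket L c) δ (y k - x i + δ / 2 - α i * δ) (β k) /
          EllipticC.shifted (EllipticC.bracket L c) δ (y k - x i + δ / 2) (β k)) *
      EllipticC.prefactor (EllipticC.bracket L c) δ b β y *
      EllipticC.series (EllipticC.bracket L c) δ b β α y x := by
  have h := EllipticC.isThetaBracket_bracket L c hδ hδL
  have hbr := EllipticC.continuous_bracket (L := L) c
  have hδs (d : ℕ) : EllipticC.shifted (EllipticC.bracket L c) δ δ d ≠ 0 := h.shifted_delta_ne d
  -- The line through the given data keeps b_p = δ/2 - a_p and, since the directions of the a_p sum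
  -- to zero, the balancing condition.
  let A (t : ℂ) (p : Fin 4) : ℂ := a p + t * EllipticC.paramDir p
  let B (t : ℂ) (p : Fin 4) : ℂ := b p - t * EllipticC.paramDir p
  let X (t : ℂ) (i : Fin m) : ℂ := x i + t * ((i : ℕ) + 1 : ℤ)
  let Y (t : ℂ) (k : Fin n) : ℂ := y k + t * (m + 1 + (k : ℕ) : ℤ)
  have hA (p) : Continuous fun t ↦ A t p := by fun_prop
  have hB (p) : Continuous fun t ↦ B t p := by fun_prop
  have hX (i) : Continuous fun t ↦ X t i := by fun_prop
  have hY (k) : Continuous fun t ↦ Y t k := by fun_prop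
  have A0 : A 0 = a := by simp [A]
  have B0 : B 0 = b := by simp [B]
  have X0 : X 0 = x := by simp [X]
  have Y0 : Y 0 = y := by simp [Y]
  have hdense := EllipticC.dense_setOf_generic (EllipticC.countable_extendedLattice L δ) a x y
  have hx' : EllipticC.DenomNeZero (EllipticC.bracket L c) δ (A 0) α β (X 0) (Y 0) := by
    rwa [A0, X0, Y0]
  have hy' : EllipticC.DenomNeZero (EllipticC.bracket L c) δ (B 0) β α (Y 0) (X 0) := by
    rwa [B0, X0, Y0]
  have hgen (t : ℂ) (ht : EllipticC.Generic (EllipticC.extendedLattice L δ) (A t) (X t) (Y t)) :=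
    h.duality_of_generic (b := B t) (fun p ↦ by simp only [A, B, hb]; ring) ht hα hβ <| by
      simp only [A, Finset.sum_add_distrib, ← Finset.mul_sum, EllipticC.sum_paramDir, mul_zero,
        add_zero, hbal]
  have key := (mem_closure_iff_nhdsWithin_neBot.mp (hdense 0))
  -- Both sides are continuous at t = 0 because no denominator vanishes there; they agree at generic
  -- t, which accumulate at 0.
  have lim := tendsto_nhds_unique_of_eventuallyEq (l := nhdsWithin (0 : ℂ) _)
    (ContinuousAt.continuousWithinAt ?_) (ContinuousAt.continuousWithinAt ?_)
    (eventually_nhdsWithin_of_forall (s := {t : ℂ | EllipticC.Generic _ (A t) (X t) (Y t)}) hgen)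
  · simpa only [A0, B0, X0, Y0] using lim
  · refine .mul (.mul ?_ (EllipticC.continuousAt_prefactor hbr hA hX hx'))
      (EllipticC.continuousAt_series hbr hA hX hY hδs hx')
    exact Continuous.continuousAt (by fun_prop)
  · refine .mul (.mul (.mul ?_ (tendsto_finsetProd _ fun k _ ↦ tendsto_finsetProd _ fun i _ ↦
      .div ?_ ?_ ?_)) (EllipticC.continuousAt_prefactor hbr hB hY hy'))
      (EllipticC.continuousAt_series hbr hB hY hX hδs hy')
    · exact Continuous.continuousAt (by fun_prop)
    · exact Continuous.continuousAt (by fun_prop)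
    · exact Continuous.continuousAt (by fun_prop)
    · rw [X0, Y0]; exact hxy k i
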